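/- **Setting.** Let $\mathbf G\subset \mathrm{GL}_N$ be a semisimple linear algebraic group defined over $\mathbb Q$ and split over $\mathbb R$, $G=\mathbf G(\mathbb R)$, $\mathfrak g$ its Lie algebra (over $\mathbb Q$), and let $\Gamma<G$ be a subgroup commensurable with $\mathbf G(\mathbb R)\cap \mathrm{GL}_N(\mathbb Z)$. Fix a lattice $\mathfrak g_{\mathbb Z}\subset\mathfrak g$ that is stable under $\mathrm{Ad}(\Gamma)$ and under the bracket, and a $\mathbf G$-invariant nondegenerate symmetric bilinear form $B$ on $\mathfrak g\otimes\mathbb R$ with $B(\mathfrak g_{\mathbb Z},\mathfrak g_{\mathbb Z})\subset\mathbb Z$ (for example the trace form of a faithful representation, if integral on $\mathfrak g_{\mathbb Z}$). Let $\mathfrak h$ be an $\mathbb R$-split Cartan subalgebra of $\mathfrak g\otimes\mathbb R$, $H$ its centralizer in $G$, $\Phi$ the set of roots of $\mathfrak h$, $r=\dim\mathfrak h$, and fix a Haar measure on $H$. An orbit $\Gamma gH\subset X=\Gamma\backslash G$ is *periodic* if it carries a nonzero finite $H$-invariant measure. Its *volume measure* is the image, under $a\mapsto\Gamma ga$, of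 the Haar measure restricted to a fundamental domain of $H\cap g^{-1}\Gamma g$ in $H$, and its *volume* is the total mass of this measure, i.e. the covolume of $H\cap g^{-1}\Gamma g$ in $H$. Its *discriminant* is the least positive integer $n$ such that $n\,\iota(\mathfrak t)\in \bigwedge^r\mathfrak g_{\mathbb Z}\otimes\bigwedge^r\mathfrak g_{\mathbb Z}$, where $\mathfrak t=\mathrm{Ad}(g)\mathfrak h$ and $$\iota(\mathfrak t)=\frac{w\otimes w}{\det (B(e_i,e_j))_{i,j=1}^r},\qquad w=e_1\wedge\dots\wedge e_r,$$ for any basis $e_1,\dots,e_r$ of $\mathfrak t$. **Theorem.** Let $x\in\mathfrak h$, $a(t)=\exp(tx)$ and $\rho>0$. For every $i$ let $Y_i=\{y_{i,1}H,\dots,y_{i,n_i}H\}$ be a finite collection of (distinct) periodic $H$-orbits in $X$, and let $\Delta_i\to\infty$ be real numbers such that 1. the discriminants of all $y_{i,j}H$, $1\le j\le n_i$, are at most $\Delta_i$; 2. the total volume of the orbits in $Y_i$ is bigger than $\Delta_i^{\rho}$. Let $\mu_i$ be the sum of the volume measures of the orbits in $Y_i$, divided by their total volume, and suppose that 3. $\mu_i\to\mu$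 in the weak$^*$ topology (tested on compactly supported continuous functions) for some probability measure $\mu$ on $X$. Then $\mu$ is invariant under right translation by $a(t)$ for all $t\in\mathbb R$, and the metric (Kolmogorov–Sinai) entropy of this flow with respect to $\mu$, that is, the entropy of its time-one map, satisfies $$h_\mu(a(\cdot))\ \ge\ \tfrac12\,\rho\,\min_{\alpha\in\Phi}|\alpha(x)| .$$ If instead of 1. one assumes that the discriminants of all $y_{i,j}H$, $1\le j\le n_i$, are equal to $\Delta_i$, then $$h_\mu(a(\cdot))\ \ge\ \rho\,\min_{\alpha\in\Phi}|\alpha(x)| .$$ -/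

import Mathlib

open MeasureTheory Filter Topology
open scoped ENNReal TensorProduct

attribute [local instance] LieRing.ofAssociativeRing

noncomputable section

/-! ## Linear algebraic groups over the rationals -/

/-- The values of the coordinate functions `x_{ij}` at a square matrix. -/
def matEntries {N : ℕ} {K : Type} (A : Matrix (Fin N) (Fin N) K) : Fin N × Fin N → K :=
  fun ij => A ij.1 ij.2

/-- A linear algebraic group `𝐆` over `ℚ`, embedded in `GL_N`: the group `𝐆(ℂ)` is a subgroup of
`GL_N(ℂ)` and it is cut out by polynomial equations with rational coefficients. -/
structure LinAlgGroup (N : ℕ) where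
  /-- the group of complex points -/
  carrier : Subgroup (GL (Fin N) ℂ)
  definedOverRat : ∃ S : Set (MvPolynomial (Fin N × Fin N) ℚ), ∀ g : GL (Fin N) ℂ,
    g ∈ carrier ↔ ∀ p ∈ S, MvPolynomial.aeval (matEntries (g : Matrix (Fin N) (Fin N) ℂ)) p = 0

namespace LinAlgGroup

variable {N : ℕ} (G : LinAlgGroup N)

/-- The real points, as a subgroup of `GL_N(ℝ)`. -/
def realSubgroup : Subgroup (GL (Fin N) ℝ) :=
  G.carrier.comap (Matrix.GeneralLinearGroup.map Complex.ofRealHom)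

/-- The group `𝐆(ℝ)`, with its topology as a subgroup of `GL_N(ℝ)` and its Borel structure. -/
def RealPoints : Type := G.realSubgroup

instance : Group G.RealPoints := inferInstanceAs (Group G.realSubgroup)
instance : TopologicalSpace G.RealPoints := inferInstanceAs (TopologicalSpace G.realSubgroup)
instance : IsTopologicalGroup G.RealPoints := inferInstanceAs (IsTopologicalGroup G.realSubgroup)
instance : MeasurableSpace G.RealPoints := borel _
instance : BorelSpace G.RealPoints := ⟨rfl⟩

/-- The inclusion `𝐆(ℝ) → GL_N(ℝ)`. -/
def toGL : G.RealPoints →* GL (Fin N) ℝ := G.realSubgroup.subtype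

/-- The group `𝐆(ℝ) ∩ GL_N(ℤ)`. -/
def integerPoints : Subgroup G.RealPoints :=
  (Matrix.GeneralLinearGroup.map (n := Fin N) (Int.castRingHom ℝ)).range.comap G.toGL

/-- The ideal of all real polynomials in the matrix entries that vanish on `𝐆`. -/
def vanishingIdeal : Ideal (MvPolynomial (Fin N × Fin N) ℝ) where
  carrier := {p | ∀ g ∈ G.carrier,
    MvPolynomial.aeval (matEntries (g : Matrix (Fin N) (Fin N) ℂ)) p = 0}
  add_mem' := fun hp hq g hg => by rw [map_add, hp g hg, hq g hg, add_zero]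
  zero_mem' := fun g _ => map_zero _
  smul_mem' := fun c p hp g hg => by rw [smul_eq_mul, map_mul, hp g hg, mul_zero]

end LinAlgGroup

/-- The left-invariant vector field on the space of matrices attached to a matrix `X`, as a
derivation of the polynomial ring: `(D_X p)(g)` is the derivative at `s = 0` of `p (g (1 + s X))`,
that is, `D_X x_{ij} = ∑ₖ x_{ik} X_{kj}`. -/
def leftInvDer {N : ℕ} (X : Matrix (Fin N) (Fin N) ℝ) :
    Derivation ℝ (MvPolynomial (Fin N × Fin N) ℝ) (MvPolynomial (Fin N × Fin N) ℝ) :=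
  MvPolynomial.mkDerivation ℝ fun ij =>
    ∑ k, MvPolynomial.X (ij.1, k) * MvPolynomial.C (X k ij.2)

theorem leftInvDer_X {N : ℕ} (X : Matrix (Fin N) (Fin N) ℝ) (ij : Fin N × Fin N) :
    leftInvDer X (MvPolynomial.X ij) =
      ∑ k, MvPolynomial.X (ij.1, k) * MvPolynomial.C (X k ij.2) :=
  MvPolynomial.mkDerivation_X _ _ _

theorem leftInvDer_add {N : ℕ} (X Y : Matrix (Fin N) (Fin N) ℝ) :
    leftInvDer (X + Y) = leftInvDer X + leftInvDer Y := by
  apply MvPolynomial.derivation_ext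
  intro ij
  simp [leftInvDer_X, mul_add, Finset.sum_add_distrib]

theorem leftInvDer_smul {N : ℕ} (c : ℝ) (X : Matrix (Fin N) (Fin N) ℝ) :
    leftInvDer (c • X) = c • leftInvDer X := by
  apply MvPolynomial.derivation_ext
  intro ij
  simp [leftInvDer_X, Finset.smul_sum, MvPolynomial.smul_eq_C_mul, mul_left_comm]

theorem leftInvDer_zero {N : ℕ} :
    leftInvDer (0 : Matrix (Fin N) (Fin N) ℝ) = 0 := by
  apply MvPolynomial.derivation_ext
  intro ij
  simp [leftInvDer_X]

theorem leftInvDer_lie {N : ℕ} (X Y : Matrix (Fin N) (Fin N) ℝ) :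
    leftInvDer ⁅X, Y⁆ = ⁅leftInvDer X, leftInvDer Y⁆ := by
  have key : ∀ (A B : Matrix (Fin N) (Fin N) ℝ) (ij : Fin N × Fin N),
      leftInvDer A (leftInvDer B (MvPolynomial.X ij)) =
        ∑ k, MvPolynomial.X (ij.1, k) * MvPolynomial.C ((A * B) k ij.2) := by
    intro A B ij
    simp only [leftInvDer_X, map_sum, Derivation.leibniz, Matrix.mul_apply, map_mul,
      Finset.mul_sum, smul_eq_mul]
    have h0 : ∀ a : ℝ, leftInvDer A (MvPolynomial.C a) = 0 := fun a =>
      Derivation.map_algebraMap _ a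
    simp only [h0, mul_zero, zero_add]
    rw [Finset.sum_comm]
    refine Finset.sum_congr rfl fun k _ => Finset.sum_congr rfl fun l _ => ?_
    ring
  apply MvPolynomial.derivation_ext
  intro ij
  rw [Derivation.commutator_apply, key, key, leftInvDer_X, ← Finset.sum_sub_distrib]
  refine Finset.sum_congr rfl fun k _ => ?_
  rw [Ring.lie_def, Matrix.sub_apply, map_sub, mul_sub]

namespace LinAlgGroup

variable {N : ℕ} (G : LinAlgGroup N)

/-- The Lie algebra `𝔤 ⊗ ℝ` of `𝐆(ℝ)`: the matrices whose left-invariant vector field is tangent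
to `𝐆`, i.e. whose left-invariant derivation preserves the ideal of `𝐆`. -/
def lieAlg : LieSubalgebra ℝ (Matrix (Fin N) (Fin N) ℝ) where
  carrier := {X | ∀ p ∈ G.vanishingIdeal, leftInvDer X p ∈ G.vanishingIdeal}
  add_mem' := fun hX hY p hp => by
    rw [leftInvDer_add]
    exact G.vanishingIdeal.add_mem (hX p hp) (hY p hp)
  zero_mem' := fun p _ => by
    rw [leftInvDer_zero]
    exact G.vanishingIdeal.zero_mem
  smul_mem' := fun c X hX p hp => by
    rw [leftInvDer_smul, Derivation.smul_apply, MvPolynomial.smul_eq_C_mul]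
    exact G.vanishingIdeal.mul_mem_left _ (hX p hp)
  lie_mem' := fun {X Y} hX hY p hp => by
    rw [leftInvDer_lie, Derivation.commutator_apply]
    exact G.vanishingIdeal.sub_mem (hX _ (hY p hp)) (hY _ (hX p hp))

end LinAlgGroup

/-- The substitution `p ↦ p(x A)` of right multiplication by `A` in the matrix entries. -/
def rightSubst {N : ℕ} (A : Matrix (Fin N) (Fin N) ℝ) :
    MvPolynomial (Fin N × Fin N) ℝ →ₐ[ℝ] MvPolynomial (Fin N × Fin N) ℝ :=
  MvPolynomial.aeval fun ij => ∑ k, MvPolynomial.X (ij.1, k) * MvPolynomial.C (A k ij.2)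

theorem rightSubst_X {N : ℕ} (A : Matrix (Fin N) (Fin N) ℝ) (ij : Fin N × Fin N) :
    rightSubst A (MvPolynomial.X ij) =
      ∑ k, MvPolynomial.X (ij.1, k) * MvPolynomial.C (A k ij.2) :=
  MvPolynomial.aeval_X _ _

theorem rightSubst_mul {N : ℕ} (A B : Matrix (Fin N) (Fin N) ℝ)
    (p : MvPolynomial (Fin N × Fin N) ℝ) :
    rightSubst A (rightSubst B p) = rightSubst (A * B) p := by
  have : (rightSubst A).comp (rightSubst B) = rightSubst (A * B) := by
    apply MvPolynomial.algHom_ext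
    intro ij
    simp only [AlgHom.comp_apply, rightSubst_X, map_sum, map_mul, Matrix.mul_apply, Finset.mul_sum]
    have h0 : ∀ a : ℝ, rightSubst A (MvPolynomial.C a) = MvPolynomial.C a := fun a =>
      (rightSubst A).commutes a
    simp only [h0, Finset.sum_mul]
    rw [Finset.sum_comm]
    refine Finset.sum_congr rfl fun k _ => Finset.sum_congr rfl fun l _ => ?_
    ring
  exact DFunLike.congr_fun this p

theorem rightSubst_one {N : ℕ} (p : MvPolynomial (Fin N × Fin N) ℝ) :
    rightSubst (1 : Matrix (Fin N) (Fin N) ℝ) p = p := by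
  have : rightSubst (1 : Matrix (Fin N) (Fin N) ℝ) = AlgHom.id ℝ _ := by
    apply MvPolynomial.algHom_ext
    intro ij
    rw [rightSubst_X, Finset.sum_eq_single ij.2]
    · simp
    · intro k _ hk
      simp [Matrix.one_apply_ne hk]
    · simp
  exact DFunLike.congr_fun this p

/-- `D_X (p(x A)) = (D_Y p)(x A)` when `X A = A Y`. -/
theorem leftInvDer_rightSubst {N : ℕ} (A X Y : Matrix (Fin N) (Fin N) ℝ) (h : X * A = A * Y)
    (p : MvPolynomial (Fin N × Fin N) ℝ) :
    leftInvDer X (rightSubst A p) = rightSubst A (leftInvDer Y p) := by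
  have hC : ∀ (Z : Matrix (Fin N) (Fin N) ℝ) (a : ℝ), leftInvDer Z (MvPolynomial.C a) = 0 :=
    fun Z a => Derivation.map_algebraMap _ a
  have hS : ∀ a : ℝ, rightSubst A (MvPolynomial.C a) = MvPolynomial.C a := fun a =>
    (rightSubst A).commutes a
  have hlin : ∀ (B C : Matrix (Fin N) (Fin N) ℝ) (ij : Fin N × Fin N),
      ∑ k, (∑ l, MvPolynomial.X (R := ℝ) (ij.1, l) * MvPolynomial.C (B l k)) *
          MvPolynomial.C (C k ij.2) =
        ∑ l, MvPolynomial.X (ij.1, l) * MvPolynomial.C ((B * C) l ij.2) := by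
    intro B C ij
    simp only [Matrix.mul_apply, map_sum, map_mul, Finset.mul_sum, Finset.sum_mul]
    rw [Finset.sum_comm]
    refine Finset.sum_congr rfl fun k _ => Finset.sum_congr rfl fun l _ => ?_
    ring
  induction p using MvPolynomial.induction_on with
  | C a => rw [hS, hC, hC, map_zero]
  | add p q hp hq => rw [map_add, map_add, map_add, map_add, hp, hq]
  | mul_X p ij hp =>
    have hX : leftInvDer X (rightSubst A (MvPolynomial.X ij)) =
        rightSubst A (leftInvDer Y (MvPolynomial.X ij)) := by
      rw [rightSubst_X, leftInvDer_X]
      simp only [map_sum, Derivation.leibniz, map_mul, hC, hS, smul_eq_mul,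
        leftInvDer_X, rightSubst_X]
      rw [hlin A Y ij, ← h, ← hlin X A ij]
      refine Finset.sum_congr rfl fun k _ => ?_
      ring
    rw [map_mul, Derivation.leibniz, Derivation.leibniz, hX, hp]
    simp only [smul_eq_mul, map_add, map_mul]

namespace LinAlgGroup

variable {N : ℕ} (G : LinAlgGroup N)

theorem rightSubst_mem (g : G.RealPoints) {p : MvPolynomial (Fin N × Fin N) ℝ}
    (hp : p ∈ G.vanishingIdeal) :
    rightSubst (G.toGL g : Matrix (Fin N) (Fin N) ℝ) p ∈ G.vanishingIdeal := by
  intro h hh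
  have hg : Matrix.GeneralLinearGroup.map Complex.ofRealHom (G.toGL g) ∈ G.carrier := g.2
  have := hp _ (G.carrier.mul_mem hh hg)
  rw [← this, rightSubst, ← AlgHom.comp_apply]
  congr 1
  apply MvPolynomial.algHom_ext
  intro ij
  simp [matEntries, Matrix.mul_apply]

theorem conj_mem (g : G.RealPoints) {X : Matrix (Fin N) (Fin N) ℝ} (hX : X ∈ G.lieAlg) :
    (G.toGL g : Matrix (Fin N) (Fin N) ℝ) * X * (G.toGL g⁻¹ : Matrix (Fin N) (Fin N) ℝ)
      ∈ G.lieAlg := by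
  intro p hp
  have h1 : (G.toGL g⁻¹ : Matrix (Fin N) (Fin N) ℝ) * (G.toGL g : Matrix (Fin N) (Fin N) ℝ) = 1 := by
    rw [← Units.val_mul, ← map_mul, inv_mul_cancel, map_one, Units.val_one]
  have h2 : (G.toGL g : Matrix (Fin N) (Fin N) ℝ) * (G.toGL g⁻¹ : Matrix (Fin N) (Fin N) ℝ) = 1 := by
    rw [← Units.val_mul, ← map_mul, mul_inv_cancel, map_one, Units.val_one]
  have h3 := leftInvDer_rightSubst (G.toGL g⁻¹ : Matrix (Fin N) (Fin N) ℝ) X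
    ((G.toGL g : Matrix (Fin N) (Fin N) ℝ) * X * (G.toGL g⁻¹ : Matrix (Fin N) (Fin N) ℝ))
    (by rw [← mul_assoc, ← mul_assoc, h1, one_mul]) p
  have h4 := G.rightSubst_mem g (hX _ (G.rightSubst_mem g⁻¹ hp))
  rw [h3, rightSubst_mul, h2, rightSubst_one] at h4
  exact h4

/-- The adjoint action of `𝐆(ℝ)` on its Lie algebra, `Ad(g) X = g X g⁻¹`. -/
def Ad (g : G.RealPoints) : G.lieAlg →ₗ[ℝ] G.lieAlg where
  toFun X := ⟨(G.toGL g : Matrix (Fin N) (Fin N) ℝ) * X * (G.toGL g⁻¹ : Matrix (Fin N) (Fin N) ℝ),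
    G.conj_mem g X.2⟩
  map_add' X Y := Subtype.ext (by simp [mul_add, add_mul])
  map_smul' c X := Subtype.ext (by simp)

end LinAlgGroup

/-! ## The exponential map -/

theorem hasDerivAt_eval_exp {N : ℕ} (X : Matrix (Fin N) (Fin N) ℝ)
    (p : MvPolynomial (Fin N × Fin N) ℝ) (t : ℝ) :
    HasDerivAt (fun s : ℝ => MvPolynomial.eval (matEntries (NormedSpace.exp (s • X))) p)
      (MvPolynomial.eval (matEntries (NormedSpace.exp (t • X))) (leftInvDer X p)) t := by
  have hent : ∀ ij : Fin N × Fin N, HasDerivAt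
      (fun s : ℝ => (NormedSpace.exp (s • X) : Matrix (Fin N) (Fin N) ℝ) ij.1 ij.2)
      ((NormedSpace.exp (t • X) * X : Matrix (Fin N) (Fin N) ℝ) ij.1 ij.2) t := by
    intro ij
    let _ : NormedRing (Matrix (Fin N) (Fin N) ℝ) := Matrix.linftyOpNormedRing
    let _ : NormedAlgebra ℝ (Matrix (Fin N) (Fin N) ℝ) := Matrix.linftyOpNormedAlgebra
    have h := hasDerivAt_exp_smul_const X t
    have h1 := hasDerivAt_pi.1 h ij.1
    exact hasDerivAt_pi.1 h1 ij.2
  induction p using MvPolynomial.induction_on with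
  | C a =>
    have h0 : leftInvDer X (MvPolynomial.C a) = 0 := Derivation.map_algebraMap _ a
    simpa [h0] using hasDerivAt_const t a
  | add p q hp hq =>
    simp only [map_add]
    exact hp.fun_add hq
  | mul_X p ij hp =>
    have h := hp.fun_mul (hent ij)
    simp only [map_mul, MvPolynomial.eval_X, matEntries]
    refine h.congr_deriv ?_
    simp only [Derivation.leibniz, map_add, smul_eq_mul, map_mul, leftInvDer_X, map_sum,
      MvPolynomial.eval_C, MvPolynomial.eval_X, matEntries, Matrix.mul_apply]
    ring

theorem analyticAt_eval_exp {N : ℕ} (X : Matrix (Fin N) (Fin N) ℝ)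
    (p : MvPolynomial (Fin N × Fin N) ℝ) (t : ℝ) :
    AnalyticAt ℝ (fun s : ℝ => MvPolynomial.eval (matEntries (NormedSpace.exp (s • X))) p) t := by
  have hent : ∀ ij : Fin N × Fin N, AnalyticAt ℝ
      (fun s : ℝ => (NormedSpace.exp (s • X) : Matrix (Fin N) (Fin N) ℝ) ij.1 ij.2) t := by
    intro ij
    let _ : NormedRing (Matrix (Fin N) (Fin N) ℝ) := Matrix.linftyOpNormedRing
    let _ : NormedAlgebra ℝ (Matrix (Fin N) (Fin N) ℝ) := Matrix.linftyOpNormedAlgebra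
    have h1 : AnalyticAt ℝ (fun s : ℝ => NormedSpace.exp (s • X)) t :=
      AnalyticAt.fun_comp (g := NormedSpace.exp) (f := fun s : ℝ => s • X)
        (NormedSpace.exp_analytic (t • X)) (analyticAt_id.fun_smul analyticAt_const)
    let L : Matrix (Fin N) (Fin N) ℝ →ₗ[ℝ] ℝ := Matrix.entryLinearMap ℝ ℝ ij.1 ij.2
    exact (L.toContinuousLinearMap.analyticAt _).fun_comp h1
  induction p using MvPolynomial.induction_on with
  | C a => simpa using analyticAt_const
  | add p q hp hq =>
    simp only [map_add]
    exact hp.fun_add hq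
  | mul_X p ij hp =>
    simp only [map_mul, MvPolynomial.eval_X]
    exact hp.fun_mul (hent ij)

namespace LinAlgGroup

variable {N : ℕ} (G : LinAlgGroup N)

theorem eval_one_eq_zero {p : MvPolynomial (Fin N × Fin N) ℝ} (hp : p ∈ G.vanishingIdeal) :
    MvPolynomial.eval (matEntries (1 : Matrix (Fin N) (Fin N) ℝ)) p = 0 := by
  have h := hp 1 G.carrier.one_mem
  have h2 : matEntries ((1 : GL (Fin N) ℂ) : Matrix (Fin N) (Fin N) ℂ) =
      fun ij => (algebraMap ℝ ℂ) (matEntries (1 : Matrix (Fin N) (Fin N) ℝ) ij) := by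
    funext ij
    by_cases hij : ij.1 = ij.2 <;> simp [matEntries, Matrix.one_apply, hij]
  rw [h2] at h
  have h3 := MvPolynomial.aeval_algebraMap_apply ℂ (matEntries (1 : Matrix (Fin N) (Fin N) ℝ)) p
  rw [show (fun ij => (algebraMap ℝ ℂ) (matEntries (1 : Matrix (Fin N) (Fin N) ℝ) ij)) =
    (algebraMap ℝ ℂ) ∘ matEntries (1 : Matrix (Fin N) (Fin N) ℝ) from rfl] at h
  rw [h] at h3
  rw [← MvPolynomial.coe_aeval_eq_eval]
  exact (map_eq_zero _).1 h3.symm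

theorem eval_exp_eq_zero {X : Matrix (Fin N) (Fin N) ℝ} (hX : X ∈ G.lieAlg)
    {p : MvPolynomial (Fin N × Fin N) ℝ} (hp : p ∈ G.vanishingIdeal) :
    MvPolynomial.eval (matEntries (NormedSpace.exp X)) p = 0 := by
  set F : MvPolynomial (Fin N × Fin N) ℝ → ℝ → ℝ := fun q s =>
    MvPolynomial.eval (matEntries (NormedSpace.exp (s • X))) q with hF
  have hder : ∀ q, deriv (F q) = F (leftInvDer X q) := fun q =>
    funext fun t => (hasDerivAt_eval_exp X q t).deriv
  have hiter : ∀ (n : ℕ) (q), q ∈ G.vanishingIdeal → iteratedDeriv n (F q) 0 = 0 := by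
    intro n
    induction n with
    | zero =>
      intro q hq
      simpa [hF] using G.eval_one_eq_zero hq
    | succ n ih =>
      intro q hq
      rw [iteratedDeriv_succ', hder]
      exact ih _ (hX q hq)
  have hs := (analyticAt_eval_exp X p 0).hasFPowerSeriesAt
  have hz : (fun n : ℕ => iteratedDeriv n (F p) 0 / n.factorial) = 0 := by
    funext n
    simp [hiter n p hp]
  have hs' : HasFPowerSeriesAt (F p) (0 : FormalMultilinearSeries ℝ ℝ ℝ) 0 := by
    have h0 : FormalMultilinearSeries.ofScalars ℝ
        (fun n : ℕ => iteratedDeriv n (F p) 0 / n.factorial) = 0 := by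
      rw [hz]
      ext n
      simp [FormalMultilinearSeries.ofScalars]
    rw [← h0]
    exact hs
  have hev : F p =ᶠ[𝓝 0] 0 := hs'.eventually_eq_zero
  have hall : F p = 0 := AnalyticOnNhd.eq_of_eventuallyEq (𝕜 := ℝ) (E := ℝ) (F := ℝ) (z₀ := 0)
    (fun t _ => analyticAt_eval_exp X p t)
    (fun t _ => (analyticAt_const : AnalyticAt ℝ (fun _ : ℝ => (0 : ℝ)) t)) hev
  have := congrFun hall 1
  simpa [hF] using this

/-- The exponential map of `𝐆(ℝ)`, given by the matrix exponential. -/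
def exp (X : G.lieAlg) : G.RealPoints :=
  ⟨(Matrix.isUnit_exp (X : Matrix (Fin N) (Fin N) ℝ)).unit, by
    obtain ⟨S, hS⟩ := G.definedOverRat
    change Matrix.GeneralLinearGroup.map Complex.ofRealHom _ ∈ G.carrier
    rw [hS]
    intro p hp
    have hmem : MvPolynomial.map (algebraMap ℚ ℝ) p ∈ G.vanishingIdeal := by
      intro g hg
      rw [MvPolynomial.aeval_map_algebraMap]
      exact (hS g).1 hg p hp
    have h0 := G.eval_exp_eq_zero X.2 hmem
    rw [← MvPolynomial.coe_aeval_eq_eval] at h0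
    change MvPolynomial.aeval _ _ = 0 at h0
    rw [MvPolynomial.aeval_map_algebraMap] at h0
    have h1 := MvPolynomial.aeval_algebraMap_apply ℂ
      (matEntries (NormedSpace.exp (X : Matrix (Fin N) (Fin N) ℝ))) p
    rw [h0, map_zero] at h1
    exact h1⟩

theorem exp_val (X : G.lieAlg) :
    (G.toGL (G.exp X) : Matrix (Fin N) (Fin N) ℝ) = NormedSpace.exp X.1 := rfl

end LinAlgGroup

/-! ## Semisimplicity, split Cartan subgroups, roots -/

namespace LinAlgGroup

variable {N : ℕ} (G : LinAlgGroup N)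

/-- `𝐆` is semisimple: its Lie algebra is semisimple, i.e. has trivial solvable radical (connectedness
is not required). -/
def IsSemisimple : Prop := LieAlgebra.HasTrivialRadical ℝ G.lieAlg

/-- `𝔥` is an `ℝ`-split Cartan subalgebra of `𝔤 ⊗ ℝ`: a Cartan subalgebra whose elements are
simultaneously diagonalizable over `ℝ`. -/
structure IsSplitCartan (h : LieSubalgebra ℝ G.lieAlg) : Prop where
  cartan : h.IsCartanSubalgebra
  split : ∃ P : GL (Fin N) ℝ, ∀ X ∈ h,
    ((P : Matrix (Fin N) (Fin N) ℝ) * (X : Matrix (Fin N) (Fin N) ℝ) *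
      ((P⁻¹ : GL (Fin N) ℝ) : Matrix (Fin N) (Fin N) ℝ)).IsDiag

theorem Ad_mul (a b : G.RealPoints) (X : G.lieAlg) : G.Ad (a * b) X = G.Ad a (G.Ad b X) := by
  apply Subtype.ext
  simp only [Ad, LinearMap.coe_mk, AddHom.coe_mk, mul_inv_rev, map_mul, Units.val_mul]
  simp only [mul_assoc]

theorem Ad_one (X : G.lieAlg) : G.Ad 1 X = X := by
  apply Subtype.ext
  simp [Ad]

/-- The Cartan subgroup `H` attached to `𝔥`: the centralizer of `𝔥` in `𝐆(ℝ)`. -/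
def cartanSubgroup (h : LieSubalgebra ℝ G.lieAlg) : Subgroup G.RealPoints where
  carrier := {g | ∀ X ∈ h, G.Ad g X = X}
  mul_mem' := fun {a b} ha hb X hX => by rw [Ad_mul, hb X hX, ha X hX]
  one_mem' := fun X _ => G.Ad_one X
  inv_mem' := fun {a} ha X hX => by
    nth_rewrite 1 [← ha X hX]
    rw [← Ad_mul, inv_mul_cancel, Ad_one]

/-- The set `Φ` of roots of `𝔥` in `𝔤 ⊗ ℝ`: the nonzero linear forms `α` on `𝔥` with a nonzero
vector `Y` such that `[X, Y] = α(X) Y` for all `X ∈ 𝔥`. -/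
def roots (h : LieSubalgebra ℝ G.lieAlg) : Set (Module.Dual ℝ h) :=
  {α | α ≠ 0 ∧ ∃ Y : G.lieAlg, Y ≠ 0 ∧ ∀ X : h, ⁅(X : G.lieAlg), Y⁆ = α X • Y}

/-- `min_{α ∈ Φ} |α(x)|`. -/
def minAbsRoot (h : LieSubalgebra ℝ G.lieAlg) (x : h) : ℝ :=
  sInf ((fun α : Module.Dual ℝ h => |α x|) '' G.roots h)

/-! ## The discriminant -/

/-- The auxiliary integral data: `𝔤_ℤ` is a lattice in the rational Lie algebra `𝔤` (a finitely
generated group of rational elements which spans `𝔤 ⊗ ℝ`), stable under `Ad(Γ)` and under the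
bracket, and `B` is a `𝐆`-invariant nondegenerate symmetric bilinear form which is integral on
`𝔤_ℤ`. -/
structure IsIntegralStructure (Γ : Subgroup G.RealPoints) (gZ : Submodule ℤ G.lieAlg)
    (B : LinearMap.BilinForm ℝ G.lieAlg) : Prop where
  rational : ∀ X ∈ gZ, ∀ i j, ∃ q : ℚ, (X : Matrix (Fin N) (Fin N) ℝ) i j = q
  fg : gZ.FG
  span_eq_top : Submodule.span ℝ (gZ : Set G.lieAlg) = ⊤
  ad_mem : ∀ γ ∈ Γ, ∀ X ∈ gZ, G.Ad γ X ∈ gZ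
  lie_mem : ∀ X ∈ gZ, ∀ Y ∈ gZ, ⁅X, Y⁆ ∈ gZ
  symm : ∀ X Y, B X Y = B Y X
  nondegenerate : B.Nondegenerate
  invariant : ∀ (g : G.RealPoints) (X Y : G.lieAlg), B (G.Ad g X) (G.Ad g Y) = B X Y
  integral : ∀ X ∈ gZ, ∀ Y ∈ gZ, ∃ n : ℤ, B X Y = n

/-- The space `V = ⋀ʳ 𝔤 ⊗ ⋀ʳ 𝔤` (over `ℝ`). -/
abbrev VSpace (r : ℕ) : Type := (⋀[ℝ]^r G.lieAlg) ⊗[ℝ] (⋀[ℝ]^r G.lieAlg)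

/-- The lattice `V_ℤ = ⋀ʳ 𝔤_ℤ ⊗ ⋀ʳ 𝔤_ℤ` in `V`: the subgroup generated by the tensors
`(v₁ ∧ … ∧ v_r) ⊗ (w₁ ∧ … ∧ w_r)` with all `v_i, w_i ∈ 𝔤_ℤ`. -/
def VInt (gZ : Submodule ℤ G.lieAlg) (r : ℕ) : AddSubgroup (G.VSpace r) :=
  AddSubgroup.closure {z | ∃ v w : Fin r → G.lieAlg, (∀ i, v i ∈ gZ) ∧ (∀ i, w i ∈ gZ) ∧
    z = exteriorPower.ιMulti ℝ r v ⊗ₜ[ℝ] exteriorPower.ιMulti ℝ r w}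

/-- `ι(𝔱) = (w ⊗ w) / B_∧(w, w)`, where `w = e₁ ∧ … ∧ e_r` for a basis `e` of `𝔱`, and
`B_∧(w, w) = det (B(e_i, e_j))`. This does not depend on the basis. -/
def iota (B : LinearMap.BilinForm ℝ G.lieAlg) (t : Submodule ℝ G.lieAlg) :
    G.VSpace (Module.finrank ℝ t) :=
  let e : Fin (Module.finrank ℝ t) → G.lieAlg := fun i => (Module.finBasis ℝ t i : G.lieAlg)
  (Matrix.det (Matrix.of fun i j => B (e i) (e j)))⁻¹ •
    (exteriorPower.ιMulti ℝ _ e ⊗ₜ[ℝ] exteriorPower.ιMulti ℝ _ e)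

/-- The discriminant of a Cartan subalgebra `𝔱`: the least positive integer `n` such that
`n ι(𝔱) ∈ V_ℤ`. -/
def discSub (gZ : Submodule ℤ G.lieAlg) (B : LinearMap.BilinForm ℝ G.lieAlg)
    (t : Submodule ℝ G.lieAlg) : ℕ :=
  sInf {n : ℕ | 0 < n ∧ n • G.iota B t ∈ G.VInt gZ (Module.finrank ℝ t)}

/-- The discriminant of the orbit `Γ g H`: the discriminant of `Ad(g) 𝔥`. -/
def disc (gZ : Submodule ℤ G.lieAlg) (B : LinearMap.BilinForm ℝ G.lieAlg)
    (h : LieSubalgebra ℝ G.lieAlg) (g : G.RealPoints) : ℕ :=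
  G.discSub gZ B (h.toSubmodule.map (G.Ad g))

end LinAlgGroup

/-! ## Periodic orbits on `Γ \ G` and their volume measures -/

section Homogeneous

variable {G : Type} [Group G]

/-- The homogeneous space `Γ \ G` of cosets `Γ g`. -/
def HomSpace (Γ : Subgroup G) : Type := Quotient (QuotientGroup.rightRel Γ)

/-- The point `Γ g`. -/
def HomSpace.mk (Γ : Subgroup G) (g : G) : HomSpace Γ := Quotient.mk (QuotientGroup.rightRel Γ) g

instance [TopologicalSpace G] (Γ : Subgroup G) : TopologicalSpace (HomSpace Γ) :=
  inferInstanceAs (TopologicalSpace (Quotient (QuotientGroup.rightRel Γ)))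

instance [TopologicalSpace G] (Γ : Subgroup G) : MeasurableSpace (HomSpace Γ) := borel _

instance [TopologicalSpace G] (Γ : Subgroup G) : BorelSpace (HomSpace Γ) := ⟨rfl⟩

/-- Right translation `Γ g ↦ Γ g a` on `Γ \ G`. -/
def HomSpace.rightMul (Γ : Subgroup G) (a : G) : HomSpace Γ → HomSpace Γ :=
  Quotient.map (fun g => g * a) fun g g' hgg' => by
    have h1 : g' * g⁻¹ ∈ Γ := QuotientGroup.rightRel_apply.1 hgg'
    refine QuotientGroup.rightRel_apply.2 ?_
    rwa [mul_inv_rev, mul_assoc, mul_inv_cancel_left]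

/-- The orbit `Γ g H` in `Γ \ G`. -/
def HomSpace.orbit (Γ H : Subgroup G) (g : G) : Set (HomSpace Γ) :=
  {z | ∃ a ∈ H, z = HomSpace.mk Γ (g * a)}

/-- The orbit `Γ g H` is periodic: it carries a nonzero finite `H`-invariant measure. -/
def HomSpace.IsPeriodic [TopologicalSpace G] (Γ H : Subgroup G) (g : G) : Prop :=
  ∃ m : Measure (HomSpace Γ), IsFiniteMeasure m ∧ m ≠ 0 ∧ m (HomSpace.orbit Γ H g)ᶜ = 0 ∧
    ∀ a ∈ H, m.map (HomSpace.rightMul Γ a) = m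

/-- The stabilizer `H ∩ g⁻¹ Γ g` of the point `Γ g` in `H`. -/
def HomSpace.stab (Γ H : Subgroup G) (g : G) : Subgroup H :=
  (Γ.comap (MulAut.conj g).toMonoidHom).subgroupOf H

open scoped Classical in
/-- The volume measure of the orbit `Γ g H` for a Haar measure `ν` on `H`: the image under
`a ↦ Γ g a` of the restriction of `ν` to a fundamental domain of `H ∩ g⁻¹ Γ g` in `H`. (It does not
depend on the fundamental domain; the value is `0` if there is none, which does not occur for
discrete `Γ`.) -/
def HomSpace.orbitMeasure [TopologicalSpace G] [MeasurableSpace G] (Γ H : Subgroup G)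
    (ν : Measure H) (g : G) : Measure (HomSpace Γ) :=
  if hF : ∃ F : Set H, IsFundamentalDomain (HomSpace.stab Γ H g) F ν then
    (ν.restrict hF.choose).map fun a : H => HomSpace.mk Γ (g * a)
  else 0

/-- The volume of the orbit `Γ g H`, i.e. the covolume of `H ∩ g⁻¹ Γ g` in `H`. -/
def HomSpace.orbitVolume [TopologicalSpace G] [MeasurableSpace G] (Γ H : Subgroup G)
    (ν : Measure H) (g : G) : ℝ≥0∞ :=
  HomSpace.orbitMeasure Γ H ν g Set.univ

/-- The total volume of a finite family of orbits `Γ y_j H`. -/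
def HomSpace.totalVolume [TopologicalSpace G] [MeasurableSpace G] (Γ H : Subgroup G)
    (ν : Measure H) {n : ℕ} (y : Fin n → G) : ℝ≥0∞ :=
  ∑ j, HomSpace.orbitVolume Γ H ν (y j)

/-- The sum of the volume measures of the orbits `Γ y_j H`, divided by their total volume. -/
def HomSpace.normalizedMeasure [TopologicalSpace G] [MeasurableSpace G] (Γ H : Subgroup G)
    (ν : Measure H) {n : ℕ} (y : Fin n → G) : Measure (HomSpace Γ) :=
  (HomSpace.totalVolume Γ H ν y)⁻¹ • ∑ j, HomSpace.orbitMeasure Γ H ν (y j)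

end Homogeneous

/-! ## Kolmogorov–Sinai entropy -/

section Entropy

variable {X : Type} [MeasurableSpace X]

/-- The entropy `-∑ μ(P_i) log μ(P_i)` of the finite partition of `X` into the fibres of `P`. -/
def partitionEntropy (μ : Measure X) {ι : Type} [Fintype ι] (P : X → ι) : ℝ :=
  ∑ i, Real.negMulLog (μ.real (P ⁻¹' {i}))

/-- The entropy `h_μ(T, P)` of `T` relative to the partition `P`: the limit as `n → ∞` of
`(1/n) H_μ(P ∨ T⁻¹ P ∨ … ∨ T^{-(n-1)} P)`. (The limit exists if `T` preserves `μ`.) -/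
def entropyRel (μ : Measure X) (T : X → X) {k : ℕ} (P : X → Fin k) : ℝ≥0∞ :=
  liminf (fun n : ℕ =>
    ENNReal.ofReal (partitionEntropy μ (fun z (m : Fin n) => P (T^[m] z)) / n)) atTop

/-- The metric (Kolmogorov–Sinai) entropy `h_μ(T)`: the supremum of `h_μ(T, P)` over all finite
measurable partitions `P`. -/
def metricEntropy (μ : Measure X) (T : X → X) : ℝ≥0∞ :=
  ⨆ (k : ℕ) (P : X → Fin k) (_ : Measurable P), entropyRel μ T P

/-- The metric entropy of a flow: the entropy of its time-one map. -/
def flowEntropy (μ : Measure X) (φ : ℝ → X → X) : ℝ≥0∞ := metricEntropy μ (φ 1)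

end Entropy

end

/-! ## Entropy of finite partitions -/

section PartitionEntropy

variable {X : Type} [MeasurableSpace X]

/-! The mechanism is a separation principle: periodic tori of small discriminant repel each other,
so a long Bowen ball sees at most one local orbit, and a collection of large total volume must
spread over many Bowen balls.

Arithmetic. A torus `Ad(g) 𝔥` from a periodic orbit is rational
(`Diagonalizes.span_eq_of_isPeriodic`): a vector fixed by the stabilizer but having a nonzero
component off `𝔥` would give a function on the orbit scaled by `e` under a translation, which a
finite invariant measure forbids. For a rational torus the discriminant is the absolute Gram
determinant of an integral basis. Hence the Plücker coordinates of `Ad(g) e`, for a fixed basis `e`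
of `𝔥`, are integers times a scale `c` with `c² · disc = |det B(e_i, e_j)|`
(`IsIntegralStructure.exists_minor_scale`).

Geometry. Let `m` be the minimum of `|α(x)|`. If `aˢ u a⁻ˢ` is bounded for `s = ±t`, every root
component of `Ad(u) X`, `X ∈ 𝔥`, is `O(e^{-tm})` (`Diagonalizes.exists_approx`), so the Plücker
coordinates of the tori at `g` and `g u` agree up to sign and `O(e^{-tm})`. Their 2×2 determinants
are multiples of a number at least of order `1/Δ`, so `e^{-tm} Δ ≪ 1` makes the tori equal. When the
discriminants coincide, the scales agree up to sign and differences of coordinates are already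
multiples of `c`, of order `Δ^{-1/2}`, so `e^{-2tm} Δ ≪ 1` suffices (`minors_proportional`). This is
the only source of the factor two between the two bounds, carried through as `κ = 1, 2`. Then `u`
normalizes `𝔥`, and being small it lies in `H`.

Entropy. A Bowen ball of time length `2t` therefore has normalized measure `O(Δ^{-ρ})`
(`IsIntegralStructure.exists_bowen_bound`). With `t ≈ log Δ / (κ m)` the itineraries of length `2t +
1` have entropy about `ρ log Δ`, or `ρ κ m / 2` per step. Since `X` need not be compact, the
partition has a class `0` for the complement of a large compact set; each visit to it multiplies the
number of Bowen balls needed by at most a constant `M` (`measure_itinerary_le`). Because the limit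
is a probability measure, typical itineraries visit it for a proportion at most `δ` of the time.
Subadditivity and null boundaries carry the estimate to `μ` (`le_entropy_of_vague_limit`), and
finally `δ → 0`. -/

theorem partitionEntropy_nonneg (μ : Measure X) [IsProbabilityMeasure μ] {ι : Type} [Fintype ι]
    (f : X → ι) : 0 ≤ partitionEntropy μ f :=
  Finset.sum_nonneg fun _ _ => Real.negMulLog_nonneg measureReal_nonneg measureReal_le_one

/-- `log p ≥ 1 - 1/p` gives `-p log p ≤ 1 - p ≤ 1` for each atom. This crude bound is enough because
it only enters a remainder that disappears after division by the length of the itinerary. -/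
theorem partitionEntropy_le_card (μ : Measure X) [IsProbabilityMeasure μ] {ι : Type} [Fintype ι]
    (f : X → ι) : partitionEntropy μ f ≤ Fintype.card ι := by
  have : ∀ i ∈ Finset.univ, Real.negMulLog (μ.real (f ⁻¹' {i})) ≤ 1 := by
    intro i _
    have h0 : 0 ≤ μ.real (f ⁻¹' {i}) := measureReal_nonneg
    rcases h0.eq_or_lt with h | h
    · rw [← h]; simp
    · have h1 := Real.one_sub_inv_le_log_of_pos h
      have h2 : μ.real (f ⁻¹' {i}) * (1 - (μ.real (f ⁻¹' {i}))⁻¹) ≤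
          μ.real (f ⁻¹' {i}) * Real.log (μ.real (f ⁻¹' {i})) :=
        mul_le_mul_of_nonneg_left h1 h0
      rw [mul_sub, mul_inv_cancel₀ h.ne'] at h2
      rw [Real.negMulLog]
      linarith
  calc partitionEntropy μ f ≤ ∑ _i : ι, (1 : ℝ) := Finset.sum_le_sum this
    _ = Fintype.card ι := by simp

theorem partitionEntropy_equiv (μ : Measure X) {ι κ : Type} [Fintype ι] [Fintype κ] (f : X → ι)
    (e : ι ≃ κ) : partitionEntropy μ (fun z => e (f z)) = partitionEntropy μ f := by
  unfold partitionEntropy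
  rw [← e.sum_comp]
  refine Finset.sum_congr rfl fun i _ => ?_
  congr 2
  ext z
  simp

theorem partitionEntropy_comp (μ : Measure X) {ι : Type} [Fintype ι] {f : X → ι}
    (hf : ∀ i, MeasurableSet (f ⁻¹' {i})) {T : X → X} (hT : MeasurePreserving T μ μ) :
    partitionEntropy μ (fun z => f (T z)) = partitionEntropy μ f := by
  refine Finset.sum_congr rfl fun i _ => ?_
  congr 1
  exact hT.measureReal_preimage (hf i).nullMeasurableSet

theorem sum_measureReal_preimage_prod (μ : Measure X) [IsFiniteMeasure μ] {ι κ : Type}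
    [Fintype κ] {f : X → ι} {g : X → κ} (hf : ∀ i, MeasurableSet (f ⁻¹' {i}))
    (hg : ∀ j, MeasurableSet (g ⁻¹' {j})) (i : ι) :
    ∑ j, μ.real ((fun z => (f z, g z)) ⁻¹' {(i, j)}) = μ.real (f ⁻¹' {i}) := by
  rw [← measureReal_biUnion_finset]
  · congr 1
    ext z
    simp
  · intro a _ b _ hab
    refine Set.disjoint_left.2 fun z hz hz' => hab ?_
    simp only [Set.mem_preimage, Set.mem_singleton_iff, Prod.mk.injEq] at hz hz'
    exact hz.2.symm.trans hz'.2
  · intro j _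
    have : (fun z => (f z, g z)) ⁻¹' {(i, j)} = f ⁻¹' {i} ∩ g ⁻¹' {j} := by
      ext z; simp
    rw [this]
    exact (hf i).inter (hg j)

/-- Gibbs' inequality in the form used for subadditivity of entropy. -/
theorem negMulLog_le_of_marginals {p a b : ℝ} (hp : 0 ≤ p) (hpa : p ≤ a) (hpb : p ≤ b) :
    Real.negMulLog p ≤ -(p * Real.log a) - p * Real.log b + (a * b - p) := by
  rcases hp.eq_or_lt with h | h
  · subst h
    simpa using mul_nonneg hpa hpb
  · have ha : 0 < a := h.trans_le hpa
    have hb : 0 < b := h.trans_le hpb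
    have h1 := Real.log_le_sub_one_of_pos (div_pos (mul_pos ha hb) h)
    rw [Real.log_div (mul_pos ha hb).ne' h.ne', Real.log_mul ha.ne' hb.ne'] at h1
    have h2 := mul_le_mul_of_nonneg_left h1 hp
    rw [mul_sub p (a * b / p), mul_div_cancel₀ _ h.ne'] at h2
    rw [Real.negMulLog]
    linarith

/-- Gibbs' inequality is summed over all joint atoms. The correction terms `a i * b j - p i j`
cancel in total because both families sum to one. -/
theorem partitionEntropy_prod_le (μ : Measure X) [IsProbabilityMeasure μ] {ι κ : Type}
    [Fintype ι] [Fintype κ] {f : X → ι} {g : X → κ} (hf : ∀ i, MeasurableSet (f ⁻¹' {i}))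
    (hg : ∀ j, MeasurableSet (g ⁻¹' {j})) :
    partitionEntropy μ (fun z => (f z, g z)) ≤ partitionEntropy μ f + partitionEntropy μ g := by
  set p : ι → κ → ℝ := fun i j => μ.real ((fun z => (f z, g z)) ⁻¹' {(i, j)}) with hp
  set a : ι → ℝ := fun i => μ.real (f ⁻¹' {i}) with ha
  set b : κ → ℝ := fun j => μ.real (g ⁻¹' {j}) with hb
  have hpa : ∀ i, ∑ j, p i j = a i := sum_measureReal_preimage_prod μ hf hg
  have hpb : ∀ j, ∑ i, p i j = b j := by
    intro j
    change _ = μ.real (g ⁻¹' {j})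
    rw [← sum_measureReal_preimage_prod μ hg hf j]
    refine Finset.sum_congr rfl fun i _ => ?_
    simp only [hp]
    congr 1
    ext z
    simp [and_comm]
  have hp0 : ∀ i j, 0 ≤ p i j := fun _ _ => measureReal_nonneg
  have hsum : ∀ {α : Type} [Fintype α] (φ : X → α), (∀ i, MeasurableSet (φ ⁻¹' {i})) →
      ∑ i, μ.real (φ ⁻¹' {i}) = 1 := by
    intro α _ φ hφ
    rw [← measureReal_biUnion_finset]
    · rw [show (⋃ i ∈ Finset.univ, φ ⁻¹' {i}) = Set.univ by ext z; simp]
      simp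
    · intro a _ b _ hab
      refine Set.disjoint_left.2 fun z hz hz' => hab ?_
      exact (Set.mem_singleton_iff.1 hz).symm.trans hz'
    · exact fun i _ => hφ i
  have h1 : partitionEntropy μ (fun z => (f z, g z)) ≤
      ∑ i, ∑ j, (-(p i j * Real.log (a i)) - p i j * Real.log (b j) + (a i * b j - p i j)) := by
    unfold partitionEntropy
    rw [Fintype.sum_prod_type]
    refine Finset.sum_le_sum fun i _ => Finset.sum_le_sum fun j _ =>
      negMulLog_le_of_marginals (hp0 i j) ?_ ?_
    · rw [← hpa i]
      exact Finset.single_le_sum (f := p i) (fun j _ => hp0 i j) (Finset.mem_univ j)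
    · rw [← hpb j]
      exact Finset.single_le_sum (f := fun i => p i j) (fun i _ => hp0 i j) (Finset.mem_univ i)
  refine h1.trans (le_of_eq ?_)
  simp only [Finset.sum_add_distrib, Finset.sum_sub_distrib, Finset.sum_neg_distrib]
  have e1 : ∑ i, ∑ j, p i j * Real.log (a i) = ∑ i, a i * Real.log (a i) :=
    Finset.sum_congr rfl fun i _ => by rw [← Finset.sum_mul, hpa]
  have e2 : ∑ i, ∑ j, p i j * Real.log (b j) = ∑ j, b j * Real.log (b j) := by
    rw [Finset.sum_comm]
    exact Finset.sum_congr rfl fun j _ => by rw [← Finset.sum_mul, hpb]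
  have e3 : ∑ i, ∑ j, a i * b j = 1 := by
    rw [← Finset.sum_mul_sum, hsum f hf, hsum g hg, one_mul]
  have e4 : ∑ i, ∑ j, p i j = 1 := by
    rw [← hsum f hf]
    exact Finset.sum_congr rfl fun i _ => hpa i
  rw [e1, e2, e3, e4]
  simp only [partitionEntropy, Real.negMulLog, neg_mul, Finset.sum_neg_distrib, ha, hb]
  ring

/-- If all atoms in a union of atoms have measure at most `κ`, the entropy is at least the measure
of the union times `-log κ`. -/
theorem le_partitionEntropy_of_atoms (μ : Measure X) [IsProbabilityMeasure μ] {ι : Type}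
    [Fintype ι] {f : X → ι} (hf : ∀ i, MeasurableSet (f ⁻¹' {i})) (S : Set ι) {κ : ℝ}
    (hκ : ∀ i ∈ S, μ.real (f ⁻¹' {i}) ≤ κ) :
    μ.real (f ⁻¹' S) * (-Real.log κ) ≤ partitionEntropy μ f := by
  classical
  have h1 : μ.real (f ⁻¹' S) = ∑ i with i ∈ S, μ.real (f ⁻¹' {i}) := by
    rw [← measureReal_biUnion_finset]
    · congr 1
      ext z
      simp
    · intro a _ b _ hab
      refine Set.disjoint_left.2 fun z hz hz' => hab ?_
      exact (Set.mem_singleton_iff.1 hz).symm.trans hz'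
    · exact fun i _ => hf i
  rw [h1, Finset.sum_mul]
  refine (Finset.sum_le_sum (g := fun i => Real.negMulLog (μ.real (f ⁻¹' {i}))) ?_).trans
    (Finset.sum_le_sum_of_subset_of_nonneg (Finset.filter_subset _ _)
      fun i _ _ => Real.negMulLog_nonneg measureReal_nonneg measureReal_le_one)
  intro i hi
  have h0 : 0 ≤ μ.real (f ⁻¹' {i}) := measureReal_nonneg
  rcases h0.eq_or_lt with h | h
  · rw [← h]; simp
  · have := Real.log_le_log h (hκ i (Finset.mem_filter.1 hi).2)
    rw [Real.negMulLog]
    nlinarith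

/-- The itinerary of length `n` of a point, relative to a map and a partition. -/
def itinerary (T : X → X) {k : ℕ} (P : X → Fin k) (n : ℕ) (z : X) (m : Fin n) : Fin k :=
  P (T^[m] z)

theorem measurableSet_itinerary {T : X → X} (hT : Measurable T) {k : ℕ} {P : X → Fin k}
    (hP : Measurable P) (n : ℕ) (S : Set (Fin n → Fin k)) :
    MeasurableSet (itinerary T P n ⁻¹' S) := by
  have : Measurable (itinerary T P n) :=
    measurable_pi_lambda _ fun m => hP.comp (hT.iterate m)
  exact this S.toFinite.measurableSet

/-- An itinerary of length `m + n` is one of length `m` followed by the itinerary of length `n` of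
`T^[m] z`, and the latter has the same entropy by invariance of `μ`. -/
theorem subadditive_partitionEntropy_itinerary {μ : Measure X} [IsProbabilityMeasure μ]
    {T : X → X} (hT : MeasurePreserving T μ μ) {k : ℕ} {P : X → Fin k} (hP : Measurable P) :
    Subadditive fun n => partitionEntropy μ (itinerary T P n) := by
  intro m n
  have h1 := partitionEntropy_comp μ (f := itinerary T P n)
    (fun i => measurableSet_itinerary hT.measurable hP n {i}) (hT.iterate m)
  beta_reduce
  rw [← h1]
  refine le_trans (le_of_eq ?_) (partitionEntropy_prod_le μ
    (fun i => measurableSet_itinerary hT.measurable hP m {i}) fun j => ?_)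
  · rw [← partitionEntropy_equiv μ _ (Fin.appendEquiv m n)]
    congr 1
    ext z i
    refine Fin.addCases (fun i => ?_) (fun i => ?_) i
    · simp [itinerary, Fin.appendEquiv]
    · simp [itinerary, Fin.appendEquiv, ← Function.iterate_add_apply, add_comm]
  · exact (hT.iterate m).measurable (measurableSet_itinerary hT.measurable hP n {j})

theorem Subadditive.le_mul_apply_one {u : ℕ → ℝ} (hu : Subadditive u) (h0 : u 0 ≤ 0) (r : ℕ) :
    u r ≤ r * u 1 := by
  have := hu.apply_mul_add_le r 1 0
  rw [mul_one, add_zero] at this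
  linarith

theorem Subadditive.le_div_mul_add_mod {u : ℕ → ℝ} (hu : Subadditive u) (m n : ℕ) :
    u m ≤ (m / n : ℕ) * u n + u (m % n) := by
  have := hu.apply_mul_add_le (m / n) n (m % n)
  rwa [Nat.div_add_mod'] at this

/-- Division with remainder cuts a long itinerary into blocks of length `n` and a remainder shorter
than `n`. This compares itineraries of growing length with those of a fixed length, where a weak
limit can be taken. -/
theorem partitionEntropy_itinerary_le {μ : Measure X} [IsProbabilityMeasure μ]
    {T : X → X} (hT : MeasurePreserving T μ μ) {k : ℕ} {P : X → Fin k} (hP : Measurable P)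
    {n : ℕ} (hn : 0 < n) (m : ℕ) :
    partitionEntropy μ (itinerary T P m) ≤
      m / n * partitionEntropy μ (itinerary T P n) + n * k := by
  have hs := subadditive_partitionEntropy_itinerary hT hP
  have h1 : partitionEntropy μ (itinerary T P 1) ≤ k := by
    refine (partitionEntropy_le_card μ _).trans ?_
    simp
  have h2 : ∀ r : ℕ, partitionEntropy μ (itinerary T P r) ≤ r * k := by
    intro r
    have h0 : partitionEntropy μ (itinerary T P 0) ≤ 0 := by
      have : ∀ i, itinerary T P 0 ⁻¹' {i} = Set.univ := fun i => by
        ext z; simp [Subsingleton.elim (itinerary T P 0 z) i]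
      simp [partitionEntropy, this]
    have := hs.le_mul_apply_one h0 r
    beta_reduce at this
    nlinarith [(Nat.cast_nonneg r : (0 : ℝ) ≤ r)]
  have h3 := hs.le_div_mul_add_mod m n
  refine h3.trans (add_le_add ?_ ((h2 _).trans ?_))
  · exact mul_le_mul_of_nonneg_right Nat.cast_div_le (partitionEntropy_nonneg μ _)
  · exact mul_le_mul_of_nonneg_right (by exact_mod_cast (Nat.mod_lt m hn).le) (Nat.cast_nonneg k)

theorem le_metricEntropy {μ : Measure X} {T : X → X} {k : ℕ} {P : X → Fin k} (hP : Measurable P)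
    {η : ℝ} (h : ∀ n : ℕ, 0 < n → η ≤ partitionEntropy μ (itinerary T P n) / n) :
    ENNReal.ofReal η ≤ metricEntropy μ T := by
  refine le_trans ?_ (le_iSup_of_le k (le_iSup_of_le P (le_iSup_of_le hP le_rfl)))
  refine le_liminf_of_le (by isBoundedDefault) ?_
  filter_upwards [eventually_gt_atTop 0] with n hn
  exact ENNReal.ofReal_le_ofReal (h n hn)

end PartitionEntropy

/-! ## The topology of `Γ \ G` and volume measures of orbits -/

namespace HomSpace

open scoped Pointwise

section Algebra

variable {G : Type} [Group G] (Γ H : Subgroup G)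

theorem mk_eq_mk_iff {g g' : G} : mk Γ g = mk Γ g' ↔ ∃ γ ∈ Γ, g' = γ * g := by
  refine Quotient.eq.trans (QuotientGroup.rightRel_apply.trans ⟨fun h => ⟨_, h, by group⟩, ?_⟩)
  rintro ⟨γ, hγ, rfl⟩
  simpa using hγ

theorem mk_mul_of_mem {γ : G} (hγ : γ ∈ Γ) (g : G) : mk Γ (γ * g) = mk Γ g :=
  ((mk_eq_mk_iff Γ).2 ⟨γ, hγ, rfl⟩).symm

theorem mk_surjective : Function.Surjective (mk Γ) := Quotient.mk_surjective

theorem rightMul_mk (a g : G) : rightMul Γ a (mk Γ g) = mk Γ (g * a) := rfl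

theorem rightMul_rightMul (a b : G) (z : HomSpace Γ) :
    rightMul Γ b (rightMul Γ a z) = rightMul Γ (a * b) z := by
  obtain ⟨g, rfl⟩ := mk_surjective Γ z
  simp [rightMul_mk, mul_assoc]

theorem rightMul_one (z : HomSpace Γ) : rightMul Γ 1 z = z := by
  obtain ⟨g, rfl⟩ := mk_surjective Γ z
  simp [rightMul_mk]

theorem iterate_rightMul (a : G) (n : ℕ) : (rightMul Γ a)^[n] = rightMul Γ (a ^ n) := by
  induction n with
  | zero => ext z; simp [rightMul_one]
  | succ n ih => ext z; rw [Function.iterate_succ_apply', ih, rightMul_rightMul, ← pow_succ]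

theorem mem_orbit_iff {g g' : G} : mk Γ g' ∈ orbit Γ H g ↔ ∃ γ ∈ Γ, ∃ a ∈ H, g' = γ * g * a := by
  constructor
  · rintro ⟨a, ha, h⟩
    obtain ⟨γ, hγ, rfl⟩ := (mk_eq_mk_iff Γ).1 h.symm
    exact ⟨γ, hγ, a, ha, by group⟩
  · rintro ⟨γ, hγ, a, ha, rfl⟩
    exact ⟨a, ha, by rw [mul_assoc, mk_mul_of_mem Γ hγ]⟩

theorem orbit_eq_of_mem {g g' : G} (h : mk Γ g' ∈ orbit Γ H g) : orbit Γ H g' = orbit Γ H g := by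
  obtain ⟨γ, hγ, a, ha, rfl⟩ := (mem_orbit_iff Γ H).1 h
  ext z
  obtain ⟨x, rfl⟩ := mk_surjective Γ z
  simp only [mem_orbit_iff]
  constructor
  · rintro ⟨γ', hγ', a', ha', rfl⟩
    exact ⟨γ' * γ, Γ.mul_mem hγ' hγ, a * a', H.mul_mem ha ha', by group⟩
  · rintro ⟨γ', hγ', a', ha', rfl⟩
    exact ⟨γ' * γ⁻¹, Γ.mul_mem hγ' (Γ.inv_mem hγ), a⁻¹ * a', H.mul_mem (H.inv_mem ha) ha', by group⟩

theorem mem_stab_iff {g : G} {a : H} : a ∈ stab Γ H g ↔ g * a * g⁻¹ ∈ Γ := by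
  simp [stab, Subgroup.mem_subgroupOf, MulAut.conj_apply]

theorem orbit_eq_image (g : G) : orbit Γ H g = (fun a => mk Γ (g * a)) '' H := by
  ext z
  exact ⟨fun ⟨a, ha, h⟩ => ⟨a, ha, h.symm⟩, fun ⟨a, ha, h⟩ => ⟨a, ha, h.symm⟩⟩

theorem countable_stab [Countable Γ] (g : G) : Countable (stab Γ H g) := by
  refine Function.Injective.countable
    (f := fun a : stab Γ H g => (⟨_, (mem_stab_iff Γ H).1 a.2⟩ : Γ)) fun a a' h => ?_
  have h1 := congrArg Subtype.val h
  exact Subtype.ext (Subtype.ext (mul_left_cancel (mul_right_cancel h1)))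

end Algebra

variable {G : Type} [Group G] [TopologicalSpace G] (Γ H : Subgroup G)

theorem continuous_mk : Continuous (mk Γ) := continuous_quotient_mk'

variable [IsTopologicalGroup G]

theorem isOpenQuotientMap_mk : IsOpenQuotientMap (mk Γ) := by
  refine ⟨mk_surjective Γ, continuous_mk Γ, fun U hU => ?_⟩
  have : mk Γ ⁻¹' (mk Γ '' U) = ⋃ γ ∈ Γ, (fun x => γ * x) ⁻¹' U := by
    ext x
    simp only [Set.mem_preimage, Set.mem_image, Set.mem_iUnion, mk_eq_mk_iff]
    constructor
    · rintro ⟨y, hy, γ, hγ, rfl⟩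
      exact ⟨γ⁻¹, Γ.inv_mem hγ, by simpa using hy⟩
    · rintro ⟨γ, hγ, hx⟩
      exact ⟨_, hx, γ⁻¹, Γ.inv_mem hγ, by simp⟩
  change IsOpen (mk Γ ⁻¹' (mk Γ '' U))
  rw [this]
  exact isOpen_biUnion fun γ _ => hU.preimage (continuous_const_mul γ)

theorem continuous_rightMul (a : G) : Continuous (rightMul Γ a) := by
  rw [(isOpenQuotientMap_mk Γ).isQuotientMap.continuous_iff]
  exact (continuous_mk Γ).comp (continuous_mul_const a)

/-- Right translation as a homeomorphism. -/
def rightMulHomeomorph (a : G) : HomSpace Γ ≃ₜ HomSpace Γ where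
  toFun := rightMul Γ a
  invFun := rightMul Γ a⁻¹
  left_inv z := by simp [rightMul_rightMul, rightMul_one]
  right_inv z := by simp [rightMul_rightMul, rightMul_one]
  continuous_toFun := continuous_rightMul Γ a
  continuous_invFun := continuous_rightMul Γ a⁻¹

/-- Inversion identifies `Γ \ G` continuously and injectively with `G ⧸ Γ`, which is Hausdorff
because a discrete subgroup is closed. -/
theorem t2Space [T2Space G] [DiscreteTopology Γ] : T2Space (HomSpace Γ) := by
  have hc : IsClosed (Γ : Set G) := Subgroup.isClosed_of_discrete
  let φ : HomSpace Γ → G ⧸ Γ := fun z => QuotientGroup.quotientRightRelEquivQuotientLeftRel Γ z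
  have : Continuous φ := by
    rw [(isOpenQuotientMap_mk Γ).isQuotientMap.continuous_iff]
    exact (continuous_quotient_mk' (s := QuotientGroup.leftRel Γ)).comp continuous_inv
  exact T2Space.of_injective_continuous (f := φ) (Equiv.injective _) this

theorem locallyCompactSpace [LocallyCompactSpace G] : LocallyCompactSpace (HomSpace Γ) :=
  (isOpenQuotientMap_mk Γ).locallyCompactSpace

theorem secondCountableTopology [SecondCountableTopology G] :
    SecondCountableTopology (HomSpace Γ) :=
  (isOpenQuotientMap_mk Γ).isQuotientMap.secondCountableTopology (isOpenQuotientMap_mk Γ).isOpenMap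

/-- An orbit need not be assumed closed: σ-compactness already makes it, and pieces of it cut out by
closed conditions, Borel. -/
theorem isSigmaCompact_image_orbit [SigmaCompactSpace G] (g : G) {C : Set G} (hC : IsClosed C) :
    IsSigmaCompact ((fun a => mk Γ (g * a)) '' C) :=
  (isSigmaCompact_univ.of_isClosed_subset hC (Set.subset_univ _)).image ((continuous_mk Γ).comp (continuous_const_mul g))

theorem _root_.IsSigmaCompact.measurableSet {X : Type*} [TopologicalSpace X] [T2Space X]
    [MeasurableSpace X] [BorelSpace X] {s : Set X} (hs : IsSigmaCompact s) : MeasurableSet s := by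
  obtain ⟨K, hK, rfl⟩ := hs
  exact MeasurableSet.iUnion fun n => (hK n).measurableSet

theorem measurableSet_orbit [T2Space G] [SigmaCompactSpace G] [DiscreteTopology Γ]
    (hH : IsClosed (H : Set G)) (g : G) : MeasurableSet (orbit Γ H g) := by
  have := t2Space Γ
  rw [orbit_eq_image]
  exact (isSigmaCompact_image_orbit Γ g hH).measurableSet

theorem continuous_orbitMap (g : G) : Continuous fun a : H => mk Γ (g * a) :=
  (continuous_mk Γ).comp ((continuous_const_mul g).comp continuous_subtype_val)

/-! ### Volume measures of orbits: local bounds and invariance. -/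

section OrbitMeasure

variable [MeasurableSpace G] [BorelSpace G] (ν : Measure H)

theorem orbitMeasure_compl_orbit [T2Space G] [SigmaCompactSpace G] [DiscreteTopology Γ]
    (hH : IsClosed (H : Set G)) (g : G) : orbitMeasure Γ H ν g (orbit Γ H g)ᶜ = 0 := by
  classical
  unfold orbitMeasure
  split_ifs with hF
  · rw [Measure.map_apply (continuous_orbitMap Γ H g).measurable
      (measurableSet_orbit Γ H hH g).compl]
    convert measure_empty (μ := ν.restrict hF.choose)
    ext a
    simp only [Set.mem_preimage, Set.mem_compl_iff, Set.mem_empty_iff_false, iff_false, not_not]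
    exact ⟨a, a.2, rfl⟩
  · simp

variable [ν.IsHaarMeasure]

/-- Inside the fundamental domain, the preimage of a local piece of orbit is covered by the
translates of `b K` under the stabilizer. The traces of these translates on the domain have total
measure `ν (b K) = ν K`. -/
theorem orbitMeasure_image_le [T2Space G] [DiscreteTopology Γ] [Countable Γ] (g : G) {γ : G}
    (hγ : γ ∈ Γ) (b : H) {K : Set H} (hK : IsCompact K) :
    orbitMeasure Γ H ν g ((fun a : H => mk Γ (γ * g * b * a)) '' K) ≤ ν K := by
  classical
  have := t2Space Γ
  unfold orbitMeasure
  split_ifs with hF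
  swap
  · simp
  set F := hF.choose
  have hFd : IsFundamentalDomain (stab Γ H g) F ν := hF.choose_spec
  have hcont : Continuous fun a : H => mk Γ (γ * g * b * a) :=
    continuous_orbitMap Γ H (γ * g * b)
  have := countable_stab Γ H g
  have hmeas : MeasurableSet ((fun a : H => mk Γ (γ * g * b * a)) '' K) :=
    (hK.image hcont).measurableSet
  rw [Measure.map_apply (continuous_orbitMap Γ H g).measurable hmeas,
    Measure.restrict_apply (hmeas.preimage (continuous_orbitMap Γ H g).measurable)]
  have hsub : (fun a : H => mk Γ (g * a)) ⁻¹' ((fun a : H => mk Γ (γ * g * b * a)) '' K) ∩ F ⊆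
      ⋃ l : stab Γ H g, l • ((fun a => b * a) '' K) ∩ F := by
    rintro a ⟨⟨k, hk, h⟩, haF⟩
    simp only at h
    rw [mul_assoc, mul_assoc, mk_mul_of_mem Γ hγ, mk_eq_mk_iff] at h
    obtain ⟨γ', hγ', h⟩ := h
    refine Set.mem_iUnion.2 ⟨⟨a * (b * k)⁻¹, (mem_stab_iff Γ H).2 ?_⟩, ?_, haF⟩
    · convert hγ'
      push_cast
      rw [← mul_assoc g, h]
      group
    · refine ⟨b * k, ⟨k, hk, rfl⟩, ?_⟩
      simp [Subgroup.smul_def, mul_assoc]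
  calc ν _ ≤ ν (⋃ l : stab Γ H g, l • ((fun a => b * a) '' K) ∩ F) := measure_mono hsub
    _ ≤ ∑' l : stab Γ H g, ν (l • ((fun a => b * a) '' K) ∩ F) := measure_iUnion_le _
    _ = ν ((fun a => b * a) '' K) := (hFd.measure_eq_tsum _).symm
    _ = ν K := by
      rw [Set.image_mul_left, measure_preimage_mul]

/-- For central `a` the translate `a F` is again a fundamental domain, and sets invariant under the
stabilizer have the same measure in `F` and in `a F`. Centrality turns the right translation on `Γ \
G` into a left translation on `H`. -/
theorem map_rightMul_orbitMeasure [Countable Γ] (g : G) {a : H}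
    (ha : a ∈ Subgroup.center H) :
    (orbitMeasure Γ H ν g).map (rightMul Γ a) = orbitMeasure Γ H ν g := by
  classical
  unfold orbitMeasure
  split_ifs with hF
  swap
  · simp
  set F := hF.choose
  have hFd : IsFundamentalDomain (stab Γ H g) F ν := hF.choose_spec
  have hφ := (continuous_orbitMap Γ H g).measurable
  have hR := (continuous_rightMul Γ (a : G)).measurable
  have := countable_stab Γ H g
  ext E hE
  rw [Measure.map_apply hR hE, Measure.map_apply hφ (hE.preimage hR), Measure.map_apply hφ hE,
    Measure.restrict_apply ((hE.preimage hR).preimage hφ), Measure.restrict_apply (hE.preimage hφ)]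
  have hFd' : IsFundamentalDomain (stab Γ H g) ((⟨a, ha⟩ : Subgroup.center H) • F) ν :=
    hFd.smul_of_comm _
  set S := (fun b : H => mk Γ (g * b)) ⁻¹' E with hS
  have hinv : ∀ l : stab Γ H g, (fun x => l • x) ⁻¹' S = S := by
    intro l
    ext b
    simp only [hS, Set.mem_preimage, Subgroup.smul_def, smul_eq_mul, Subgroup.coe_mul]
    rw [← mk_mul_of_mem Γ ((mem_stab_iff Γ H).1 l.2) (g * b)]
    simp [mul_assoc]
  have h1 := hFd.measure_set_eq hFd' (hE.preimage hφ) hinv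
  rw [h1, ← measure_preimage_mul ν a (S ∩ _)]
  congr 1
  ext b
  simp only [hS, Set.mem_preimage, Set.mem_inter_iff, rightMul_mk]
  have hab : b * a = a * b := Subgroup.mem_center_iff.1 ha b
  have e1 : g * (b : G) * (a : G) = g * ((a * b : H) : G) := by
    rw [mul_assoc, ← Subgroup.coe_mul, hab]
  rw [e1]
  refine and_congr Iff.rfl ?_
  rw [Set.mem_smul_set_iff_inv_smul_mem]
  simp [Subgroup.smul_def]

end OrbitMeasure

end HomSpace

/-! ## Vague limits and entropy -/

section VagueLimit

theorem frontier_iInter_subset_of_finite {Y ι : Type*} [TopologicalSpace Y] [Finite ι]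
    (A : ι → Set Y) : frontier (⋂ i, A i) ⊆ ⋃ i, frontier (A i) := by
  intro z hz
  by_contra hcon
  simp only [Set.mem_iUnion, not_exists] at hcon
  have hcl : ∀ i, z ∈ closure (A i) := fun i =>
    closure_mono (Set.iInter_subset A i) hz.1
  have hint : ∀ i, z ∈ interior (A i) := fun i => by
    by_contra h
    exact hcon i ⟨hcl i, h⟩
  exact hz.2 (by rw [interior_iInter_of_finite]; exact Set.mem_iInter.2 hint)

/-- Null boundaries survive refinement along the orbit, so every atom of an itinerary partition is a
continuity set for the limit measure. -/
theorem measure_frontier_itinerary {X : Type} [TopologicalSpace X] [MeasurableSpace X]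
    [BorelSpace X] {μ : Measure X} {T : X ≃ₜ X}
    (hT : MeasurePreserving T μ μ) {k : ℕ} {P : X → Fin k}
    (hP : ∀ j, μ (frontier (P ⁻¹' {j})) = 0) (n : ℕ) (w : Fin n → Fin k) :
    μ (frontier (itinerary T P n ⁻¹' {w})) = 0 := by
  have h1 : itinerary T P n ⁻¹' {w} = ⋂ m : Fin n, T^[m] ⁻¹' (P ⁻¹' {w m}) := by
    ext z
    simp [itinerary, funext_iff]
  rw [h1]
  refine measure_mono_null (frontier_iInter_subset_of_finite _) (measure_iUnion_null fun m => ?_)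
  refine measure_mono_null ((T.continuous.iterate m).frontier_preimage_subset _) ?_
  rw [(hT.iterate m).measure_preimage isClosed_frontier.measurableSet.nullMeasurableSet, hP]

variable {X : Type} [TopologicalSpace X] [T2Space X] [LocallyCompactSpace X]
  [SecondCountableTopology X] [MeasurableSpace X] [BorelSpace X]

/-- Inner regularity and Urysohn's lemma put a compactly supported function between a large compact
subset and `U`. Since all measures have mass one, this half of the portmanteau theorem controls
closed sets too, although the test functions see only compact parts. -/
theorem le_liminf_measure_of_vague_limit {μ : Measure X} [IsProbabilityMeasure μ]
    {μs : ℕ → Measure X} [∀ i, IsProbabilityMeasure (μs i)]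
    (hμ : ∀ f : CompactlySupportedContinuousMap X ℝ,
      Tendsto (fun i => ∫ z, f z ∂(μs i)) atTop (𝓝 (∫ z, f z ∂μ)))
    {U : Set X} (hU : IsOpen U) : μ U ≤ liminf (fun i => μs i U) atTop := by
  refine le_of_forall_lt fun c hc => ?_
  obtain ⟨K, hKU, hK, hcK⟩ := hU.exists_lt_isCompact hc
  obtain ⟨f, hf1, hf0, hfc, hf⟩ := exists_continuous_one_zero_of_isCompact hK hU.isClosed_compl
    (Set.disjoint_compl_right_iff_subset.2 hKU)
  have hint : ∀ m : Measure X, IsProbabilityMeasure m → Integrable f m := fun m _ =>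
    f.continuous.integrable_of_hasCompactSupport hfc
  have h1 : μ.real K ≤ ∫ z, f z ∂μ := by
    rw [← integral_indicator_one hK.measurableSet]
    refine integral_mono ((integrable_const (1 : ℝ)).indicator hK.measurableSet)
      (hint μ inferInstance) fun z => ?_
    by_cases hz : z ∈ K
    · simp [hz, hf1 hz]
    · simpa [hz] using (hf z).1
  have h2 : ∀ i, ∫ z, f z ∂(μs i) ≤ (μs i).real U := by
    intro i
    rw [← integral_indicator_one hU.measurableSet]
    refine integral_mono (hint _ inferInstance)
      ((integrable_const (1 : ℝ)).indicator hU.measurableSet) fun z => ?_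
    by_cases hz : z ∈ U
    · simpa [hz] using (hf z).2
    · simp [hz, hf0 (Set.mem_compl hz)]
  have hct : c < ⊤ := hc.trans_le le_top
  have h3 : c.toReal < ∫ z, f z ∂μ := by
    refine lt_of_lt_of_le ?_ h1
    exact (ENNReal.toReal_lt_toReal hct.ne (measure_ne_top _ _)).2 hcK
  obtain ⟨d, hcd, hd⟩ := exists_between h3
  have h4 := (hμ ⟨f, hfc⟩).eventually (lt_mem_nhds hd)
  refine lt_of_lt_of_le ((ENNReal.lt_ofReal_iff_toReal_lt hct.ne).2 hcd)
    (le_liminf_of_le (by isBoundedDefault) ?_)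
  filter_upwards [h4] with i hi
  exact ENNReal.ofReal_le_of_le_toReal (hi.le.trans (h2 i))

theorem tendsto_measureReal_of_vague_limit {μ : Measure X} [IsProbabilityMeasure μ]
    {μs : ℕ → Measure X} [∀ i, IsProbabilityMeasure (μs i)]
    (hμ : ∀ f : CompactlySupportedContinuousMap X ℝ,
      Tendsto (fun i => ∫ z, f z ∂(μs i)) atTop (𝓝 (∫ z, f z ∂μ)))
    {E : Set X} (hE : μ (frontier E) = 0) :
    Tendsto (fun i => (μs i).real E) atTop (𝓝 (μ.real E)) :=
  (ENNReal.tendsto_toReal (measure_ne_top _ _)).comp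
    (tendsto_measure_of_null_frontier (fun _ hU => le_liminf_measure_of_vague_limit hμ hU) hE)

/-- Composition with a homeomorphism preserves compactly supported functions, so invariance passes
to the limit. -/
theorem measurePreserving_of_vague_limit {μ : Measure X} [IsProbabilityMeasure μ]
    {μs : ℕ → Measure X}
    (hμ : ∀ f : CompactlySupportedContinuousMap X ℝ,
      Tendsto (fun i => ∫ z, f z ∂(μs i)) atTop (𝓝 (∫ z, f z ∂μ)))
    (T : X ≃ₜ X) (hT : ∀ i, (μs i).map T = μs i) : MeasurePreserving T μ μ := by
  refine ⟨T.continuous.measurable, ?_⟩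
  have : IsProbabilityMeasure (μ.map T) :=
    Measure.isProbabilityMeasure_map T.continuous.measurable.aemeasurable
  refine Measure.ext_of_integral_eq_on_compactlySupported fun f => ?_
  let g : CompactlySupportedContinuousMap X ℝ :=
    ⟨⟨fun z => f (T z), f.continuous.comp T.continuous⟩,
      f.hasCompactSupport'.comp_homeomorph T⟩
  have hm : ∀ m : Measure X, ∫ z, f z ∂(m.map T) = ∫ z, g z ∂m := fun m =>
    integral_map T.continuous.measurable.aemeasurable
      f.continuous.aestronglyMeasurable
  rw [hm]
  refine tendsto_nhds_unique (hμ g) ((hμ f).congr fun i => ?_)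
  rw [← hm, hT]

/-- Lower bounds for the entropy of long itineraries under measures converging vaguely to `μ` pass
to the entropy of itineraries of any fixed length under `μ`. -/
theorem le_entropy_of_vague_limit {μ : Measure X} [IsProbabilityMeasure μ]
    {μs : ℕ → Measure X} [∀ i, IsProbabilityMeasure (μs i)]
    (hμ : ∀ f : CompactlySupportedContinuousMap X ℝ,
      Tendsto (fun i => ∫ z, f z ∂(μs i)) atTop (𝓝 (∫ z, f z ∂μ)))
    {T : X ≃ₜ X} (hT : MeasurePreserving T μ μ) (hTs : ∀ i, MeasurePreserving T (μs i) (μs i))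
    {k : ℕ} {P : X → Fin k} (hPm : Measurable P) (hP : ∀ j, μ (frontier (P ⁻¹' {j})) = 0)
    {L : ℕ → ℕ} (hL : Tendsto L atTop atTop) {η : ℝ}
    (hη : ∀ᶠ i in atTop, η * L i ≤ partitionEntropy (μs i) (itinerary T P (L i)))
    {n : ℕ} (hn : 0 < n) : η ≤ partitionEntropy μ (itinerary T P n) / n := by
  have h1 : Tendsto (fun i => partitionEntropy (μs i) (itinerary T P n)) atTop
      (𝓝 (partitionEntropy μ (itinerary T P n))) := by
    refine tendsto_finsetSum _ fun w _ => ?_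
    exact (Real.continuous_negMulLog.tendsto _).comp
      (tendsto_measureReal_of_vague_limit hμ (measure_frontier_itinerary hT hP n w))
  have hn' : (0 : ℝ) < n := by exact_mod_cast hn
  have hL' : Tendsto (fun i => (L i : ℝ)) atTop atTop := tendsto_natCast_atTop_atTop.comp hL
  -- The term `n k / L i` is the remainder of the comparison between lengths `L i` and `n`; it
  -- vanishes since `L i → ∞`.
  have h2 : Tendsto (fun i => partitionEntropy (μs i) (itinerary T P n) / n + n * k / L i) atTop
      (𝓝 (partitionEntropy μ (itinerary T P n) / n + 0)) :=
    (h1.div_const _).add (hL'.const_div_atTop _)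
  rw [add_zero] at h2
  refine ge_of_tendsto h2 ?_
  filter_upwards [hη, hL.eventually_gt_atTop 0] with i hi hLi
  have hLi' : (0 : ℝ) < L i := by exact_mod_cast hLi
  have h3 := hi.trans (partitionEntropy_itinerary_le (hTs i) hPm hn (L i))
  rw [← mul_le_mul_iff_left₀ hLi']
  refine h3.trans (le_of_eq ?_)
  field_simp

end VagueLimit

/-! ### Itineraries that rarely visit the class of the cusp. -/

section GoodItineraries

variable {X : Type} [MeasurableSpace X]

/-- The itineraries of length `2 t + 1` which are not in the class `0` at the times `0` and `t` and
which are in the class `0` at a proportion at most `δ` of the time. -/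
def goodItineraries (k t : ℕ) (δ : ℝ) : Set (Fin (2 * t + 1) → Fin (k + 1)) :=
  {w | w 0 ≠ 0 ∧ w ⟨t, by omega⟩ ≠ 0 ∧
    ((Finset.univ.filter fun m => w m = 0).card : ℝ) ≤ δ * (2 * t + 1 : ℕ)}

/-- Being in class `0` at time `0`, or at time `t`, has probability at most `δ²`. By Markov's
inequality, spending a proportion at least `δ` of the time there has probability at most `δ² / δ =
δ`. The total `2 δ² + δ` is at most `3 δ`. -/
theorem measureReal_goodItineraries {μ : Measure X} [IsProbabilityMeasure μ] {T : X → X}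
    (hT : MeasurePreserving T μ μ) {k : ℕ} {P : X → Fin (k + 1)} (hP : Measurable P) (t : ℕ)
    {δ : ℝ} (hδ : 0 < δ) (hδ1 : δ ≤ 1) (h0 : μ.real (P ⁻¹' {0}) ≤ δ ^ 2) :
    1 - 3 * δ ≤ μ.real (itinerary T P (2 * t + 1) ⁻¹' goodItineraries k t δ) := by
  classical
  set L := 2 * t + 1 with hL
  have hLpos : (0 : ℝ) < L := by positivity
  have hA : MeasurableSet (P ⁻¹' {0}) := hP (measurableSet_singleton _)
  have hTm : ∀ m : ℕ, MeasurableSet (T^[m] ⁻¹' (P ⁻¹' {0})) := fun m =>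
    (hT.iterate m).measurable hA
  have hm : ∀ m : ℕ, μ.real (T^[m] ⁻¹' (P ⁻¹' {0})) = μ.real (P ⁻¹' {0}) := fun m =>
    (hT.iterate m).measureReal_preimage hA.nullMeasurableSet
  set c : X → ℝ := fun z => ∑ m : Fin L, (T^[m] ⁻¹' (P ⁻¹' {0})).indicator 1 z with hc
  have hcint : Integrable c μ := integrable_finsetSum _ fun m _ =>
    (integrable_const (1 : ℝ)).indicator (hTm m)
  have hc0 : 0 ≤ c := fun z => Finset.sum_nonneg fun m _ =>
    Set.indicator_nonneg (fun _ _ => zero_le_one) _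
  have hci : ∫ z, c z ∂μ = L * μ.real (P ⁻¹' {0}) := by
    have hi : ∀ m : ℕ, Integrable ((T^[m] ⁻¹' (P ⁻¹' {0})).indicator (1 : X → ℝ)) μ := fun m =>
      (integrable_const (1 : ℝ)).indicator (hTm m)
    simp only [hc]
    rw [integral_finsetSum _ fun (m : Fin L) _ => hi m]
    rw [Finset.sum_congr rfl fun (m : Fin L) _ =>
      (integral_indicator_one (hTm m)).trans (hm m)]
    simp
  have hmark := mul_meas_ge_le_integral_of_nonneg (ae_of_all μ hc0) hcint (δ * L)
  rw [hci] at hmark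
  have hbad : μ.real {z | δ * L ≤ c z} ≤ δ := by
    have : δ * L * μ.real {z | δ * L ≤ c z} ≤ δ * L * δ := by
      refine hmark.trans ?_
      nlinarith
    exact le_of_mul_le_mul_left this (by positivity)
  have hcov : (itinerary T P L ⁻¹' goodItineraries k t δ)ᶜ ⊆
      (T^[0] ⁻¹' (P ⁻¹' {0}) ∪ T^[t] ⁻¹' (P ⁻¹' {0})) ∪ {z | δ * L ≤ c z} := by
    intro z hz
    by_contra hcon
    simp only [Set.mem_union, not_or] at hcon
    refine hz ⟨hcon.1.1, hcon.1.2, ?_⟩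
    have h3 : ¬ δ * L ≤ c z := hcon.2
    push Not at h3
    refine le_trans (le_of_eq ?_) h3.le
    rw [Finset.card_filter, Nat.cast_sum]
    refine Finset.sum_congr rfl fun m _ => ?_
    by_cases h : P (T^[m] z) = 0 <;> simp [itinerary, h]
  have hmeas := measurableSet_itinerary hT.measurable hP L (goodItineraries k t δ)
  have h1 := probReal_compl_eq_one_sub (μ := μ) hmeas
  have h2 : μ.real (itinerary T P L ⁻¹' goodItineraries k t δ)ᶜ ≤ (δ ^ 2 + δ ^ 2) + δ := by
    refine (measureReal_mono hcov).trans ((measureReal_union_le _ _).trans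
      (add_le_add ((measureReal_union_le _ _).trans (add_le_add ?_ ?_)) hbad))
    · rw [hm]; exact h0
    · rw [hm]; exact h0
  nlinarith

end GoodItineraries

/-! ## The topology of the group of real points -/

section MatrixNorm

variable {N : ℕ}

/-- The operator norm on matrices for the sup norm on vectors. -/
noncomputable def matNorm (A : Matrix (Fin N) (Fin N) ℝ) : ℝ :=
  (Matrix.linftyOpNormedRing : NormedRing (Matrix (Fin N) (Fin N) ℝ)).norm A

theorem matNorm_nonneg (A : Matrix (Fin N) (Fin N) ℝ) : 0 ≤ matNorm A :=
  let _ := (Matrix.linftyOpNormedRing : NormedRing (Matrix (Fin N) (Fin N) ℝ)); norm_nonneg A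

theorem matNorm_zero : matNorm (0 : Matrix (Fin N) (Fin N) ℝ) = 0 :=
  let _ := (Matrix.linftyOpNormedRing : NormedRing (Matrix (Fin N) (Fin N) ℝ)); norm_zero

theorem matNorm_add_le (A B : Matrix (Fin N) (Fin N) ℝ) :
    matNorm (A + B) ≤ matNorm A + matNorm B :=
  let _ := (Matrix.linftyOpNormedRing : NormedRing (Matrix (Fin N) (Fin N) ℝ)); norm_add_le A B

theorem matNorm_sub_le (A B : Matrix (Fin N) (Fin N) ℝ) :
    matNorm (A - B) ≤ matNorm A + matNorm B :=
  let _ := (Matrix.linftyOpNormedRing : NormedRing (Matrix (Fin N) (Fin N) ℝ)); norm_sub_le A B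

theorem matNorm_sub_rev (A B : Matrix (Fin N) (Fin N) ℝ) :
    matNorm (A - B) = matNorm (B - A) :=
  let _ := (Matrix.linftyOpNormedRing : NormedRing (Matrix (Fin N) (Fin N) ℝ)); norm_sub_rev A B

theorem matNorm_mul_le (A B : Matrix (Fin N) (Fin N) ℝ) :
    matNorm (A * B) ≤ matNorm A * matNorm B :=
  let _ := (Matrix.linftyOpNormedRing : NormedRing (Matrix (Fin N) (Fin N) ℝ)); norm_mul_le A B

theorem matNorm_smul (c : ℝ) (A : Matrix (Fin N) (Fin N) ℝ) :
    matNorm (c • A) = |c| * matNorm A :=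
  let _ := (Matrix.linftyOpNormedRing : NormedRing (Matrix (Fin N) (Fin N) ℝ))
  let _ := (Matrix.linftyOpNormedAlgebra : NormedAlgebra ℝ (Matrix (Fin N) (Fin N) ℝ))
  norm_smul c A

theorem continuous_matNorm : Continuous (matNorm (N := N)) :=
  let _ := (Matrix.linftyOpNormedRing : NormedRing (Matrix (Fin N) (Fin N) ℝ)); continuous_norm

theorem abs_apply_le_matNorm (A : Matrix (Fin N) (Fin N) ℝ) (i j : Fin N) :
    |A i j| ≤ matNorm A := by
  have h : matNorm A = ((Finset.univ.sup fun i : Fin N => ∑ j, ‖A i j‖₊ : NNReal) : ℝ) :=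
    Matrix.linfty_opNorm_def A
  rw [h]
  have h1 : ‖A i j‖₊ ≤ ∑ j, ‖A i j‖₊ :=
    Finset.single_le_sum (f := fun j => ‖A i j‖₊) (fun _ _ => zero_le) (Finset.mem_univ j)
  have h2 := Finset.le_sup (f := fun i : Fin N => ∑ j, ‖A i j‖₊) (Finset.mem_univ i)
  exact_mod_cast h1.trans h2

theorem exists_matNorm_lt_of_mem_nhds {A : Matrix (Fin N) (Fin N) ℝ}
    {s : Set (Matrix (Fin N) (Fin N) ℝ)} (hs : s ∈ 𝓝 A) :
    ∃ r > 0, ∀ B, matNorm (B - A) < r → B ∈ s := by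
  let _ := (Matrix.linftyOpNormedRing : NormedRing (Matrix (Fin N) (Fin N) ℝ))
  obtain ⟨r, hr, h⟩ := Metric.mem_nhds_iff.1 hs
  exact ⟨r, hr, fun B hB => h (mem_ball_iff_norm.2 hB)⟩

/-- A ball of radius `C r` in the space of matrices is a union of `M` sets of diameter at most
`r / 4`, with `M` independent of `r`. -/
theorem exists_cells (C : ℝ) : ∃ M : ℕ, ∀ r > 0,
    ∃ κ : Matrix (Fin N) (Fin N) ℝ → Fin M, ∀ A B, matNorm A ≤ C * r → matNorm B ≤ C * r →
      κ A = κ B → matNorm (A - B) ≤ r / 4 := by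
  let _ := (Matrix.linftyOpNormedRing : NormedRing (Matrix (Fin N) (Fin N) ℝ))
  let _ := (Matrix.linftyOpNormedAlgebra : NormedAlgebra ℝ (Matrix (Fin N) (Fin N) ℝ))
  have : ProperSpace (Matrix (Fin N) (Fin N) ℝ) := FiniteDimensional.proper_real _
  -- The ball of radius `C` is covered once by balls of radius `1/8`, and the cover is then scaled
  -- by `r`. This is why the number of cells is the same for all `r`.
  have hc := (isCompact_closedBall (0 : Matrix (Fin N) (Fin N) ℝ) C).totallyBounded
  obtain ⟨t, ht, hcov⟩ := Metric.totallyBounded_iff.1 hc (1 / 8) (by norm_num)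
  have := ht.to_subtype
  obtain ⟨n, ⟨e⟩⟩ := Finite.exists_equiv_fin t
  refine ⟨n + 1, fun r hr => ?_⟩
  classical
  have key : ∀ A : Matrix (Fin N) (Fin N) ℝ, ‖A‖ ≤ C * r → ∃ y : t, ‖A - r • y.1‖ < r / 8 := by
    intro A hA
    have h1 : r⁻¹ • A ∈ Metric.closedBall (0 : Matrix (Fin N) (Fin N) ℝ) C := by
      rw [mem_closedBall_zero_iff, norm_smul, norm_inv, Real.norm_of_nonneg hr.le,
        inv_mul_le_iff₀ hr, mul_comm]
      exact hA
    obtain ⟨y, hy, hd⟩ := Set.mem_iUnion₂.1 (hcov h1)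
    refine ⟨⟨y, hy⟩, ?_⟩
    have h2 : A - r • y = r • (r⁻¹ • A - y) := by
      rw [smul_sub, smul_smul, mul_inv_cancel₀ hr.ne', one_smul]
    rw [h2, norm_smul, Real.norm_of_nonneg hr.le]
    rw [mem_ball_iff_norm] at hd
    nlinarith
  -- Matrices outside the ball receive the extra label `Fin.last n`, about which nothing is claimed.
  refine ⟨fun A => if h : ‖A‖ ≤ C * r then (e (key A h).choose).castSucc else Fin.last n,
    fun A B hA hB hAB => ?_⟩
  have hA' : ‖A‖ ≤ C * r := hA
  have hB' : ‖B‖ ≤ C * r := hB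
  simp only [hA', hB', dif_pos] at hAB
  have h3 := e.injective (Fin.castSucc_injective _ hAB)
  have h4 := (key A hA').choose_spec
  have h5 := (key B hB').choose_spec
  rw [← h3] at h5
  have h6 : A - B = (A - r • ((key A hA').choose : t).1) - (B - r • ((key A hA').choose : t).1) := by
    abel
  change ‖A - B‖ ≤ r / 4
  rw [h6]
  refine (norm_sub_le _ _).trans ?_
  linarith

theorem isOpenEmbedding_val_GL : IsOpenEmbedding
    (fun g : GL (Fin N) ℝ => (g : Matrix (Fin N) (Fin N) ℝ)) := by
  let _ := (Matrix.linftyOpNormedRing : NormedRing (Matrix (Fin N) (Fin N) ℝ))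
  let _ := (Matrix.linftyOpNormedAlgebra : NormedAlgebra ℝ (Matrix (Fin N) (Fin N) ℝ))
  have : CompleteSpace (Matrix (Fin N) (Fin N) ℝ) := FiniteDimensional.complete ℝ _
  exact Units.isOpenEmbedding_val

instance : SecondCountableTopology (GL (Fin N) ℝ) :=
  haveI : SecondCountableTopology (Matrix (Fin N) (Fin N) ℝ) :=
    inferInstanceAs (SecondCountableTopology (Fin N → Fin N → ℝ))
  isOpenEmbedding_val_GL.isEmbedding.secondCountableTopology

instance : LocallyCompactSpace (GL (Fin N) ℝ) :=
  haveI : LocallyCompactSpace (Matrix (Fin N) (Fin N) ℝ) :=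
    inferInstanceAs (LocallyCompactSpace (Fin N → Fin N → ℝ))
  isOpenEmbedding_val_GL.locallyCompactSpace

end MatrixNorm

namespace LinAlgGroup

variable {N : ℕ} (G : LinAlgGroup N)

theorem isClosed_realSubgroup : IsClosed (G.realSubgroup : Set (GL (Fin N) ℝ)) := by
  obtain ⟨S, hS⟩ := G.definedOverRat
  have : (G.realSubgroup : Set (GL (Fin N) ℝ)) = ⋂ p ∈ S, {g | MvPolynomial.aeval (matEntries
      (Matrix.GeneralLinearGroup.map Complex.ofRealHom g : Matrix (Fin N) (Fin N) ℂ)) p = 0} := by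
    ext g
    rw [Set.mem_iInter₂]
    exact hS _
  rw [this]
  refine isClosed_biInter fun p _ => isClosed_eq ?_ continuous_const
  have h1 : Continuous fun g : GL (Fin N) ℝ => matEntries
      (Matrix.GeneralLinearGroup.map Complex.ofRealHom g : Matrix (Fin N) (Fin N) ℂ) := by
    refine continuous_pi fun ij => ?_
    exact Complex.continuous_ofReal.comp (isOpenEmbedding_val_GL.continuous.matrix_elem ij.1 ij.2)
  simp only [MvPolynomial.aeval_def, MvPolynomial.eval₂_eq_eval_map]
  exact (MvPolynomial.continuous_eval _).comp h1

instance : T2Space G.RealPoints := inferInstanceAs (T2Space G.realSubgroup)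

instance : SecondCountableTopology G.RealPoints :=
  (IsEmbedding.subtypeVal (p := (· ∈ G.realSubgroup))).secondCountableTopology

instance : LocallyCompactSpace G.RealPoints := G.isClosed_realSubgroup.locallyCompactSpace

/-- A real point as a matrix. -/
def toMat (g : G.RealPoints) : Matrix (Fin N) (Fin N) ℝ := G.toGL g

theorem toMat_mul (g h : G.RealPoints) : G.toMat (g * h) = G.toMat g * G.toMat h := by
  simp [toMat]

theorem toMat_one : G.toMat 1 = 1 := by simp [toMat]

theorem toMat_inv_mul (g : G.RealPoints) : G.toMat g⁻¹ * G.toMat g = 1 := by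
  rw [← toMat_mul, inv_mul_cancel, toMat_one]

theorem isEmbedding_toMat : IsEmbedding G.toMat :=
  isOpenEmbedding_val_GL.isEmbedding.comp IsEmbedding.subtypeVal

theorem continuous_toMat : Continuous G.toMat := G.isEmbedding_toMat.continuous

theorem coe_Ad (g : G.RealPoints) (X : G.lieAlg) :
    (G.Ad g X : Matrix (Fin N) (Fin N) ℝ) = G.toMat g * X * G.toMat g⁻¹ := rfl

/-- The distance of a real point from the identity. -/
noncomputable def dev (g : G.RealPoints) : ℝ := matNorm (G.toMat g - 1)

theorem dev_nonneg (g : G.RealPoints) : 0 ≤ G.dev g := matNorm_nonneg _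

theorem dev_one : G.dev 1 = 0 := by rw [dev, toMat_one, sub_self, matNorm_zero]

theorem continuous_dev : Continuous G.dev :=
  continuous_matNorm.comp (G.continuous_toMat.sub continuous_const)

theorem dev_lt_mem_nhds {r : ℝ} (hr : 0 < r) : {g | G.dev g < r} ∈ 𝓝 (1 : G.RealPoints) :=
  (isOpen_lt G.continuous_dev continuous_const).mem_nhds (by simpa [dev_one] using hr)

theorem exists_dev_lt_of_mem_nhds {s : Set G.RealPoints} (hs : s ∈ 𝓝 (1 : G.RealPoints)) :
    ∃ r > 0, ∀ g, G.dev g < r → g ∈ s := by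
  rw [G.isEmbedding_toMat.nhds_eq_comap, mem_comap] at hs
  obtain ⟨t, ht, hts⟩ := hs
  rw [toMat_one] at ht
  obtain ⟨r, hr, h⟩ := exists_matNorm_lt_of_mem_nhds ht
  exact ⟨r, hr, fun g hg => hts (h _ hg)⟩

theorem dev_mul_le (g h : G.RealPoints) :
    G.dev (g * h) ≤ G.dev g + G.dev h + G.dev g * G.dev h := by
  have : G.toMat (g * h) - 1 = (G.toMat g - 1) + (G.toMat h - 1) +
      (G.toMat g - 1) * (G.toMat h - 1) := by
    rw [toMat_mul]; noncomm_ring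
  rw [dev, this]
  exact (matNorm_add_le _ _).trans (add_le_add (matNorm_add_le _ _) (matNorm_mul_le _ _))

/-- In `g⁻¹ - 1 = (1 - g) + (g⁻¹ - 1)(1 - g)` the last term can be absorbed on the left once `dev g
≤ 1/2`. -/
theorem dev_inv_le {g : G.RealPoints} (hg : G.dev g ≤ 1 / 2) : G.dev g⁻¹ ≤ 2 * G.dev g := by
  have : G.toMat g⁻¹ - 1 = (1 - G.toMat g) + (G.toMat g⁻¹ - 1) * (1 - G.toMat g) := by
    rw [mul_sub, sub_mul _ _ (G.toMat g), toMat_inv_mul]; noncomm_ring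
  have h1 : G.dev g⁻¹ ≤ G.dev g + G.dev g⁻¹ * G.dev g := by
    have h2 : G.dev g = matNorm (1 - G.toMat g) := matNorm_sub_rev _ _
    rw [h2]
    nth_rewrite 1 [dev]
    rw [this]
    exact (matNorm_add_le _ _).trans (add_le_add le_rfl (matNorm_mul_le _ _))
  nlinarith [G.dev_nonneg g⁻¹]

theorem dev_inv_mul_le (g h : G.RealPoints) :
    G.dev (g⁻¹ * h) ≤ (1 + G.dev g⁻¹) * matNorm (G.toMat h - G.toMat g) := by
  have : G.toMat (g⁻¹ * h) - 1 = (G.toMat h - G.toMat g) +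
      (G.toMat g⁻¹ - 1) * (G.toMat h - G.toMat g) := by
    rw [toMat_mul, sub_mul, mul_sub, toMat_inv_mul]; noncomm_ring
  rw [dev, this]
  refine (matNorm_add_le _ _).trans ((add_le_add le_rfl (matNorm_mul_le _ _)).trans (le_of_eq ?_))
  rw [dev]; ring

theorem dev_conj_le (a g : G.RealPoints) :
    G.dev (a⁻¹ * g * a) ≤ matNorm (G.toMat a⁻¹) * matNorm (G.toMat a) * G.dev g := by
  have : G.toMat (a⁻¹ * g * a) - 1 = G.toMat a⁻¹ * (G.toMat g - 1) * G.toMat a := by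
    rw [toMat_mul, toMat_mul, mul_sub, sub_mul, mul_one, toMat_inv_mul]
  rw [dev, this]
  refine (matNorm_mul_le _ _).trans
    ((mul_le_mul_of_nonneg_right (matNorm_mul_le _ _) (matNorm_nonneg _)).trans (le_of_eq ?_))
  rw [dev]; ring

end LinAlgGroup

/-! ## Discreteness -/

namespace LinAlgGroup

variable {N : ℕ} (G : LinAlgGroup N)

theorem eq_one_of_dev_lt_one {g : G.RealPoints} (hg : g ∈ G.integerPoints) (h : G.dev g < 1) :
    g = 1 := by
  obtain ⟨A, hA⟩ := hg
  have hA' : ∀ i j, G.toMat g i j = ((A : Matrix (Fin N) (Fin N) ℤ) i j : ℝ) := by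
    intro i j
    change (G.toGL g : Matrix (Fin N) (Fin N) ℝ) i j = _
    rw [← hA]
    rfl
  apply G.isEmbedding_toMat.injective
  rw [toMat_one]
  ext i j
  have h1 := (abs_apply_le_matNorm (G.toMat g - 1) i j).trans_lt h
  rw [Matrix.sub_apply, hA', Matrix.one_apply] at h1
  rw [hA', Matrix.one_apply]
  split_ifs at h1 ⊢
  · have : |(A : Matrix (Fin N) (Fin N) ℤ) i j - 1| < 1 := by exact_mod_cast h1
    have := Int.abs_lt_one_iff.1 this
    exact_mod_cast (by omega : (A : Matrix (Fin N) (Fin N) ℤ) i j = 1)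
  · have : |(A : Matrix (Fin N) (Fin N) ℤ) i j| < 1 := by
      rw [sub_zero] at h1
      exact_mod_cast h1
    exact_mod_cast Int.abs_lt_one_iff.1 this

theorem countable_integerPoints : Countable G.integerPoints := by
  have h : ∀ g : G.integerPoints, ∃ A : GL (Fin N) ℤ,
      Matrix.GeneralLinearGroup.map (Int.castRingHom ℝ) A = G.toGL g := fun g => g.2
  choose f hf using h
  have : Countable (GL (Fin N) ℤ) := by
    have : Countable (Matrix (Fin N) (Fin N) ℤ) :=
      inferInstanceAs (Countable (Fin N → Fin N → ℤ))
    exact Function.Injective.countable (f := fun g : GL (Fin N) ℤ =>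
      (g : Matrix (Fin N) (Fin N) ℤ)) Units.val_injective
  refine Function.Injective.countable (f := f) fun g g' hgg' => ?_
  have := hf g
  rw [hgg', hf g'] at this
  exact Subtype.ext (Subtype.ext this.symm)

variable {G} {Γ : Subgroup G.RealPoints}

/-- Every use of commensurability goes through this: discreteness and countability of `Γ` are
inherited from the integer points along finitely many cosets. -/
theorem exists_finite_cosets (hΓ : Γ.Commensurable G.integerPoints) :
    ∃ F : Set G.RealPoints, F.Finite ∧ ∀ γ ∈ Γ, ∃ f ∈ F, f⁻¹ * γ ∈ G.integerPoints := by
  have : (G.integerPoints.subgroupOf Γ).FiniteIndex := ⟨hΓ.2⟩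
  have hfin : Finite (Γ ⧸ G.integerPoints.subgroupOf Γ) := inferInstance
  refine ⟨Set.range fun q : Γ ⧸ G.integerPoints.subgroupOf Γ => (q.out : G.RealPoints),
    Set.finite_range _, fun γ hγ => ⟨_, ⟨QuotientGroup.mk ⟨γ, hγ⟩, rfl⟩, ?_⟩⟩
  have h1 : (QuotientGroup.mk (QuotientGroup.mk (s := G.integerPoints.subgroupOf Γ)
    (⟨γ, hγ⟩ : Γ)).out : Γ ⧸ G.integerPoints.subgroupOf Γ) = QuotientGroup.mk ⟨γ, hγ⟩ :=
    Quotient.out_eq _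
  have h2 := QuotientGroup.eq.1 h1
  exact Subgroup.mem_subgroupOf.1 h2

theorem countable_of_commensurable (hΓ : Γ.Commensurable G.integerPoints) : Countable Γ := by
  obtain ⟨F, hF, h⟩ := exists_finite_cosets hΓ
  have := G.countable_integerPoints
  have h1 : (Γ : Set G.RealPoints) ⊆
      ⋃ f ∈ F, (fun x => f * x) '' (G.integerPoints : Set G.RealPoints) := by
    intro γ hγ
    obtain ⟨f, hf, hfγ⟩ := h γ hγ
    exact Set.mem_biUnion hf ⟨_, hfγ, by simp⟩
  exact (Set.Countable.mono h1 (hF.countable.biUnion fun f _ =>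
    (Set.to_countable _).image _)).to_subtype

/-- Two elements of `Γ` near the identity in the same coset of the integer points differ by an
integral matrix at distance less than one from the identity, so they agree. Hence a small ball
contains only finitely many elements of `Γ` and can be shrunk. -/
theorem exists_dev_isolated (hΓ : Γ.Commensurable G.integerPoints) :
    ∃ ρ > 0, ∀ γ ∈ Γ, G.dev γ < ρ → γ = 1 := by
  obtain ⟨F, hF, h⟩ := exists_finite_cosets hΓ
  have hfin : {γ | γ ∈ Γ ∧ G.dev γ < 1 / 8}.Finite := by
    choose! φ hφ hφ' using h
    refine Set.Finite.of_finite_image (f := φ) (hF.subset ?_) ?_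
    · rintro _ ⟨γ, hγ, rfl⟩
      exact hφ γ hγ.1
    · intro γ hγ γ' hγ' heq
      have h1 : γ⁻¹ * γ' ∈ G.integerPoints := by
        have := G.integerPoints.mul_mem (G.integerPoints.inv_mem (hφ' γ hγ.1)) (hφ' γ' hγ'.1)
        simpa [heq, mul_assoc] using this
      have h2 : G.dev (γ⁻¹ * γ') < 1 := by
        have h3 := G.dev_inv_le (hγ.2.le.trans (by norm_num))
        have h4 := G.dev_mul_le γ⁻¹ γ'
        have h5 : G.dev γ < 1 / 8 := hγ.2
        have h6 : G.dev γ' < 1 / 8 := hγ'.2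
        nlinarith [G.dev_nonneg γ⁻¹, G.dev_nonneg γ', G.dev_nonneg γ]
      exact (inv_mul_eq_one.1 (G.eq_one_of_dev_lt_one h1 h2))
  have hU : ({γ | γ ∈ Γ ∧ G.dev γ < 1 / 8} \ {1})ᶜ ∈ 𝓝 (1 : G.RealPoints) :=
    (hfin.subset Set.sdiff_subset).isClosed.isOpen_compl.mem_nhds (by simp)
  obtain ⟨r, hr, hrU⟩ := G.exists_dev_lt_of_mem_nhds hU
  refine ⟨min r (1 / 8), lt_min hr (by norm_num), fun γ hγ hd => ?_⟩
  have h1 := hrU γ (hd.trans_le (min_le_left _ _))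
  by_contra hne
  exact h1 ⟨⟨hγ, hd.trans_le (min_le_right _ _)⟩, hne⟩

theorem discreteTopology_of_commensurable (hΓ : Γ.Commensurable G.integerPoints) :
    DiscreteTopology Γ := by
  obtain ⟨ρ, hρ, h⟩ := exists_dev_isolated hΓ
  refine discreteTopology_of_isOpen_singleton_one ?_
  have : ({1} : Set Γ) = (fun γ : Γ => G.dev γ) ⁻¹' Set.Iio ρ := by
    ext γ
    simp only [Set.mem_singleton_iff, Set.mem_preimage, Set.mem_Iio]
    refine ⟨fun h1 => by simpa [h1, dev_one] using hρ, fun h1 => Subtype.ext (h γ γ.2 h1)⟩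
  rw [this]
  exact isOpen_Iio.preimage (G.continuous_dev.comp continuous_subtype_val)

/-- The injectivity radius is bounded below on compact sets. -/
theorem exists_injectivity_radius (hΓ : Γ.Commensurable G.integerPoints) {K : Set G.RealPoints}
    (hK : IsCompact K) : ∃ ρ > 0, ∀ q ∈ K, ∀ γ ∈ Γ, G.dev (q⁻¹ * γ * q) < ρ → γ = 1 := by
  obtain ⟨ρ, hρ, h⟩ := exists_dev_isolated hΓ
  have hc : Continuous fun q : G.RealPoints => matNorm (G.toMat q⁻¹) * matNorm (G.toMat q) :=
    (continuous_matNorm.comp (G.continuous_toMat.comp continuous_inv)).mul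
      (continuous_matNorm.comp G.continuous_toMat)
  obtain ⟨C, hC⟩ := (hK.image hc).bddAbove
  have hC1 : 0 < max C 1 := lt_max_of_lt_right one_pos
  refine ⟨ρ / max C 1, by positivity, fun q hq γ hγ hd => h γ hγ ?_⟩
  have h1 := G.dev_conj_le q⁻¹ (q⁻¹ * γ * q)
  have h2 : q⁻¹⁻¹ * (q⁻¹ * γ * q) * q⁻¹ = γ := by group
  rw [h2, inv_inv] at h1
  have h3 : matNorm (G.toMat q⁻¹) * matNorm (G.toMat q) ≤ max C 1 :=
    (hC ⟨q, hq, rfl⟩).trans (le_max_left _ _)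
  calc G.dev γ ≤ _ := h1
    _ ≤ max C 1 * G.dev (q⁻¹ * γ * q) := by
      rw [mul_comm (matNorm (G.toMat q))]
      exact mul_le_mul_of_nonneg_right h3 (G.dev_nonneg _)
    _ < max C 1 * (ρ / max C 1) := mul_lt_mul_of_pos_left hd hC1
    _ = ρ := mul_div_cancel₀ _ hC1.ne'

end LinAlgGroup

/-! ## Covering itinerary sets by Bowen balls -/

namespace LinAlgGroup

variable {N : ℕ} (G : LinAlgGroup N)

/-- The elements of `S` differ by elements which stay within `r` of the identity under conjugation
by `a⁰, …, aʲ`. -/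
def BowenSmall (a : G.RealPoints) (r : ℝ) (j : ℕ) (S : Set G.RealPoints) : Prop :=
  ∀ g ∈ S, ∀ g' ∈ S, ∀ i ≤ j, G.dev ((a ^ i)⁻¹ * (g⁻¹ * g') * a ^ i) < r

variable {G}

theorem BowenSmall.subset {a : G.RealPoints} {r : ℝ} {j : ℕ} {S S' : Set G.RealPoints}
    (h : G.BowenSmall a r j S) (hS : S' ⊆ S) : G.BowenSmall a r j S' :=
  fun g hg g' hg' => h g (hS hg) g' (hS hg')

theorem BowenSmall.dev_succ_le {a : G.RealPoints} {r C : ℝ} (hC1 : 1 ≤ C)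
    (hC : ∀ u, G.dev (a⁻¹ * u * a) ≤ C * G.dev u) {j : ℕ} {S : Set G.RealPoints}
    (h : G.BowenSmall a r j S) {g g' : G.RealPoints} (hg : g ∈ S) (hg' : g' ∈ S) :
    G.dev ((a ^ (j + 1))⁻¹ * (g⁻¹ * g') * a ^ (j + 1)) ≤ C * r := by
  have h1 : (a ^ (j + 1))⁻¹ * (g⁻¹ * g') * a ^ (j + 1) =
      a⁻¹ * ((a ^ j)⁻¹ * (g⁻¹ * g') * a ^ j) * a := by
    rw [pow_succ]; group
  rw [h1]
  exact (hC _).trans (mul_le_mul_of_nonneg_left (h g hg g' hg' j le_rfl).le (by linarith))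

/-- This fixes the size `r / 8` of the pieces of the partition: two points of one piece differ by
less than `r`. -/
theorem dev_inv_mul_lt {r : ℝ} (hr1 : r ≤ 1 / 2) {v v' : G.RealPoints}
    (hv : G.dev v < r / 8) (hv' : G.dev v' < r / 8) : G.dev (v⁻¹ * v') < r := by
  have h1 := G.dev_inv_mul_le v v'
  have h2 : matNorm (G.toMat v' - G.toMat v) ≤ G.dev v' + G.dev v := by
    have : G.toMat v' - G.toMat v = (G.toMat v' - 1) - (G.toMat v - 1) := by abel
    rw [this]
    exact matNorm_sub_le _ _
  have h3 := G.dev_inv_le (g := v) (by linarith)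
  nlinarith [G.dev_nonneg v, G.dev_nonneg v⁻¹, matNorm_nonneg (G.toMat v' - G.toMat v)]

/-- Passing from time `j` to time `j + 1` inside a small piece of `Γ \ G` on which the injectivity
radius is bounded below. -/
theorem BowenSmall.succ_of_piece {Γ : Subgroup G.RealPoints} {a : G.RealPoints} {r C : ℝ}
    (hC1 : 1 ≤ C) (hC : ∀ u, G.dev (a⁻¹ * u * a) ≤ C * G.dev u) (hr : 0 < r)
    (hCr : C * r ≤ 1 / 2) {j : ℕ} {S : Set G.RealPoints} (h : G.BowenSmall a r j S)
    {q : G.RealPoints} (hq : ∀ γ ∈ Γ, G.dev (q⁻¹ * γ * q) < 4 * C * r → γ = 1)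
    (hS : ∀ g ∈ S, ∃ v, G.dev v < r / 8 ∧
      HomSpace.mk Γ (q * v) = HomSpace.mk Γ (g * a ^ (j + 1))) :
    G.BowenSmall a r (j + 1) S := by
  intro g hg g' hg' i hi
  rcases hi.lt_or_eq with hi | rfl
  · exact h g hg g' hg' i (Nat.lt_succ_iff.1 hi)
  have hr1 : r ≤ 1 / 2 := by nlinarith
  set x := (a ^ (j + 1))⁻¹ * (g⁻¹ * g') * a ^ (j + 1) with hx
  have hxd : G.dev x ≤ C * r := h.dev_succ_le hC1 hC hg hg'
  obtain ⟨v, hv, hvm⟩ := hS g hg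
  obtain ⟨v', hv', hvm'⟩ := hS g' hg'
  obtain ⟨γ, hγ, h1⟩ := (HomSpace.mk_eq_mk_iff Γ).1 hvm
  obtain ⟨γ', hγ', h2⟩ := (HomSpace.mk_eq_mk_iff Γ).1 hvm'
  have hxv : x = v⁻¹ * (q⁻¹ * (γ⁻¹ * γ') * q) * v' := by
    have : x = (g * a ^ (j + 1))⁻¹ * (g' * a ^ (j + 1)) := by rw [hx]; group
    rw [this, h1, h2]
    group
  have hy : q⁻¹ * (γ⁻¹ * γ') * q = v * x * v'⁻¹ := by rw [hxv]; group
  -- The Bowen condition at time `j` keeps `x` within `C r` of the identity, and `v`, `v'` are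
  -- small. So the lattice element comparing the two lifts, conjugated by `q`, lies below the
  -- injectivity radius and is trivial, leaving `x = v⁻¹ v'`.
  have hone : γ⁻¹ * γ' = 1 := by
    refine hq _ (Γ.mul_mem (Γ.inv_mem hγ) hγ') ?_
    rw [hy]
    have e1 := G.dev_mul_le v x
    have e2 := G.dev_mul_le (v * x) v'⁻¹
    have e3 := G.dev_inv_le (g := v') (by linarith)
    have n1 := G.dev_nonneg v
    have n2 := G.dev_nonneg x
    have n3 := G.dev_nonneg v'⁻¹
    have n4 := G.dev_nonneg (v * x)
    have hvx : G.dev (v * x) ≤ 2 * (C * r) := by nlinarith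
    have hrC : r ≤ C * r := by nlinarith
    nlinarith
  rw [hxv, hone, mul_one, inv_mul_cancel, mul_one]
  exact dev_inv_mul_lt hr1 hv hv'

/-- The measure of the set of points with a given itinerary `w` is at most `κ₀ M ^ c` if `κ₀` bounds
the measure of the part in a Bowen ball, and `c` is the number of times spent in the class `0`. -/
theorem measure_itinerary_le {Γ : Subgroup G.RealPoints} {a : G.RealPoints} {r C : ℝ}
    (hC1 : 1 ≤ C) (hC : ∀ u, G.dev (a⁻¹ * u * a) ≤ C * G.dev u) (hr : 0 < r)
    (hCr : C * r ≤ 1 / 2) {M : ℕ} {κ : Matrix (Fin N) (Fin N) ℝ → Fin M}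
    (hκ : ∀ A B, matNorm A ≤ C * r → matNorm B ≤ C * r → κ A = κ B → matNorm (A - B) ≤ r / 4)
    {k : ℕ} {P : HomSpace Γ → Fin (k + 1)}
    (hP : ∀ j, j ≠ 0 → ∃ q, (∀ γ ∈ Γ, G.dev (q⁻¹ * γ * q) < 4 * C * r → γ = 1) ∧
      ∀ z, P z = j → ∃ v, G.dev v < r / 8 ∧ HomSpace.mk Γ (q * v) = z)
    (m : Measure (HomSpace Γ)) (w : ℕ → Fin (k + 1)) (hw0 : w 0 ≠ 0) (L : ℕ)
    {A : Set (HomSpace Γ)} (hA : ∀ z ∈ A, ∀ i ≤ L, P (HomSpace.rightMul Γ (a ^ i) z) = w i)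
    {κ₀ : ℝ≥0∞} (hκ₀ : ∀ S, G.BowenSmall a r L S → m (A ∩ HomSpace.mk Γ '' S) ≤ κ₀) :
    m A ≤ (M : ℝ≥0∞) ^ ((Finset.range (L + 1)).filter fun i => w i = 0).card * κ₀ := by
  -- Induction on the number `d` of remaining times: a Bowen set up to time `j` is refined to one up
  -- to time `L`, and a factor `M` is paid only at visits to class `0`.
  have main : ∀ d j, j + d = L → ∀ S, G.BowenSmall a r j S →
      m (A ∩ HomSpace.mk Γ '' S) ≤
        (M : ℝ≥0∞) ^ ((Finset.Ioc j L).filter fun i => w i = 0).card * κ₀ := by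
    intro d
    induction d with
    | zero =>
      rintro j hj S hS
      rw [add_zero] at hj
      subst hj
      simpa using hκ₀ S hS
    | succ d ih =>
      intro j hj S hS
      have hI : Finset.Ioc j L = insert (j + 1) (Finset.Ioc (j + 1) L) := by
        ext i; simp only [Finset.mem_Ioc, Finset.mem_insert]; omega
      rw [hI, Finset.filter_insert]
      -- In class `0` nothing is known about the injectivity radius, so the set, which may have
      -- grown to size `C r`, is cut into `M` cells. In any other class the refinement is free.
      by_cases hw : w (j + 1) = 0
      · rw [if_pos hw, Finset.card_insert_of_notMem (by simp), pow_succ']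
        rcases S.eq_empty_or_nonempty with rfl | ⟨g₀, hg₀⟩
        · simp
        set f : G.RealPoints → G.RealPoints := fun g =>
          (a ^ (j + 1))⁻¹ * (g₀⁻¹ * g) * a ^ (j + 1) with hf
        have hcov : A ∩ HomSpace.mk Γ '' S ⊆ ⋃ c : Fin M,
            A ∩ HomSpace.mk Γ '' {g ∈ S | κ (G.toMat (f g) - 1) = c} := by
          rintro z ⟨hz, g, hg, rfl⟩
          exact Set.mem_iUnion.2 ⟨κ (G.toMat (f g) - 1), hz, g, ⟨hg, rfl⟩, rfl⟩
        have hsmall : ∀ c : Fin M,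
            G.BowenSmall a r (j + 1) {g ∈ S | κ (G.toMat (f g) - 1) = c} := by
          rintro c g ⟨hg, hgc⟩ g' ⟨hg', hgc'⟩ i hi
          rcases hi.lt_or_eq with hi | rfl
          · exact hS g hg g' hg' i (Nat.lt_succ_iff.1 hi)
          have d1 : G.dev (f g) ≤ C * r := hS.dev_succ_le hC1 hC hg₀ hg
          have d2 : G.dev (f g') ≤ C * r := hS.dev_succ_le hC1 hC hg₀ hg'
          have h1 := hκ _ _ d2 d1 (hgc'.trans hgc.symm)
          rw [sub_sub_sub_cancel_right] at h1
          have h2 : (a ^ (j + 1))⁻¹ * (g⁻¹ * g') * a ^ (j + 1) = (f g)⁻¹ * f g' := by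
            rw [hf]; group
          rw [h2]
          have h3 := G.dev_inv_mul_le (f g) (f g')
          have h4 := G.dev_inv_le (d1.trans hCr)
          -- The cells have diameter at most `r / 4` and `dev (f g)⁻¹ ≤ 1`, so the difference has
          -- size at most `r / 2 < r`.
          nlinarith [G.dev_nonneg (f g)⁻¹, matNorm_nonneg (G.toMat (f g') - G.toMat (f g))]
        calc m (A ∩ HomSpace.mk Γ '' S)
            ≤ ∑ c : Fin M, m (A ∩ HomSpace.mk Γ '' {g ∈ S | κ (G.toMat (f g) - 1) = c}) :=
              (measure_mono hcov).trans (measure_iUnion_fintype_le _ _)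
          _ ≤ ∑ _c : Fin M,
              (M : ℝ≥0∞) ^ ((Finset.Ioc (j + 1) L).filter fun i => w i = 0).card * κ₀ :=
              Finset.sum_le_sum fun c _ => ih (j + 1) (by omega) _ (hsmall c)
          _ = _ := by simp [mul_assoc]
      · rw [if_neg hw]
        obtain ⟨q, hq, hPq⟩ := hP _ hw
        -- Discarding the elements of `S` that do not project to `A` makes the itinerary available
        -- at every remaining point.
        have h1 : A ∩ HomSpace.mk Γ '' S ⊆
            A ∩ HomSpace.mk Γ '' {g ∈ S | HomSpace.mk Γ g ∈ A} := by
          rintro z ⟨hz, g, hg, rfl⟩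
          exact ⟨hz, g, ⟨hg, hz⟩, rfl⟩
        refine (measure_mono h1).trans (ih (j + 1) (by omega) _ ?_)
        refine (hS.subset (Set.sep_subset _ _)).succ_of_piece hC1 hC hr hCr hq fun g hg => ?_
        exact hPq _ (hA _ hg.2 (j + 1) (by omega))
  obtain ⟨q, hq, hPq⟩ := hP _ hw0
  have hS₀ : G.BowenSmall a r 0 {g | ∃ v, G.dev v < r / 8 ∧ g = q * v} := by
    rintro _ ⟨v, hv, rfl⟩ _ ⟨v', hv', rfl⟩ i hi
    obtain rfl : i = 0 := by omega
    have : (a ^ 0)⁻¹ * ((q * v)⁻¹ * (q * v')) * a ^ 0 = v⁻¹ * v' := by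
      rw [pow_zero]; group
    rw [this]
    exact dev_inv_mul_lt (by nlinarith) hv hv'
  have h1 : A ⊆ A ∩ HomSpace.mk Γ '' {g | ∃ v, G.dev v < r / 8 ∧ g = q * v} := by
    intro z hz
    have h2 := hA z hz 0 (Nat.zero_le _)
    rw [pow_zero, HomSpace.rightMul_one] at h2
    obtain ⟨v, hv, rfl⟩ := hPq z h2
    exact ⟨hz, _, ⟨v, hv, rfl⟩, rfl⟩
  refine (measure_mono h1).trans ((main L 0 (by omega) _ hS₀).trans (le_of_eq ?_))
  -- The induction counts visits at times `1, …, L`; since `w 0 ≠ 0`, including time `0` changes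
  -- nothing.
  congr 3
  ext i
  simp only [Finset.mem_filter, Finset.mem_Ioc, Finset.mem_range]
  constructor
  · rintro ⟨⟨_, h⟩, h'⟩
    exact ⟨by omega, h'⟩
  · rintro ⟨h, h'⟩
    refine ⟨⟨Nat.pos_of_ne_zero ?_, by omega⟩, h'⟩
    rintro rfl
    exact hw0 h'

end LinAlgGroup

/-! ## Split Cartan subalgebras in diagonal coordinates -/

namespace LinAlgGroup

section Conj

variable {N : ℕ}

/-- Conjugation of matrices by `P`. -/
def conjBy (P : GL (Fin N) ℝ) : Matrix (Fin N) (Fin N) ℝ →ₗ[ℝ] Matrix (Fin N) (Fin N) ℝ where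
  toFun A := P.1 * A * P⁻¹.1
  map_add' A B := by rw [mul_add, add_mul]
  map_smul' c A := by simp

variable (P : GL (Fin N) ℝ)

theorem conjBy_apply (A : Matrix (Fin N) (Fin N) ℝ) : conjBy P A = P.1 * A * P⁻¹.1 := rfl

theorem conjBy_mul (A B : Matrix (Fin N) (Fin N) ℝ) :
    conjBy P (A * B) = conjBy P A * conjBy P B := by
  simp only [conjBy_apply]
  rw [show P.1 * A * P⁻¹.1 * (P.1 * B * P⁻¹.1) = P.1 * A * (P⁻¹.1 * P.1) * B * P⁻¹.1 by
    noncomm_ring, Units.inv_mul]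
  noncomm_ring

theorem conjBy_injective : Function.Injective (conjBy P) := by
  intro A B h
  have : P⁻¹.1 * conjBy P A * P.1 = P⁻¹.1 * conjBy P B * P.1 := by rw [h]
  have key : ∀ C, P⁻¹.1 * conjBy P C * P.1 = C := by
    intro C
    rw [conjBy_apply, show P⁻¹.1 * (P.1 * C * P⁻¹.1) * P.1 = (P⁻¹.1 * P.1) * C * (P⁻¹.1 * P.1) by
      noncomm_ring, Units.inv_mul, one_mul, mul_one]
  rwa [key, key] at this

theorem conjBy_lie_apply {X Y : Matrix (Fin N) (Fin N) ℝ} (hX : (conjBy P X).IsDiag)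
    (i j : Fin N) :
    conjBy P ⁅X, Y⁆ i j = (conjBy P X i i - conjBy P X j j) * conjBy P Y i j := by
  rw [Ring.lie_def, map_sub, conjBy_mul, conjBy_mul, Matrix.sub_apply]
  nth_rewrite 1 [← hX.diagonal_diag]
  nth_rewrite 2 [← hX.diagonal_diag]
  rw [Matrix.diagonal_mul, Matrix.mul_diagonal]
  simp only [Matrix.diag_apply]
  ring

end Conj

variable {N : ℕ} {G : LinAlgGroup N}

/-- `P` conjugates all elements of `h` to diagonal matrices. -/
def Diagonalizes (P : GL (Fin N) ℝ) (h : LieSubalgebra ℝ G.lieAlg) : Prop :=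
  ∀ X ∈ h, (conjBy P (X : Matrix (Fin N) (Fin N) ℝ)).IsDiag

/-- The weight of `h` on the matrix entry `(i, j)`. -/
def entryWeight (P : GL (Fin N) ℝ) (h : LieSubalgebra ℝ G.lieAlg) (i j : Fin N) :
    Module.Dual ℝ h where
  toFun X := conjBy P (X : G.lieAlg) i i - conjBy P (X : G.lieAlg) j j
  map_add' X Y := by simp; ring
  map_smul' c X := by simp; ring

theorem entryWeight_apply (P : GL (Fin N) ℝ) (h : LieSubalgebra ℝ G.lieAlg) (i j : Fin N) (X : h) :
    entryWeight P h i j X = conjBy P (X : G.lieAlg) i i - conjBy P (X : G.lieAlg) j j := rfl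

theorem coe_add (Y Z : G.lieAlg) : ((Y + Z : G.lieAlg) : Matrix (Fin N) (Fin N) ℝ) = Y.1 + Z.1 :=
  rfl

theorem coe_sub (Y Z : G.lieAlg) : ((Y - Z : G.lieAlg) : Matrix (Fin N) (Fin N) ℝ) = Y.1 - Z.1 :=
  rfl

theorem coe_neg (Y : G.lieAlg) : ((-Y : G.lieAlg) : Matrix (Fin N) (Fin N) ℝ) = -Y.1 := rfl

theorem coe_smul (c : ℝ) (Y : G.lieAlg) :
    ((c • Y : G.lieAlg) : Matrix (Fin N) (Fin N) ℝ) = c • Y.1 := rfl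

variable {P : GL (Fin N) ℝ} {h : LieSubalgebra ℝ G.lieAlg}

theorem ext_conjBy {Y Z : G.lieAlg} (hYZ : ∀ i j, conjBy P Y i j = conjBy P Z i j) : Y = Z :=
  Subtype.ext (conjBy_injective P (Matrix.ext hYZ))

theorem Diagonalizes.lie_apply (hP : Diagonalizes P h) (X : h) (Y : G.lieAlg) (i j : Fin N) :
    conjBy P (⁅(X : G.lieAlg), Y⁆ : G.lieAlg) i j = entryWeight P h i j X * conjBy P Y i j :=
  conjBy_lie_apply P (hP X X.2) i j

/-- In diagonal coordinates `ad X` multiplies the entry `(i, j)` by a scalar. By Lagrange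
interpolation any function of these finitely many scalars is realized by a polynomial in `ad X`,
which automatically preserves `𝔤`. All projections to weight spaces used below come from this. -/
theorem Diagonalizes.exists_polynomial (hP : Diagonalizes P h) (X : h) (f : ℝ → ℝ) :
    ∃ p : Polynomial ℝ, ∀ (Y : G.lieAlg) (i j : Fin N),
      conjBy P (Polynomial.aeval (LieAlgebra.ad ℝ G.lieAlg X) p Y : G.lieAlg) i j =
        f (entryWeight P h i j X) * conjBy P Y i j := by
  classical
  have key : ∀ (p : Polynomial ℝ) (Y : G.lieAlg) (i j : Fin N),
      conjBy P ((Polynomial.aeval (LieAlgebra.ad ℝ G.lieAlg X) p Y : G.lieAlg)) i j =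
        p.eval (entryWeight P h i j X) * conjBy P Y i j := by
    intro p Y
    induction p using Polynomial.induction_on' with
    | add p q hp hq =>
      intro i j
      rw [map_add, LinearMap.add_apply, coe_add, map_add, Matrix.add_apply, hp, hq,
        Polynomial.eval_add, add_mul]
    | monomial n a =>
      intro i j
      rw [Polynomial.aeval_monomial, Polynomial.eval_monomial]
      simp only [Module.algebraMap_end_eq_smul_id, Module.End.mul_apply, LinearMap.smul_apply,
        LinearMap.id_coe, id_eq, coe_smul, map_smul, Matrix.smul_apply, smul_eq_mul,
        mul_assoc]
      congr 1
      induction n generalizing i j with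
      | zero => simp
      | succ n ih =>
        rw [pow_succ', Module.End.mul_apply, LieAlgebra.ad_apply, hP.lie_apply, ih, pow_succ']
        ring
  set s : Finset ℝ := Finset.univ.image fun ij : Fin N × Fin N => entryWeight P h ij.1 ij.2 X
  refine ⟨Lagrange.interpolate s id f, fun Y i j => ?_⟩
  rw [key]
  congr 1
  exact Lagrange.eval_interpolate_at_node (v := id) f Function.injective_id.injOn
    (Finset.mem_image.2 ⟨(i, j), Finset.mem_univ _, rfl⟩)

theorem Diagonalizes.exists_of_function (hP : Diagonalizes P h) (X : h) (Y : G.lieAlg)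
    (f : ℝ → ℝ) :
    ∃ Z : G.lieAlg, ∀ i j, conjBy P Z i j = f (entryWeight P h i j X) * conjBy P Y i j := by
  obtain ⟨p, hp⟩ := hP.exists_polynomial X f
  exact ⟨_, hp Y⟩

/-- A Cartan subalgebra is self-normalizing, hence contains its centralizer. -/
theorem mem_of_forall_lie_eq_zero (hh : h.IsCartanSubalgebra) {Y : G.lieAlg}
    (hY : ∀ X ∈ h, ⁅X, Y⁆ = 0) : Y ∈ h := by
  rw [← hh.self_normalizing, LieSubalgebra.mem_normalizer_iff]
  intro X hX
  rw [← lie_skew, hY X hX, neg_zero]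
  exact h.zero_mem

theorem Diagonalizes.mem_of_entries (hP : Diagonalizes P h) (hh : h.IsCartanSubalgebra)
    {Y : G.lieAlg} (hY : ∀ i j, conjBy P Y i j ≠ 0 → entryWeight P h i j = 0) : Y ∈ h := by
  refine mem_of_forall_lie_eq_zero hh fun X hX => ext_conjBy (P := P) fun i j => ?_
  rw [hP.lie_apply ⟨X, hX⟩]
  by_cases h0 : conjBy P Y i j = 0
  · simp [h0]
  · simp [hY i j h0]

/-- Some `X ∈ 𝔥` separates this weight from all other entry weights. The spectral projection of `Y`
for `ad X` at that value is then a root vector, nonzero because its entry at `(i, j)` is that of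
`Y`. -/
theorem Diagonalizes.entryWeight_mem_roots (hP : Diagonalizes P h) {Y : G.lieAlg} {i j : Fin N}
    (hY : conjBy P Y i j ≠ 0) (hij : entryWeight P h i j ≠ 0) :
    entryWeight P h i j ∈ G.roots h := by
  classical
  set l := entryWeight P h i j with hl
  obtain ⟨X, hX⟩ := Module.Dual.exists_forall_ne_zero_of_forall_exists
    (ι := {q : Fin N × Fin N // entryWeight P h q.1 q.2 ≠ l})
    (fun q => entryWeight P h q.1.1 q.1.2 - l) fun q => by
      by_contra hcon
      push Not at hcon
      exact q.2 (sub_eq_zero.1 (LinearMap.ext hcon))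
  obtain ⟨Z, hZ⟩ := hP.exists_of_function X Y fun c => if c = l X then 1 else 0
  refine ⟨hij, Z, ?_, fun X' => ext_conjBy (P := P) fun i' j' => ?_⟩
  · intro h0
    have := hZ i j
    rw [h0] at this
    simp [hl] at this
    exact hY this.symm
  · rw [hP.lie_apply, coe_smul, map_smul, Matrix.smul_apply, smul_eq_mul, hZ]
    by_cases hq : entryWeight P h i' j' = l
    · rw [hq]
    · have h1 := hX ⟨(i', j'), hq⟩
      have h2 : entryWeight P h i' j' X ≠ l X := fun h3 => h1 (by simp [h3])
      simp [h2]

theorem bddBelow_abs_roots (x : h) :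
    BddBelow ((fun α : Module.Dual ℝ h => |α x|) '' G.roots h) :=
  ⟨0, by rintro _ ⟨α, _, rfl⟩; exact abs_nonneg _⟩

/-- The nonvanishing entry of an element of `𝔤` is essential: for other positions the entry weight
is a weight of the full matrix algebra and need not be a root of `𝔤`. -/
theorem Diagonalizes.gap (hP : Diagonalizes P h) (x : h) {Y : G.lieAlg} {i j : Fin N}
    (hY : conjBy P Y i j ≠ 0) :
    entryWeight P h i j = 0 ∨ G.minAbsRoot h x ≤ |entryWeight P h i j x| := by
  by_cases hij : entryWeight P h i j = 0
  · exact Or.inl hij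
  · exact Or.inr (csInf_le (bddBelow_abs_roots x) ⟨_, hP.entryWeight_mem_roots hY hij, rfl⟩)

theorem Diagonalizes.weight_eq_zero (hP : Diagonalizes P h) {x : h} (hx : 0 < G.minAbsRoot h x)
    {Y : G.lieAlg} {i j : Fin N} (hY : conjBy P Y i j ≠ 0) (h0 : entryWeight P h i j x = 0) :
    entryWeight P h i j = 0 := by
  rcases hP.gap x hY with h1 | h1
  · exact h1
  · rw [h0, abs_zero] at h1
    linarith

/-- The projection of `𝔤` to `𝔥` along the root spaces, in coordinates. -/
theorem Diagonalizes.exists_proj (hP : Diagonalizes P h) (hh : h.IsCartanSubalgebra) {x : h}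
    (hx : 0 < G.minAbsRoot h x) (Y : G.lieAlg) :
    ∃ Z ∈ h, ∀ i j, conjBy P Z i j =
      (if entryWeight P h i j x = 0 then 1 else 0) * conjBy P Y i j := by
  classical
  obtain ⟨Z, hZ⟩ := hP.exists_of_function x Y fun c => if c = 0 then 1 else 0
  refine ⟨Z, hP.mem_of_entries hh fun i j hij => ?_, hZ⟩
  refine hP.weight_eq_zero hx hij ?_
  by_contra hne
  exact hij (by rw [hZ, if_neg hne, zero_mul])

/-! ### The exponential -/

theorem toMat_exp (X : G.lieAlg) : G.toMat (G.exp X) = NormedSpace.exp X.1 := rfl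

theorem exp_add {X Y : G.lieAlg} (hXY : Commute X.1 Y.1) :
    G.exp (X + Y) = G.exp X * G.exp Y := by
  apply G.isEmbedding_toMat.injective
  rw [toMat_mul]
  exact Matrix.exp_add_of_commute _ _ hXY

theorem exp_add_smul (X : G.lieAlg) (s t : ℝ) :
    G.exp ((s + t) • X) = G.exp (s • X) * G.exp (t • X) := by
  rw [add_smul]
  exact exp_add (((Commute.refl X.1).smul_left s).smul_right t)

theorem exp_zero : G.exp (0 : G.lieAlg) = 1 := by
  apply G.isEmbedding_toMat.injective
  rw [toMat_one, toMat_exp]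
  exact NormedSpace.exp_zero

theorem exp_neg (X : G.lieAlg) : G.exp (-X) = (G.exp X)⁻¹ := by
  refine eq_inv_of_mul_eq_one_left ?_
  have := exp_add_smul X (-1) 1
  rw [neg_add_cancel, zero_smul, exp_zero] at this
  simpa using this.symm

theorem exp_natCast_smul (X : G.lieAlg) (n : ℕ) : G.exp ((n : ℝ) • X) = G.exp X ^ n := by
  induction n with
  | zero => simp [exp_zero]
  | succ n ih => rw [Nat.cast_succ, exp_add_smul, ih, one_smul, pow_succ]

theorem Diagonalizes.Ad_exp_apply (hP : Diagonalizes P h) (X : h) (Y : G.lieAlg) (i j : Fin N) :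
    conjBy P (G.Ad (G.exp X) Y) i j =
      Real.exp (entryWeight P h i j X) * conjBy P Y i j := by
  have key : ∀ Z ∈ h, conjBy P (G.toMat (G.exp Z)) =
      Matrix.diagonal fun i => Real.exp (conjBy P Z i i) := by
    intro Z hZ
    rw [toMat_exp, conjBy_apply, ← Matrix.exp_units_conj]
    change NormedSpace.exp (conjBy P Z) = _
    rw [← (hP Z hZ).diagonal_diag, Matrix.exp_diagonal]
    congr 1
    ext i
    rw [Pi.coe_exp, ← Real.exp_eq_exp_ℝ]
    simp [Matrix.diag_apply]
  rw [coe_Ad, conjBy_mul, conjBy_mul, ← exp_neg, key _ X.2, key _ (h.neg_mem X.2),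
    Matrix.mul_diagonal, Matrix.diagonal_mul, entryWeight_apply, Real.exp_sub, coe_neg,
    map_neg, Matrix.neg_apply, Real.exp_neg]
  ring

theorem Diagonalizes.exp_mem (hP : Diagonalizes P h) (X : h) :
    G.exp X ∈ G.cartanSubgroup h := by
  intro X' hX'
  refine ext_conjBy (P := P) fun i j => ?_
  rw [hP.Ad_exp_apply]
  by_cases hij : i = j
  · subst hij
    simp [entryWeight_apply]
  · simp [hP X' hX' hij]

theorem exp_comm_of_mem {g : G.RealPoints} (hg : g ∈ G.cartanSubgroup h) {X : G.lieAlg}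
    (hX : X ∈ h) : g * G.exp X = G.exp X * g := by
  have h1 := congrArg Subtype.val (hg X hX)
  have h2 : G.toMat g * G.toMat (G.exp X) * G.toMat g⁻¹ = G.toMat (G.exp X) := by
    have h3 := Matrix.exp_units_conj (G.toGL g) X.1
    have h4 : (G.toGL g).1 * X.1 * (G.toGL g)⁻¹.1 = X.1 := by rw [← map_inv]; exact h1
    rw [h4, ← map_inv] at h3
    exact h3.symm
  apply G.isEmbedding_toMat.injective
  rw [toMat_mul, toMat_mul]
  nth_rewrite 2 [← h2]
  rw [mul_assoc, toMat_inv_mul, mul_one]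

theorem Diagonalizes.exp_mem_center (hP : Diagonalizes P h) (X : h) :
    (⟨G.exp X, hP.exp_mem X⟩ : G.cartanSubgroup h) ∈ Subgroup.center (G.cartanSubgroup h) :=
  Subgroup.mem_center_iff.2 fun g => Subtype.ext (exp_comm_of_mem g.2 X.2)

theorem isClosed_cartanSubgroup (h : LieSubalgebra ℝ G.lieAlg) :
    IsClosed (G.cartanSubgroup h : Set G.RealPoints) := by
  have : (G.cartanSubgroup h : Set G.RealPoints) =
      ⋂ X ∈ h, {g | G.toMat g * (X : Matrix (Fin N) (Fin N) ℝ) * G.toMat g⁻¹ = X} := by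
    ext g
    rw [Set.mem_iInter₂]
    exact ⟨fun hg X hX => congrArg Subtype.val (hg X hX), fun hg X hX => Subtype.ext (hg X hX)⟩
  rw [this]
  refine isClosed_biInter fun X _ => isClosed_eq ?_ continuous_const
  exact ((G.continuous_toMat.matrix_mul continuous_const).matrix_mul
    (G.continuous_toMat.comp continuous_inv))

/-! ### The invariant form on `𝔥` -/

/-- The function `(e^c - 1)⁻¹` of the weights inverts `Ad(a) - 1` away from weight zero, so every
`Y` is `Z + (Ad(a) W - W)` with `Z ∈ 𝔥`. Invariance of `B` and `Ad(a) X = X` make `X` orthogonal to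
`Ad(a) W - W`, so being orthogonal to `𝔥` means being orthogonal to everything. The value at `c = 0`
is harmless because `Y - Z` has no part of weight zero. -/
theorem Diagonalizes.form_nondegenerate (hP : Diagonalizes P h) (hh : h.IsCartanSubalgebra) {x : h}
    (hx : 0 < G.minAbsRoot h x) {B : LinearMap.BilinForm ℝ G.lieAlg} (hB : B.Nondegenerate)
    (hinv : ∀ (g : G.RealPoints) (X Y : G.lieAlg), B (G.Ad g X) (G.Ad g Y) = B X Y)
    {X : G.lieAlg} (hX : X ∈ h) (h0 : ∀ X' ∈ h, B X X' = 0) : X = 0 := by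
  refine hB.1 X fun Y => ?_
  obtain ⟨Z, hZ, hZe⟩ := hP.exists_proj hh hx Y
  obtain ⟨W, hW⟩ := hP.exists_of_function x (Y - Z) fun c => (Real.exp c - 1)⁻¹
  have h1 : Y = Z + (G.Ad (G.exp x) W - W) := by
    refine ext_conjBy (P := P) fun i j => ?_
    rw [coe_add, map_add, Matrix.add_apply, coe_sub, map_sub,
      Matrix.sub_apply, hP.Ad_exp_apply, hW, coe_sub, map_sub, Matrix.sub_apply, hZe]
    by_cases hc : entryWeight P h i j x = 0
    · simp [hc]
    · have : Real.exp (entryWeight P h i j x) - 1 ≠ 0 := by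
        rwa [sub_ne_zero, Ne, Real.exp_eq_one_iff]
      simp only [hc, if_false, zero_mul, sub_zero, zero_add]
      field_simp
  rw [h1, map_add, map_sub, h0 Z hZ]
  have h2 := hinv (G.exp x) X W
  rw [hP.exp_mem x X hX] at h2
  rw [h2]
  simp

theorem Diagonalizes.det_form_ne_zero (hP : Diagonalizes P h) (hh : h.IsCartanSubalgebra) {x : h}
    (hx : 0 < G.minAbsRoot h x) {B : LinearMap.BilinForm ℝ G.lieAlg} (hB : B.Nondegenerate)
    (hinv : ∀ (g : G.RealPoints) (X Y : G.lieAlg), B (G.Ad g X) (G.Ad g Y) = B X Y)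
    {r : ℕ} (e : Module.Basis (Fin r) ℝ h) :
    (Matrix.of fun i j => B (e i) (e j)).det ≠ 0 := by
  intro hdet
  obtain ⟨v, hv, hv0⟩ := Matrix.exists_vecMul_eq_zero_iff.2 hdet
  set X : h := ∑ i, v i • e i with hXdef
  have hX0 : X = 0 := by
    refine Subtype.ext (hP.form_nondegenerate hh hx hB hinv X.2 fun X' hX' => ?_)
    have hlin : ∀ Z : h, B X Z = 0 := by
      have : (B (X : G.lieAlg)).comp h.toSubmodule.subtype = 0 := by
        refine e.ext fun j => ?_
        have h1 := congrFun hv0 j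
        simp only [Matrix.vecMul, dotProduct, Matrix.of_apply, Pi.zero_apply] at h1
        have h2 : (X : G.lieAlg) = ∑ i, v i • (e i : G.lieAlg) := by
          rw [hXdef]
          exact map_sum h.toSubmodule.subtype (fun i => v i • e i) Finset.univ
        rw [LinearMap.comp_apply, h2, map_sum, LinearMap.sum_apply]
        refine Eq.trans (Finset.sum_congr rfl fun i _ => ?_) h1
        rw [map_smul, LinearMap.smul_apply, smul_eq_mul]
        rfl
      exact fun Z => LinearMap.congr_fun this Z
    exact hlin ⟨X', hX'⟩
  have := Fintype.linearIndependent_iff.1 e.linearIndependent v (by rw [← hXdef, hX0])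
  exact hv (funext this)

/-! ### Small elements of the normalizer -/

theorem exists_gap {ι : Type*} [Finite ι] (d : ι → ℝ) :
    ∃ ε > 0, ∀ i k, |d i - d k| < ε → d i = d k := by
  classical
  have := Fintype.ofFinite ι
  -- The element `1` only serves to keep the set nonempty when all differences vanish.
  set s : Finset ℝ := insert 1 ((Finset.univ.image fun ik : ι × ι => |d ik.1 - d ik.2|).erase 0)
  have hs : s.Nonempty := Finset.insert_nonempty _ _
  refine ⟨s.min' hs, ?_, fun i k hik => ?_⟩
  · rw [gt_iff_lt, Finset.lt_min'_iff]
    intro b hb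
    rcases Finset.mem_insert.1 hb with rfl | hb
    · exact one_pos
    · obtain ⟨hb0, hb1⟩ := Finset.mem_erase.1 hb
      obtain ⟨ik, _, rfl⟩ := Finset.mem_image.1 hb1
      exact lt_of_le_of_ne (abs_nonneg _) hb0.symm
  · by_contra hne
    refine absurd (Finset.min'_le s |d i - d k| ?_) (not_le.2 hik)
    refine Finset.mem_insert_of_mem (Finset.mem_erase.2 ⟨?_, Finset.mem_image.2 ⟨(i, k),
      Finset.mem_univ _, rfl⟩⟩)
    simpa [sub_eq_zero] using hne

/-- `X` and `Ad(u) X` have the same characteristic polynomial and are diagonalized by the same `P`,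
so their diagonal entries form the same spectrum. -/
theorem Diagonalizes.exists_entry_eq (hP : Diagonalizes P h) {X : G.lieAlg} (hX : X ∈ h)
    {u : G.RealPoints} (hu : G.Ad u X ∈ h) (i : Fin N) :
    ∃ k, conjBy P (G.Ad u X) i i = conjBy P X k k := by
  set c := conjBy P (G.Ad u X) i i
  have hdet : ∀ Z ∈ h, (Z.1 - Matrix.scalar (Fin N) c).det = ∏ k, (conjBy P Z k k - c) := by
    intro Z hZ
    have h1 : (conjBy P (Z.1 - Matrix.scalar (Fin N) c)).det = (Z.1 - Matrix.scalar (Fin N) c).det :=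
      Matrix.det_units_conj P _
    rw [← h1, map_sub]
    have h2 : conjBy P (Matrix.scalar (Fin N) c) = Matrix.scalar (Fin N) c := by
      rw [conjBy_apply, mul_assoc, (Matrix.scalar_commute c (fun r' => mul_comm _ _) P⁻¹.1).eq,
        ← mul_assoc, Units.mul_inv, one_mul]
    rw [h2]
    nth_rewrite 1 [← (hP Z hZ).diagonal_diag]
    rw [Matrix.scalar_apply, Matrix.diagonal_sub, Matrix.det_diagonal]
    rfl
  have h3 : ((G.Ad u X : G.lieAlg).1 - Matrix.scalar (Fin N) c).det =
      (X.1 - Matrix.scalar (Fin N) c).det := by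
    rw [← Matrix.det_units_conj (G.toGL u) (X.1 - Matrix.scalar (Fin N) c)]
    congr 1
    rw [coe_Ad, mul_sub, sub_mul, mul_assoc (G.toGL u).1 (Matrix.scalar (Fin N) c),
      (Matrix.scalar_commute c (fun r' => mul_comm _ _) (G.toGL u)⁻¹.1).eq, ← mul_assoc,
      Units.mul_inv, one_mul, ← map_inv]
    rfl
  rw [hdet _ hu, hdet _ hX, Finset.prod_eq_zero (Finset.mem_univ i) (sub_self _)] at h3
  obtain ⟨k, _, hk⟩ := Finset.prod_eq_zero_iff.1 h3.symm
  exact ⟨k, (sub_eq_zero.1 hk).symm⟩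

theorem continuous_conjBy_Ad (P : GL (Fin N) ℝ) (X : G.lieAlg) (i j : Fin N) :
    Continuous fun u : G.RealPoints => conjBy P (G.Ad u X) i j := by
  have h1 : Continuous fun u : G.RealPoints =>
      P.1 * (G.toMat u * (X : Matrix (Fin N) (Fin N) ℝ) * G.toMat u⁻¹) * P⁻¹.1 :=
    (continuous_const.matrix_mul ((G.continuous_toMat.matrix_mul continuous_const).matrix_mul
      (G.continuous_toMat.comp continuous_inv))).matrix_mul continuous_const
  exact h1.matrix_elem i j

/-- An element of the normalizer of `h` close to the identity centralizes `h`. -/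
theorem Diagonalizes.exists_normalizer_radius (hP : Diagonalizes P h) :
    ∃ ρ > 0, ∀ u : G.RealPoints, G.dev u < ρ → (∀ X ∈ h, G.Ad u X ∈ h) →
      u ∈ G.cartanSubgroup h := by
  have key : ∀ X : h, ∀ᶠ u in 𝓝 (1 : G.RealPoints), (∀ X ∈ h, G.Ad u X ∈ h) →
      G.Ad u X = X := by
    intro X
    -- Diagonal entries of `Ad(u) X` stay in the finite spectrum of `X`; moving by less than the
    -- gap, they cannot move at all.
    obtain ⟨ε, hε, hgap⟩ := exists_gap fun i => conjBy P (X : G.lieAlg) i i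
    have h1 : ∀ᶠ u in 𝓝 (1 : G.RealPoints), ∀ i,
        |conjBy P (G.Ad u X) i i - conjBy P (X : G.lieAlg) i i| < ε := by
      refine eventually_all.2 fun i => ?_
      have hc : Continuous fun u : G.RealPoints =>
          |conjBy P (G.Ad u X) i i - conjBy P (X : G.lieAlg) i i| :=
        continuous_abs.comp ((continuous_conjBy_Ad P (X : G.lieAlg) i i).sub
          (continuous_const (y := conjBy P (X : G.lieAlg) i i)))
      have h0 : |conjBy P (G.Ad 1 X) i i - conjBy P (X : G.lieAlg) i i| = 0 := by
        rw [Ad_one, sub_self, abs_zero]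
      exact (hc.tendsto' 1 0 h0).eventually (gt_mem_nhds hε)
    filter_upwards [h1] with u hu hun
    refine ext_conjBy (P := P) fun i j => ?_
    by_cases hij : i = j
    · subst hij
      obtain ⟨k, hk⟩ := hP.exists_entry_eq X.2 (hun X X.2) i
      have h2 := hu i
      rw [hk] at h2
      rw [hk]
      exact hgap k i h2
    · rw [hP _ (hun X X.2) hij, hP _ X.2 hij]
  let e := Module.finBasis ℝ h
  have hall : ∀ᶠ u in 𝓝 (1 : G.RealPoints), ∀ c, (∀ X ∈ h, G.Ad u X ∈ h) →
      G.Ad u (e c) = e c := eventually_all.2 fun c => key (e c)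
  obtain ⟨ρ, hρ, hρ'⟩ := G.exists_dev_lt_of_mem_nhds hall
  refine ⟨ρ, hρ, fun u hu hun X hX => ?_⟩
  have : (G.Ad u).comp h.toSubmodule.subtype = h.toSubmodule.subtype :=
    e.ext fun c => hρ' u hu c hun
  exact LinearMap.congr_fun this ⟨X, hX⟩

end LinAlgGroup

/-! ## Rationality of periodic tori -/

/-- A family of rational numbers has a common denominator. -/
theorem exists_common_den {ι : Type*} [Fintype ι] (c : ι → ℚ) :
    ∃ D : ℕ, 0 < D ∧ ∀ i, ∃ n : ℤ, (D : ℚ) * c i = n := by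
  classical
  refine ⟨∏ i, (c i).den, Finset.prod_pos fun i _ => (c i).den_pos, fun i => ?_⟩
  obtain ⟨k, hk⟩ := Finset.dvd_prod_of_mem (fun i => (c i).den) (Finset.mem_univ i)
  refine ⟨(c i).num * k, ?_⟩
  rw [hk]
  push_cast
  rw [mul_right_comm, Rat.den_mul_eq_num]

/-- A real number all of whose rational coordinates vanish is zero. -/
theorem eq_zero_of_forall_rat_functional {x : ℝ} (hx : ∀ l : ℝ →ₗ[ℚ] ℚ, l x = 0) : x = 0 := by
  refine (Module.Basis.ofVectorSpace ℚ ℝ).repr.map_eq_zero_iff.1 (Finsupp.ext fun k => ?_)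
  exact hx ((Module.Basis.ofVectorSpace ℚ ℝ).coord k)

theorem rat_functional_sum_mul {ι : Type*} [Fintype ι] (l : ℝ →ₗ[ℚ] ℚ) (c : ι → ℝ) (q : ι → ℚ) :
    l (∑ i, c i * q i) = ∑ i, l (c i) * q i := by
  rw [map_sum]
  refine Finset.sum_congr rfl fun i _ => ?_
  rw [mul_comm, ← Rat.smul_def, map_smul, smul_eq_mul, mul_comm]

namespace LinAlgGroup

variable {N : ℕ} {G : LinAlgGroup N} {Γ : Subgroup G.RealPoints} {gZ : Submodule ℤ G.lieAlg}
  {B : LinearMap.BilinForm ℝ G.lieAlg} {h : LieSubalgebra ℝ G.lieAlg}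

/-- Applying a `ℚ`-linear functional `ℝ → ℚ` to the coefficients of a real relation gives a rational
relation, because the matrix entries are rational. After clearing denominators it is an integral
one, hence trivial; and such functionals separate the reals. -/
theorem IsIntegralStructure.linearIndependent (hB : G.IsIntegralStructure Γ gZ B)
    {ι : Type*} [Fintype ι] {b : ι → gZ} (hb : LinearIndependent ℤ b) :
    LinearIndependent ℝ fun i => (b i : G.lieAlg) := by
  rw [Fintype.linearIndependent_iff]
  intro c hc i
  choose q hq using fun (i : ι) k l => hB.rational (b i) (b i).2 k l
  refine eq_zero_of_forall_rat_functional fun l => ?_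
  obtain ⟨D, hD, hn⟩ := exists_common_den fun i => l (c i)
  choose n hn using hn
  have h1 : ∀ k k', ∑ i, l (c i) * q i k k' = 0 := by
    intro k k'
    rw [← rat_functional_sum_mul]
    have h2 := congrFun (congrFun (congrArg Subtype.val hc) k) k'
    have h3 : ((∑ i, c i • (b i : G.lieAlg) : G.lieAlg) : Matrix (Fin N) (Fin N) ℝ) k k' =
        ∑ i, c i * q i k k' := by
      rw [show ((∑ i, c i • (b i : G.lieAlg) : G.lieAlg) : Matrix (Fin N) (Fin N) ℝ) =
        ∑ i, c i • ((b i : G.lieAlg) : Matrix (Fin N) (Fin N) ℝ) from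
          map_sum G.lieAlg.toSubmodule.subtype (fun i => c i • (b i : G.lieAlg)) Finset.univ,
        Matrix.sum_apply]
      refine Finset.sum_congr rfl fun i _ => ?_
      rw [Matrix.smul_apply, hq, smul_eq_mul]
    rw [← h3]
    rw [show ((∑ i, c i • (b i : G.lieAlg) : G.lieAlg) : Matrix (Fin N) (Fin N) ℝ) k k' = 0 from h2,
      map_zero]
  have h4 : ∑ i, n i • b i = 0 := by
    refine Subtype.ext (Subtype.ext (Matrix.ext fun k k' => ?_))
    have h5 : (((∑ i, n i • b i : gZ) : G.lieAlg) : Matrix (Fin N) (Fin N) ℝ) =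
        ∑ i, n i • ((b i : G.lieAlg) : Matrix (Fin N) (Fin N) ℝ) :=
      map_sum ((G.lieAlg.toSubmodule.subtype.restrictScalars ℤ).comp gZ.subtype)
        (fun i => n i • b i) Finset.univ
    rw [h5, Matrix.sum_apply]
    have h6 : ∑ i, (n i : ℚ) * q i k k' = 0 := by
      simp only [← hn, mul_assoc]
      rw [← Finset.mul_sum, h1, mul_zero]
    have h7 : ((∑ i, (n i : ℚ) * q i k k' : ℚ) : ℝ) = 0 := by rw [h6, Rat.cast_zero]
    push_cast at h7
    refine Eq.trans (Finset.sum_congr rfl fun i _ => ?_) h7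
    rw [Matrix.smul_apply, hq, zsmul_eq_mul]
  have h5 := Fintype.linearIndependent_iff.1 hb n h4 i
  have h6 := hn i
  rw [h5, Int.cast_zero] at h6
  exact (mul_eq_zero.1 h6).resolve_left (by exact_mod_cast hD.ne')

theorem IsIntegralStructure.finite (hB : G.IsIntegralStructure Γ gZ B) : Module.Finite ℤ gZ :=
  Module.Finite.of_fg hB.fg

theorem isTorsionFree_lieAlg (G : LinAlgGroup N) : Module.IsTorsionFree ℤ G.lieAlg := Module.IsTorsionFree.trans ℝ

theorem free_intLattice (hB : G.IsIntegralStructure Γ gZ B) : Module.Free ℤ gZ := by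
  have := hB.finite
  have := G.isTorsionFree_lieAlg
  exact Module.free_of_finite_type_torsion_free'

/-- A basis of the lattice is a basis of the real Lie algebra. -/
theorem IsIntegralStructure.exists_basis (hB : G.IsIntegralStructure Γ gZ B) :
    ∃ (d : ℕ) (b : Module.Basis (Fin d) ℤ gZ) (b' : Module.Basis (Fin d) ℝ G.lieAlg),
      ∀ i, b' i = b i := by
  have := hB.finite
  have := free_intLattice hB
  let b := Module.finBasis ℤ gZ
  have hspan : ⊤ ≤ Submodule.span ℝ (Set.range fun i => (b i : G.lieAlg)) := by
    rw [← hB.span_eq_top, Submodule.span_le]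
    intro X hX
    have h1 := congrArg Subtype.val (b.sum_repr ⟨X, hX⟩)
    have h2 : X = ∑ i, b.repr ⟨X, hX⟩ i • (b i : G.lieAlg) :=
      h1.symm.trans (map_sum gZ.subtype (fun i => b.repr ⟨X, hX⟩ i • b i) Finset.univ)
    rw [h2]
    refine Submodule.sum_mem _ fun i _ => ?_
    rw [← Int.cast_smul_eq_zsmul ℝ]
    exact Submodule.smul_mem _ _ (Submodule.subset_span ⟨i, rfl⟩)
  exact ⟨_, b, Module.Basis.mk (hB.linearIndependent b.linearIndependent) hspan,
    fun i => Module.Basis.mk_apply _ _ i⟩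

theorem repr_eq_intCast {d : ℕ} {b : Module.Basis (Fin d) ℤ gZ}
    {b' : Module.Basis (Fin d) ℝ G.lieAlg} (hb : ∀ i, b' i = b i) {X : G.lieAlg} (hX : X ∈ gZ)
    (i : Fin d) : b'.repr X i = b.repr ⟨X, hX⟩ i := by
  have h1 := congrArg Subtype.val (b.sum_repr ⟨X, hX⟩)
  have h2 : X = ∑ i, (b.repr ⟨X, hX⟩ i : ℝ) • b' i := by
    refine h1.symm.trans ((map_sum gZ.subtype (fun i => b.repr ⟨X, hX⟩ i • b i) Finset.univ).trans
      (Finset.sum_congr rfl fun i _ => ?_))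
    rw [hb, Int.cast_smul_eq_zsmul]
    rfl
  nth_rewrite 1 [h2]
  rw [Module.Basis.repr_sum_self]

theorem mem_intLattice_of_repr {d : ℕ} {b : Module.Basis (Fin d) ℤ gZ}
    {b' : Module.Basis (Fin d) ℝ G.lieAlg} (hb : ∀ i, b' i = b i) {X : G.lieAlg}
    (hX : ∀ i, ∃ n : ℤ, b'.repr X i = n) : X ∈ gZ := by
  choose n hn using hX
  rw [← b'.sum_repr X]
  refine Submodule.sum_mem _ fun i _ => ?_
  rw [hn, hb, Int.cast_smul_eq_zsmul]
  exact gZ.smul_mem _ (b i).2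

/-- The subspace fixed by a set of elements of `Γ` is rational. -/
theorem IsIntegralStructure.fixed_mem_span (hB : G.IsIntegralStructure Γ gZ B)
    {Λ : Set G.RealPoints} (hΛ : Λ ⊆ Γ) {v : G.lieAlg} (hv : ∀ γ ∈ Λ, G.Ad γ v = v) :
    v ∈ Submodule.span ℝ {X | X ∈ gZ ∧ ∀ γ ∈ Λ, G.Ad γ X = X} := by
  classical
  obtain ⟨d, b, b', hb⟩ := hB.exists_basis
  -- In an integral basis the equations `Ad γ v = v` have integer coefficients, so applying `l` to
  -- the coordinates of a solution yields a rational solution.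
  have hfix : ∀ l : ℝ →ₗ[ℚ] ℚ, ∀ γ ∈ Λ,
      G.Ad γ (∑ i, (l (b'.repr v i) : ℝ) • b' i) = ∑ i, (l (b'.repr v i) : ℝ) • b' i := by
    intro l γ hγ
    have hint : ∀ i j, ∃ n : ℤ, b'.repr (G.Ad γ (b' i)) j = n := fun i j =>
      ⟨_, repr_eq_intCast hb (hB.ad_mem γ (hΛ hγ) (b' i) (by rw [hb]; exact (b i).2)) j⟩
    choose n hn using hint
    have h1 : ∀ c : Fin d → ℝ, ∀ j, b'.repr (G.Ad γ (∑ i, c i • b' i)) j = ∑ i, c i * n i j := by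
      intro c j
      simp only [map_sum, map_smul, Finsupp.coe_finsetSum, Finset.sum_apply, Finsupp.smul_apply, hn,
        smul_eq_mul]
    have h2 : ∀ j, ∑ i, b'.repr v i * n i j = b'.repr v j := by
      intro j
      rw [← h1, b'.sum_repr, hv γ hγ]
    refine b'.repr.injective (Finsupp.ext fun j => ?_)
    rw [h1, Module.Basis.repr_sum_self]
    have h3 := rat_functional_sum_mul l (fun i => b'.repr v i) fun i => (n i j : ℚ)
    simp only [Rat.cast_intCast] at h3
    rw [h2 j] at h3
    rw [h3]
    push_cast
    rfl
  have hmem : ∀ l : ℝ →ₗ[ℚ] ℚ, ∑ i, (l (b'.repr v i) : ℝ) • b' i ∈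
      Submodule.span ℝ {X | X ∈ gZ ∧ ∀ γ ∈ Λ, G.Ad γ X = X} := by
    intro l
    obtain ⟨D, hD, hn⟩ := exists_common_den fun i => l (b'.repr v i)
    have hD' : (D : ℝ) ≠ 0 := by exact_mod_cast hD.ne'
    rw [← inv_smul_smul₀ hD' (∑ i, (l (b'.repr v i) : ℝ) • b' i)]
    refine Submodule.smul_mem _ _ (Submodule.subset_span ⟨mem_intLattice_of_repr hb fun i => ?_,
      fun γ hγ => by rw [map_smul, hfix l γ hγ]⟩)
    obtain ⟨m, hm⟩ := hn i
    refine ⟨m, ?_⟩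
    rw [map_smul, Finsupp.smul_apply, Module.Basis.repr_sum_self, smul_eq_mul]
    exact_mod_cast hm
  -- Expanding the coordinates of `v` in a basis of `ℝ` over `ℚ` writes `v` as a finite real
  -- combination of rational fixed vectors.
  let β := Module.Basis.ofVectorSpace ℚ ℝ
  set s := Finset.univ.biUnion fun i => (β.repr (b'.repr v i)).support with hs
  have hv' : v = ∑ k ∈ s, β k • ∑ i, (β.coord k (b'.repr v i) : ℝ) • b' i := by
    nth_rewrite 1 [← b'.sum_repr v]
    simp only [Finset.smul_sum]
    rw [Finset.sum_comm]
    refine Finset.sum_congr rfl fun i _ => ?_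
    simp only [smul_smul]
    rw [← Finset.sum_smul]
    congr 1
    have h1 := β.linearCombination_repr (b'.repr v i)
    rw [Finsupp.linearCombination_apply, Finsupp.sum_of_support_subset _
      (Finset.subset_biUnion_of_mem (fun i => (β.repr (b'.repr v i)).support)
        (Finset.mem_univ i)) _ (by simp)] at h1
    rw [← h1]
    refine Finset.sum_congr rfl fun k _ => ?_
    rw [h1, Rat.smul_def, mul_comm]
    rfl
  rw [hv']
  exact Submodule.sum_mem _ fun k _ => Submodule.smul_mem _ _ (hmem _)

/-! ### Vectors fixed by the stabilizer of a periodic orbit -/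

theorem Ad_lie (u : G.RealPoints) (X Y : G.lieAlg) : G.Ad u ⁅X, Y⁆ = ⁅G.Ad u X, G.Ad u Y⁆ := by
  apply Subtype.ext
  rw [LieSubalgebra.coe_bracket, coe_Ad, LieSubalgebra.coe_bracket, coe_Ad, coe_Ad, Ring.lie_def,
    Ring.lie_def]
  have key : ∀ A C : Matrix (Fin N) (Fin N) ℝ, G.toMat u * A * G.toMat u⁻¹ *
      (G.toMat u * C * G.toMat u⁻¹) = G.toMat u * (A * C) * G.toMat u⁻¹ := by
    intro A C
    rw [show G.toMat u * A * G.toMat u⁻¹ * (G.toMat u * C * G.toMat u⁻¹) =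
      G.toMat u * A * (G.toMat u⁻¹ * G.toMat u) * C * G.toMat u⁻¹ by noncomm_ring, toMat_inv_mul]
    noncomm_ring
  rw [key, key, mul_sub, sub_mul]

theorem Ad_aeval {u : G.RealPoints} (hu : u ∈ G.cartanSubgroup h) (X : h) (p : Polynomial ℝ)
    (Y : G.lieAlg) : G.Ad u (Polynomial.aeval (LieAlgebra.ad ℝ G.lieAlg X) p Y) =
      Polynomial.aeval (LieAlgebra.ad ℝ G.lieAlg X) p (G.Ad u Y) := by
  induction p using Polynomial.induction_on' with
  | add p q hp hq => rw [map_add, LinearMap.add_apply, map_add, hp, hq, LinearMap.add_apply]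
  | monomial n a =>
    rw [Polynomial.aeval_monomial]
    simp only [Module.algebraMap_end_eq_smul_id, Module.End.mul_apply, LinearMap.smul_apply,
      LinearMap.id_coe, id_eq, map_smul]
    congr 1
    induction n with
    | zero => simp
    | succ n ih =>
      rw [pow_succ', Module.End.mul_apply, LieAlgebra.ad_apply, Ad_lie, ih, hu X X.2,
        Module.End.mul_apply, LieAlgebra.ad_apply]

theorem continuous_matNorm_Ad (X : G.lieAlg) :
    Continuous fun u : G.RealPoints => matNorm (G.Ad u X : Matrix (Fin N) (Fin N) ℝ) :=
  continuous_matNorm.comp ((G.continuous_toMat.matrix_mul continuous_const).matrix_mul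
    (G.continuous_toMat.comp continuous_inv))

theorem matNorm_pos {A : Matrix (Fin N) (Fin N) ℝ} (hA : A ≠ 0) : 0 < matNorm A := by
  obtain ⟨i, j, hij⟩ : ∃ i j, A i j ≠ 0 := by
    by_contra hcon
    push Not at hcon
    exact hA (Matrix.ext hcon)
  exact (abs_pos.2 hij).trans_le (abs_apply_le_matNorm A i j)

/-- There is no finite invariant measure on an orbit with a function that is multiplied by `e`
under some translation. -/
theorem not_isPeriodic_of_expanding (hΓ : Γ.Commensurable G.integerPoints)
    {H : Subgroup G.RealPoints} (hH : IsClosed (H : Set G.RealPoints)) {g c : G.RealPoints}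
    (hc : c ∈ H) (φ : G.RealPoints → ℝ) (hφc : Continuous φ) (hφ0 : ∀ a ∈ H, 0 < φ a)
    (hφ : ∀ a ∈ H, φ (a * c) = Real.exp 1 * φ a)
    (hinv : ∀ a ∈ H, ∀ a' ∈ H, HomSpace.mk Γ (g * a) = HomSpace.mk Γ (g * a') → φ a = φ a') :
    ¬ HomSpace.IsPeriodic Γ H g := by
  rintro ⟨m, hm, hm0, hmo, hminv⟩
  have := discreteTopology_of_commensurable hΓ
  have := HomSpace.t2Space Γ
  -- These are the superlevel sets `φ ≥ eⁿ` on the orbit. Translation by `c` shifts the index, so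
  -- all have the same measure; they decrease to the empty set, so that measure is zero; yet
  -- together they fill the orbit.
  set A : ℤ → Set (HomSpace Γ) := fun n =>
    (fun a => HomSpace.mk Γ (g * a)) '' {a | a ∈ H ∧ Real.exp n ≤ φ a} with hA
  have hAm : ∀ n, MeasurableSet (A n) := fun n =>
    (HomSpace.isSigmaCompact_image_orbit Γ g
      (hH.inter (isClosed_le continuous_const hφc))).measurableSet
  have hstep : ∀ n, m (A (n + 1)) = m (A n) := by
    intro n
    nth_rewrite 1 [← hminv c hc]
    rw [Measure.map_apply (HomSpace.continuous_rightMul Γ c).measurable (hAm _)]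
    congr 1
    ext z
    obtain ⟨x, rfl⟩ := HomSpace.mk_surjective Γ z
    simp only [hA, Set.mem_preimage, HomSpace.rightMul_mk]
    constructor
    · rintro ⟨a, ⟨ha, hea⟩, heq⟩
      refine ⟨a * c⁻¹, ⟨H.mul_mem ha (H.inv_mem hc), ?_⟩, ?_⟩
      · have h1 := hφ (a * c⁻¹) (H.mul_mem ha (H.inv_mem hc))
        rw [inv_mul_cancel_right] at h1
        rw [h1, Int.cast_add, Int.cast_one, Real.exp_add, mul_comm] at hea
        exact le_of_mul_le_mul_left hea (Real.exp_pos 1)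
      · have h2 := congrArg (HomSpace.rightMul Γ c⁻¹) heq
        simpa [HomSpace.rightMul_mk, mul_assoc] using h2
    · rintro ⟨a, ⟨ha, hea⟩, heq⟩
      refine ⟨a * c, ⟨H.mul_mem ha hc, ?_⟩, ?_⟩
      · rw [hφ a ha, Int.cast_add, Int.cast_one, Real.exp_add, mul_comm]
        exact mul_le_mul_of_nonneg_left hea (Real.exp_pos 1).le
      · have h2 := congrArg (HomSpace.rightMul Γ c) heq
        simpa [HomSpace.rightMul_mk, mul_assoc] using h2
  have hconst : ∀ n, m (A n) = m (A 0) := by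
    intro n
    induction n using Int.induction_on with
    | zero => rfl
    | succ n ih => rw [hstep, ih]
    | pred n ih => rw [← hstep, sub_add_cancel, ih]
  have hanti : Antitone fun n : ℕ => A n := by
    rintro n n' hn _ ⟨a, ⟨ha, hea⟩, rfl⟩
    refine ⟨a, ⟨ha, le_trans (Real.exp_le_exp.2 ?_) hea⟩, rfl⟩
    exact_mod_cast hn
  have hempty : ⋂ n : ℕ, A n = ∅ := by
    refine Set.eq_empty_of_forall_notMem fun z hz => ?_
    rw [Set.mem_iInter] at hz
    obtain ⟨a, ⟨ha, _⟩, rfl⟩ := hz 0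
    obtain ⟨n, hn⟩ := exists_nat_gt (Real.log (φ a))
    obtain ⟨a', ⟨ha', hea'⟩, heq⟩ := hz n
    rw [hinv a' ha' a ha heq] at hea'
    have := (Real.le_log_iff_exp_le (hφ0 a ha)).2 hea'
    push_cast at this
    linarith
  have h0 : m (A 0) = 0 := by
    have h1 := tendsto_measure_iInter_atTop (μ := m) (s := fun n : ℕ => A n)
      (fun n => (hAm n).nullMeasurableSet) hanti ⟨0, measure_ne_top _ _⟩
    rw [hempty, measure_empty] at h1
    refine tendsto_nhds_unique (tendsto_const_nhds.congr fun n => ?_) h1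
    exact (hconst n).symm
  refine hm0 (Measure.measure_univ_eq_zero.1 ?_)
  rw [← Set.union_compl_self (HomSpace.orbit Γ H g)]
  refine measure_union_null (measure_mono_null ?_ (measure_iUnion_null fun n : ℤ =>
    (hconst n).trans h0)) hmo
  rintro _ ⟨a, ha, rfl⟩
  refine Set.mem_iUnion.2 ⟨⌊Real.log (φ a)⌋, a, ⟨ha, ?_⟩, rfl⟩
  rw [← Real.le_log_iff_exp_le (hφ0 a ha)]
  exact Int.floor_le _

/-- Suppose `v` has a component of nonzero weight, choose `X ∈ 𝔥` of value `1` on that weight, and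
let `T` project to the eigenvalue `1` of `ad X`. Since `T` commutes with `Ad` of `H` and `v` is
fixed by the stabilizer, the norm of `Ad(a⁻¹) (T v)` depends only on the point `Γ g a`. Translation
by `exp(-X)` multiplies it by `e`, contradicting periodicity. -/
theorem Diagonalizes.mem_of_fixed {P : GL (Fin N) ℝ} (hP : Diagonalizes P h)
    (hh : h.IsCartanSubalgebra) (hΓ : Γ.Commensurable G.integerPoints) {g : G.RealPoints}
    (hper : HomSpace.IsPeriodic Γ (G.cartanSubgroup h) g) {v : G.lieAlg}
    (hv : ∀ u ∈ G.cartanSubgroup h, g * u * g⁻¹ ∈ Γ → G.Ad u v = v) : v ∈ h := by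
  refine hP.mem_of_entries hh fun i j hij => ?_
  by_contra hne
  obtain ⟨X₀, hX₀⟩ : ∃ X, entryWeight P h i j X ≠ 0 := by
    by_contra hcon
    push Not at hcon
    exact hne (LinearMap.ext hcon)
  obtain ⟨X, hX1⟩ : ∃ X, entryWeight P h i j X = 1 :=
    ⟨(entryWeight P h i j X₀)⁻¹ • X₀, by rw [map_smul, smul_eq_mul, inv_mul_cancel₀ hX₀]⟩
  obtain ⟨p, hp⟩ := hP.exists_polynomial X fun t => if t = 1 then 1 else 0
  set T := Polynomial.aeval (LieAlgebra.ad ℝ G.lieAlg X) p with hT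
  have hTexp : ∀ Y, G.Ad (G.exp (X : G.lieAlg)) (T Y) = Real.exp 1 • T Y := by
    intro Y
    refine ext_conjBy (P := P) fun k l => ?_
    rw [hP.Ad_exp_apply, coe_smul, map_smul, Matrix.smul_apply, smul_eq_mul, hp]
    by_cases hw : entryWeight P h k l X = 1 <;> simp [hw]
  have hTv : T v ≠ 0 := by
    intro h0
    have h1 := hp v i j
    rw [h0, hX1, if_pos rfl, one_mul] at h1
    refine hij (h1.symm.trans ?_)
    simp
  refine not_isPeriodic_of_expanding hΓ (isClosed_cartanSubgroup h)
    (c := (G.exp (X : G.lieAlg))⁻¹) ((G.cartanSubgroup h).inv_mem (hP.exp_mem X))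
    (fun a => matNorm (G.Ad a⁻¹ (T v) : Matrix (Fin N) (Fin N) ℝ))
    ((continuous_matNorm_Ad (T v)).comp continuous_inv) (fun a _ => matNorm_pos ?_)
    (fun a ha => ?_) (fun a ha a' ha' heq => ?_) hper
  · intro h0
    refine hTv ?_
    have h1 : G.Ad a⁻¹ (T v) = 0 := Subtype.ext h0
    rw [← G.Ad_one (T v), ← mul_inv_cancel a, Ad_mul, h1, map_zero]
  · rw [mul_inv_rev, inv_inv, Ad_mul, Ad_aeval ((G.cartanSubgroup h).inv_mem ha), hTexp, coe_smul,
      matNorm_smul, abs_of_pos (Real.exp_pos 1)]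
  · obtain ⟨γ, hγ, h1⟩ := (HomSpace.mk_eq_mk_iff Γ).1 heq
    have h2 : g * (a' * a⁻¹) * g⁻¹ = γ := by
      rw [← mul_assoc, h1]; group
    have h3 : G.Ad (a' * a⁻¹) v = v :=
      hv _ ((G.cartanSubgroup h).mul_mem ha' ((G.cartanSubgroup h).inv_mem ha)) (h2 ▸ hγ)
    have h4 : G.Ad a⁻¹ v = G.Ad a'⁻¹ v := by
      rw [show a⁻¹ = a'⁻¹ * (a' * a⁻¹) by group, Ad_mul, h3]
    rw [Ad_aeval ((G.cartanSubgroup h).inv_mem ha), Ad_aeval ((G.cartanSubgroup h).inv_mem ha'), h4]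

/-- The Cartan subalgebra of a periodic orbit is rational. -/
theorem Diagonalizes.span_eq_of_isPeriodic {P : GL (Fin N) ℝ} (hP : Diagonalizes P h)
    (hh : h.IsCartanSubalgebra) (hΓ : Γ.Commensurable G.integerPoints)
    (hB : G.IsIntegralStructure Γ gZ B) {g : G.RealPoints}
    (hper : HomSpace.IsPeriodic Γ (G.cartanSubgroup h) g) :
    Submodule.span ℝ {X | X ∈ gZ ∧ X ∈ h.toSubmodule.map (G.Ad g)} = h.toSubmodule.map (G.Ad g) := by
  refine le_antisymm (Submodule.span_le.2 fun X hX => hX.2) ?_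
  rintro _ ⟨X, hX, rfl⟩
  -- With `Λ = Γ ∩ g H g⁻¹`, the torus consists of `Λ`-fixed vectors and, by periodicity, contains
  -- all of them. The space fixed by elements of `Γ` is rational.
  set Λ : Set G.RealPoints := {γ | γ ∈ Γ ∧ ∃ u ∈ G.cartanSubgroup h, γ = g * u * g⁻¹} with hΛ
  have h1 : ∀ γ ∈ Λ, G.Ad γ (G.Ad g X) = G.Ad g X := by
    rintro _ ⟨_, u, hu, rfl⟩
    rw [← Ad_mul, inv_mul_cancel_right, Ad_mul, hu X hX]
  refine Submodule.span_mono ?_ (hB.fixed_mem_span (Λ := Λ) (fun γ hγ => hγ.1) h1)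
  rintro Y ⟨hY, hfix⟩
  refine ⟨hY, G.Ad g⁻¹ Y, ?_, by rw [← Ad_mul, mul_inv_cancel, Ad_one]⟩
  refine hP.mem_of_fixed hh hΓ hper fun u hu hγ => ?_
  have h2 := congrArg (G.Ad g⁻¹) (hfix _ ⟨hγ, u, hu, rfl⟩)
  rw [← Ad_mul] at h2
  rw [← Ad_mul, ← h2]
  congr 2
  group

end LinAlgGroup

/-! ## The discriminant of a rational subspace -/

/-- The value of an alternating map on a family of `r` vectors of an `r`-dimensional space. -/
theorem AlternatingMap.eq_det_smul {t M : Type*} [AddCommGroup t] [Module ℝ t] [AddCommGroup M]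
    [Module ℝ M] {ι : Type*} [Fintype ι] [DecidableEq ι] (F : Module.Basis ι ℝ t)
    (A : t [⋀^ι]→ₗ[ℝ] M) (e : ι → t) : A e = F.det e • A F := by
  have h1 : A = (LinearMap.toSpanSingleton ℝ M (A F)).compAlternatingMap F.det := by
    refine Module.Basis.ext_alternating F fun v hv => ?_
    obtain ⟨σ, rfl⟩ : ∃ σ : Equiv.Perm ι, (σ : ι → ι) = v :=
      ⟨Equiv.ofBijective v (Finite.injective_iff_bijective.1 hv), rfl⟩
    have h2 : F.det (fun i => F (σ i)) = ((Equiv.Perm.sign σ : ℤ) : ℝ) := by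
      have := F.det.map_perm (fun i => F i) σ
      simpa [Function.comp_def, F.det_self, Units.smul_def] using this
    have h3 := A.map_perm (fun i => F i) σ
    rw [LinearMap.compAlternatingMap_apply, LinearMap.toSpanSingleton_apply, h2]
    rw [Units.smul_def] at h3
    rw [Int.cast_smul_eq_zsmul]
    exact h3
  nth_rewrite 1 [h1]
  rfl

theorem det_apply_eq {t : Type*} [AddCommGroup t] [Module ℝ t] {ι : Type*} [Fintype ι]
    [DecidableEq ι] (F : Module.Basis ι ℝ t) (φ : ι → t →ₗ[ℝ] ℝ) (e : ι → t) :
    (Matrix.of fun a c => φ a (e c)).det = F.det e * (Matrix.of fun a c => φ a (F c)).det := by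
  rw [Module.Basis.det_apply, mul_comm, ← Matrix.det_mul]
  congr 1
  ext a c
  rw [Matrix.mul_apply, Matrix.of_apply]
  nth_rewrite 1 [← F.sum_repr (e c)]
  rw [map_sum]
  refine Finset.sum_congr rfl fun i _ => ?_
  rw [map_smul, smul_eq_mul, mul_comm, Module.Basis.toMatrix_apply]
  rfl

theorem det_gram_eq {t : Type*} [AddCommGroup t] [Module ℝ t] {ι : Type*} [Fintype ι]
    [DecidableEq ι] (F : Module.Basis ι ℝ t) (B : LinearMap.BilinForm ℝ t) (e : ι → t) :
    (Matrix.of fun a c => B (e a) (e c)).det =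
      F.det e ^ 2 * (Matrix.of fun a c => B (F a) (F c)).det := by
  have h1 := det_apply_eq F (fun a => B (e a)) e
  have h2 := det_apply_eq F (fun a => B.flip (F a)) e
  have h3 : (Matrix.of fun a c => B.flip (F a) (e c)).det =
      (Matrix.of fun a c => B (e a) (F c)).det := by
    rw [← Matrix.det_transpose]
    rfl
  have h4 : (Matrix.of fun a c => B.flip (F a) (F c)).det =
      (Matrix.of fun a c => B (F a) (F c)).det := by
    rw [← Matrix.det_transpose]
    rfl
  rw [h1, ← h3, h2, h4]
  ring

theorem exists_int_det {ι : Type*} [Fintype ι] [DecidableEq ι] {A : Matrix ι ι ℝ}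
    (hA : ∀ i j, ∃ n : ℤ, A i j = n) : ∃ n : ℤ, A.det = n := by
  choose n hn using hA
  refine ⟨(Matrix.of n).det, ?_⟩
  have h1 := (Int.castRingHom ℝ).map_det (Matrix.of n)
  refine Eq.trans ?_ h1.symm
  congr 1
  ext i j
  simp [hn]

/-- The denominator of `D⁻¹ u` for a vector `u` of a lattice with an integral functional of value
one. -/
theorem sInf_smul_inv_mem {V : Type*} [AddCommGroup V] [Module ℝ V] {L : AddSubgroup V} {u : V}
    (hu : u ∈ L) (Ψ : V →ₗ[ℝ] ℝ) (hΨ : ∀ z ∈ L, ∃ k : ℤ, Ψ z = k) (hΨu : Ψ u = 1) {D : ℤ}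
    (hD0' : D ≠ 0) : sInf {n : ℕ | 0 < n ∧ n • ((D : ℝ)⁻¹ • u) ∈ L} = D.natAbs := by
  have hD0 : (D : ℝ) ≠ 0 := by exact_mod_cast hD0'
  have hmul : ∀ k : ℤ, k • ((D : ℝ)⁻¹ • u) = (k * (D : ℝ)⁻¹) • u := fun k => by
    rw [← Int.cast_smul_eq_zsmul ℝ, smul_smul]
  have hDmem : 0 < D.natAbs ∧ D.natAbs • ((D : ℝ)⁻¹ • u) ∈ L := by
    refine ⟨Int.natAbs_pos.2 hD0', ?_⟩
    have h1 : D • ((D : ℝ)⁻¹ • u) ∈ L := by rwa [hmul, mul_inv_cancel₀ hD0, one_smul]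
    rw [← natCast_zsmul]
    rcases Int.natAbs_eq D with hs | hs
    · rwa [← hs]
    · rw [show (D.natAbs : ℤ) = -D by omega, neg_zsmul]
      exact neg_mem h1
  obtain ⟨hpos, hmem⟩ := Nat.sInf_mem (s := {n : ℕ | 0 < n ∧ n • ((D : ℝ)⁻¹ • u) ∈ L}) ⟨_, hDmem⟩
  have hle := Nat.sInf_le (s := {n : ℕ | 0 < n ∧ n • ((D : ℝ)⁻¹ • u) ∈ L}) hDmem
  set n := sInf {n : ℕ | 0 < n ∧ n • ((D : ℝ)⁻¹ • u) ∈ L}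
  -- `Ψ` takes the value `n / D` on `n D⁻¹ u`; its integrality forces `D` to divide `n`.
  obtain ⟨k, hk⟩ := hΨ _ hmem
  rw [← natCast_zsmul, hmul, map_smul, hΨu, smul_eq_mul, mul_one] at hk
  have hnk : (n : ℤ) = k * D := by
    have h1 : ((n : ℤ) : ℝ) = k * D := by rw [← hk, mul_assoc, inv_mul_cancel₀ hD0, mul_one]
    exact_mod_cast h1
  refine le_antisymm hle (Nat.le_of_dvd hpos ?_)
  rw [← Int.natCast_dvd_natCast, hnk, Int.natAbs_dvd]
  exact dvd_mul_left _ _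

namespace LinAlgGroup

variable {N : ℕ} {G : LinAlgGroup N} {Γ : Subgroup G.RealPoints} {gZ : Submodule ℤ G.lieAlg}
  {B : LinearMap.BilinForm ℝ G.lieAlg} {h : LieSubalgebra ℝ G.lieAlg}

/-- A rational subspace has a basis that extends to a basis of the lattice. -/
theorem IsIntegralStructure.exists_adapted_basis (hB : G.IsIntegralStructure Γ gZ B)
    {t : Submodule ℝ G.lieAlg} (ht : Submodule.span ℝ {X | X ∈ gZ ∧ X ∈ t} = t) :
    ∃ (d : ℕ) (b : Module.Basis (Fin d) ℤ gZ) (b' : Module.Basis (Fin d) ℝ G.lieAlg)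
      (φ : Fin (Module.finrank ℝ t) ↪ Fin d) (F : Module.Basis (Fin (Module.finrank ℝ t)) ℝ t),
      (∀ i, b' i = b i) ∧ ∀ i, (F i : G.lieAlg) = b' (φ i) := by
  obtain ⟨d, b₀, -, -⟩ := hB.exists_basis
  set M : Submodule ℤ gZ := (t.restrictScalars ℤ).comap gZ.subtype with hM
  have hmemM : ∀ X : gZ, X ∈ M ↔ (X : G.lieAlg) ∈ t := fun X => Iff.rfl
  -- Smith normal form describes `𝔤_ℤ ∩ 𝔱` by multiples `a i • b (φ i)` of lattice basis vectors. As
  -- `𝔱` is a real subspace, it contains the vectors `b (φ i)` themselves, so the multipliers can be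
  -- dropped.
  obtain ⟨n, b, bN, φ, a, hsnf⟩ := Submodule.smithNormalForm b₀ M
  have hspan : ⊤ ≤ Submodule.span ℝ (Set.range fun i => (b i : G.lieAlg)) := by
    rw [← hB.span_eq_top, Submodule.span_le]
    intro X hX
    have h1 := congrArg Subtype.val (b.sum_repr ⟨X, hX⟩)
    have h2 : X = ∑ i, b.repr ⟨X, hX⟩ i • (b i : G.lieAlg) :=
      h1.symm.trans (map_sum gZ.subtype (fun i => b.repr ⟨X, hX⟩ i • b i) Finset.univ)
    rw [h2]
    refine Submodule.sum_mem _ fun i _ => ?_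
    rw [← Int.cast_smul_eq_zsmul ℝ]
    exact Submodule.smul_mem _ _ (Submodule.subset_span ⟨i, rfl⟩)
  have hli := hB.linearIndependent b.linearIndependent
  have ha : ∀ i, a i ≠ 0 := by
    intro i hi
    have h1 := hsnf i
    rw [hi, zero_smul] at h1
    exact bN.ne_zero i (Subtype.ext h1)
  have hmem : ∀ i, (b (φ i) : G.lieAlg) ∈ t := by
    intro i
    have h1 : ((bN i : gZ) : G.lieAlg) ∈ t := (hmemM _).1 (bN i).2
    rw [hsnf, show ((a i • b (φ i) : gZ) : G.lieAlg) = (a i : ℝ) • (b (φ i) : G.lieAlg) by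
      rw [Int.cast_smul_eq_zsmul]; rfl] at h1
    exact (Submodule.smul_mem_iff _ (by exact_mod_cast ha i)).1 h1
  have hliF : LinearIndependent ℝ fun i => (⟨b (φ i), hmem i⟩ : t) :=
    LinearIndependent.of_comp t.subtype (hli.comp φ φ.injective)
  have hspF : ⊤ ≤ Submodule.span ℝ (Set.range fun i => (⟨b (φ i), hmem i⟩ : t)) := by
    rintro ⟨X, hX⟩ -
    have hle : t ≤ Submodule.span ℝ (Set.range fun i => (b (φ i) : G.lieAlg)) := by
      rw [← ht, Submodule.span_le]
      rintro Y ⟨hY, hYt⟩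
      have h1 := congrArg (fun z : M => ((z : gZ) : G.lieAlg)) (bN.sum_repr ⟨⟨Y, hY⟩, hYt⟩)
      have h2 : Y = ∑ i, bN.repr ⟨⟨Y, hY⟩, hYt⟩ i • ((bN i : gZ) : G.lieAlg) :=
        h1.symm.trans (map_sum (gZ.subtype.comp M.subtype)
          (fun i => bN.repr ⟨⟨Y, hY⟩, hYt⟩ i • bN i) Finset.univ)
      rw [h2]
      refine Submodule.sum_mem _ fun i _ => ?_
      rw [hsnf, show ((a i • b (φ i) : gZ) : G.lieAlg) = (a i : ℝ) • (b (φ i) : G.lieAlg) by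
        rw [Int.cast_smul_eq_zsmul]; rfl, ← Int.cast_smul_eq_zsmul ℝ]
      exact Submodule.smul_mem _ _ (Submodule.smul_mem _ _ (Submodule.subset_span ⟨i, rfl⟩))
    have h3 := hle hX
    rw [show (Set.range fun i => (b (φ i) : G.lieAlg)) =
      t.subtype '' Set.range fun i => (⟨b (φ i), hmem i⟩ : t) by
        rw [← Set.range_comp]; rfl, ← Submodule.map_span] at h3
    obtain ⟨Z, hZ, hZX⟩ := h3
    rwa [show (⟨X, hX⟩ : t) = Z from Subtype.ext hZX.symm]
  let F := Module.Basis.mk hliF hspF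
  have hn : n = Module.finrank ℝ t := by
    rw [Module.finrank_eq_card_basis F, Fintype.card_fin]
  subst hn
  refine ⟨d, b, Module.Basis.mk hli hspan, φ, F, fun i => Module.Basis.mk_apply _ _ i, fun i => ?_⟩
  rw [Module.Basis.mk_apply, Module.Basis.mk_apply]

/-- `ι(𝔱)` can be computed with any basis. -/
theorem iota_eq (B : LinearMap.BilinForm ℝ G.lieAlg) (t : Submodule ℝ G.lieAlg)
    (F : Module.Basis (Fin (Module.finrank ℝ t)) ℝ t) :
    G.iota B t = (Matrix.of fun i j => B (F i) (F j)).det⁻¹ •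
      (exteriorPower.ιMulti ℝ _ (fun i => (F i : G.lieAlg)) ⊗ₜ[ℝ]
        exteriorPower.ιMulti ℝ _ (fun i => (F i : G.lieAlg))) := by
  set e := Module.finBasis ℝ t with he
  have h1 : exteriorPower.ιMulti ℝ _ (fun i => (e i : G.lieAlg)) =
      F.det e • exteriorPower.ιMulti ℝ _ (fun i => (F i : G.lieAlg)) :=
    AlternatingMap.eq_det_smul F ((exteriorPower.ιMulti ℝ _).compLinearMap t.subtype) e
  have h2 := det_gram_eq F (B.compl₁₂ t.subtype t.subtype) e
  simp only [LinearMap.compl₁₂_apply, Submodule.subtype_apply] at h2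
  have h3 : F.det e ≠ 0 := (F.isUnit_det e).ne_zero
  change (Matrix.of fun i j => B (e i) (e j)).det⁻¹ •
    (exteriorPower.ιMulti ℝ _ (fun i => (e i : G.lieAlg)) ⊗ₜ[ℝ]
      exteriorPower.ιMulti ℝ _ (fun i => (e i : G.lieAlg))) = _
  rw [h1, h2, TensorProduct.smul_tmul_smul, smul_smul]
  congr 1
  rw [mul_inv, mul_assoc, mul_comm _ (F.det e * F.det e), ← mul_assoc, ← sq,
    inv_mul_cancel₀ (pow_ne_zero 2 h3), one_mul]

/-- The discriminant of a rational subspace is the Gram determinant of an integral basis. -/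
theorem discSub_eq {t : Submodule ℝ G.lieAlg} {d : ℕ} {b : Module.Basis (Fin d) ℤ gZ}
    {b' : Module.Basis (Fin d) ℝ G.lieAlg} (hb : ∀ i, b' i = b i)
    (φ : Fin (Module.finrank ℝ t) ↪ Fin d) (F : Module.Basis (Fin (Module.finrank ℝ t)) ℝ t)
    (hF : ∀ i, (F i : G.lieAlg) = b' (φ i)) {D : ℤ} (hD0' : D ≠ 0)
    (hD : (Matrix.of fun i j => B (F i) (F j)).det = D) :
    G.discSub gZ B t = D.natAbs := by
  classical
  have hFZ : ∀ i, (F i : G.lieAlg) ∈ gZ := fun i => by rw [hF, hb]; exact (b (φ i)).2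
  have hD0 : (D : ℝ) ≠ 0 := by exact_mod_cast hD0'
  have hiota := iota_eq B t F
  rw [hD] at hiota
  set w := exteriorPower.ιMulti ℝ (Module.finrank ℝ t) (fun i => (F i : G.lieAlg)) with hw
  have hwV : w ⊗ₜ[ℝ] w ∈ G.VInt gZ (Module.finrank ℝ t) :=
    AddSubgroup.subset_closure ⟨_, _, hFZ, hFZ, rfl⟩
  -- The coordinate minor on the indices `φ` is integral on the lattice and equals one on the
  -- integral basis `F`. Squaring it gives a functional showing that `w ⊗ w` is primitive in `V_ℤ`.
  set A : G.lieAlg [⋀^Fin (Module.finrank ℝ t)]→ₗ[ℝ] ℝ :=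
    Matrix.detRowAlternating.compLinearMap (LinearMap.pi fun i => b'.coord (φ i)) with hA
  have hAint : ∀ v : Fin (Module.finrank ℝ t) → G.lieAlg, (∀ i, v i ∈ gZ) → ∃ k : ℤ, A v = k :=
    fun v hv => exists_int_det fun i j => ⟨_, repr_eq_intCast hb (hv i) (φ j)⟩
  have hAF : A (fun i => (F i : G.lieAlg)) = 1 := by
    have : (fun i => (LinearMap.pi fun j => b'.coord (φ j)) (F i : G.lieAlg)) =
        (1 : Matrix (Fin (Module.finrank ℝ t)) (Fin (Module.finrank ℝ t)) ℝ) := by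
      ext i j
      rw [LinearMap.pi_apply, Module.Basis.coord_apply, hF, Module.Basis.repr_self,
        Finsupp.single_apply, Matrix.one_apply]
      simp only [φ.injective.eq_iff]
    change Matrix.det (fun i => (LinearMap.pi fun j => b'.coord (φ j)) (F i : G.lieAlg)) = 1
    rw [this, Matrix.det_one]
  set p := exteriorPower.alternatingMapLinearEquiv A with hp
  set Ψ : G.VSpace (Module.finrank ℝ t) →ₗ[ℝ] ℝ :=
    (LinearMap.mul' ℝ ℝ).comp (TensorProduct.map p p) with hΨ
  have hΨint : ∀ z ∈ G.VInt gZ (Module.finrank ℝ t), ∃ k : ℤ, Ψ z = k := by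
    intro z hz
    induction hz using AddSubgroup.closure_induction with
    | mem z hz =>
      obtain ⟨v, v', hv, hv', rfl⟩ := hz
      obtain ⟨k, hk⟩ := hAint v hv
      obtain ⟨k', hk'⟩ := hAint v' hv'
      refine ⟨k * k', ?_⟩
      rw [hΨ, LinearMap.comp_apply, TensorProduct.map_tmul, LinearMap.mul'_apply, hp,
        exteriorPower.alternatingMapLinearEquiv_apply_ιMulti,
        exteriorPower.alternatingMapLinearEquiv_apply_ιMulti, hk, hk', Int.cast_mul]
    | zero => exact ⟨0, by simp⟩
    | add z z' _ _ hz hz' =>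
      obtain ⟨k, hk⟩ := hz
      obtain ⟨k', hk'⟩ := hz'
      exact ⟨k + k', by rw [map_add, hk, hk', Int.cast_add]⟩
    | neg z _ hz =>
      obtain ⟨k, hk⟩ := hz
      exact ⟨-k, by rw [map_neg, hk, Int.cast_neg]⟩
  have hΨw : Ψ (w ⊗ₜ[ℝ] w) = 1 := by
    rw [hΨ, LinearMap.comp_apply, TensorProduct.map_tmul, LinearMap.mul'_apply, hp, hw,
      exteriorPower.alternatingMapLinearEquiv_apply_ιMulti, hAF, mul_one]
  rw [discSub, hiota]
  exact sInf_smul_inv_mem hwV Ψ hΨint hΨw hD0'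

/-- The minors of a rational subspace are multiples of a number determined by the discriminant. -/
theorem IsIntegralStructure.exists_discSub_scale (hB : G.IsIntegralStructure Γ gZ B)
    {t : Submodule ℝ G.lieAlg} (ht : Submodule.span ℝ {X | X ∈ gZ ∧ X ∈ t} = t) {r : ℕ}
    (e : Module.Basis (Fin r) ℝ t) (he : (Matrix.of fun i j => B (e i) (e j)).det ≠ 0) :
    0 < G.discSub gZ B t ∧ ∃ c : ℝ,
      c ^ 2 * G.discSub gZ B t = |(Matrix.of fun i j => B (e i) (e j)).det| ∧
      ∀ ψ : Fin r → G.lieAlg →ₗ[ℝ] ℝ, (∀ i, ∀ X ∈ gZ, ∃ k : ℤ, ψ i X = k) →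
        ∃ k : ℤ, (Matrix.of fun i j => ψ i (e j)).det = c * k := by
  classical
  obtain ⟨d, b, b', φ, F, hb, hF⟩ := hB.exists_adapted_basis ht
  obtain rfl : r = Module.finrank ℝ t := by
    rw [Module.finrank_eq_card_basis e, Fintype.card_fin]
  have hFZ : ∀ i, (F i : G.lieAlg) ∈ gZ := fun i => by rw [hF, hb]; exact (b (φ i)).2
  obtain ⟨D, hD⟩ := exists_int_det (A := Matrix.of fun i j => B (F i) (F j))
    fun i j => hB.integral _ (hFZ i) _ (hFZ j)
  have hgram := det_gram_eq F (B.compl₁₂ t.subtype t.subtype) e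
  simp only [LinearMap.compl₁₂_apply, Submodule.subtype_apply] at hgram
  rw [hD] at hgram
  have hD0 : (D : ℝ) ≠ 0 := fun h0 => he (by rw [hgram, h0, mul_zero])
  have hD0' : D ≠ 0 := by exact_mod_cast hD0
  have hn := discSub_eq hb φ F hF hD0' hD
  have hpos : 0 < G.discSub gZ B t := by rw [hn]; exact Int.natAbs_pos.2 hD0'
  -- The scale `c` is the determinant of `e` in the integral basis `F`: Gram determinants change by
  -- its square and minors by its first power.
  refine ⟨hpos, F.det e, ?_, fun ψ hψ => ?_⟩
  · rw [hgram, abs_mul, abs_of_nonneg (sq_nonneg (F.det e)), hn, Nat.cast_natAbs, Int.cast_abs]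
  · obtain ⟨k, hk⟩ := exists_int_det (A := Matrix.of fun i j => ψ i (F j))
      fun i j => hψ i _ (hFZ j)
    refine ⟨k, ?_⟩
    rw [← hk]
    exact det_apply_eq F (fun i => (ψ i).comp t.subtype) e

end LinAlgGroup

/-! ## Minors of families of vectors -/

/-- The determinant is Lipschitz on bounded sets of matrices. -/
theorem exists_det_lipschitz (n : ℕ) (R : ℝ) : ∃ C, 0 ≤ C ∧
    ∀ (A B : Matrix (Fin n) (Fin n) ℝ) (ε : ℝ), 0 ≤ ε → (∀ i j, |A i j| ≤ R) →
      (∀ i j, |B i j| ≤ R) → (∀ i j, |A i j - B i j| ≤ ε) → |A.det - B.det| ≤ C * ε := by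
  rcases lt_or_ge R 0 with hR | hR
  · refine ⟨0, le_rfl, fun A B ε hε hA _ _ => ?_⟩
    rcases Nat.eq_zero_or_pos n with rfl | hn
    · simp
    · exact absurd ((abs_nonneg _).trans (hA ⟨0, hn⟩ ⟨0, hn⟩)) (not_le.2 hR)
  have hf : ContDiff ℝ 1 fun A : Fin n → Fin n → ℝ => (Matrix.of A).det := by
    simp only [Matrix.det_apply, Matrix.of_apply]
    fun_prop
  obtain ⟨K, hK⟩ := hf.contDiffOn.exists_lipschitzOnWith (s := Metric.closedBall 0 R) one_ne_zero
    (convex_closedBall 0 R) (isCompact_closedBall 0 R)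
  have hmem : ∀ A : Matrix (Fin n) (Fin n) ℝ, (∀ i j, |A i j| ≤ R) →
      (fun i j => A i j) ∈ Metric.closedBall (0 : Fin n → Fin n → ℝ) R := by
    intro A hA
    rw [mem_closedBall_zero_iff]
    exact (pi_norm_le_iff_of_nonneg hR).2 fun i => (pi_norm_le_iff_of_nonneg hR).2 fun j => hA i j
  refine ⟨K, K.2, fun A B ε hε hA hB hAB => ?_⟩
  have h1 := hK.dist_le_mul _ (hmem A hA) _ (hmem B hB)
  rw [Real.dist_eq, dist_eq_norm] at h1
  refine h1.trans (mul_le_mul_of_nonneg_left ?_ K.2)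
  exact (pi_norm_le_iff_of_nonneg hε).2 fun i => (pi_norm_le_iff_of_nonneg hε).2 fun j => hAB i j

section Minor

variable {V : Type*} [AddCommGroup V] [Module ℝ V] {ι : Type*} {r : ℕ}

/-- The minors of the coordinate matrix of a family of vectors. -/
noncomputable def minor (b : Module.Basis ι ℝ V) (I : Fin r → ι) (w : Fin r → V) : ℝ :=
  (Matrix.of fun a c => b.coord (I a) (w c)).det

/-- The minors are the values of one alternating form on the dual space at dual basis vectors. If
all vanish the form is zero, but it equals one on functionals dual to the independent family `w`. -/
theorem exists_minor_ne_zero [Finite ι] (b : Module.Basis ι ℝ V) {w : Fin r → V}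
    (hw : LinearIndependent ℝ w) : ∃ I, minor b I w ≠ 0 := by
  classical
  have := Fintype.ofFinite ι
  by_contra! hcon
  let A : (Module.Dual ℝ V) [⋀^Fin r]→ₗ[ℝ] ℝ :=
    Matrix.detRowAlternating.compLinearMap (LinearMap.pi fun c => Module.Dual.eval ℝ V (w c))
  have hA : A = 0 := by
    refine Module.Basis.ext_alternating b.dualBasis fun I _ => ?_
    rw [AlternatingMap.zero_apply, ← hcon I, minor, Module.Basis.coe_dualBasis]
    rfl
  obtain ⟨g, hg⟩ := (LinearMap.exists_leftInverse_of_injective (Fintype.linearCombination ℝ w)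
    (LinearMap.ker_eq_bot.2 (linearIndependent_iff_injective_fintypeLinearCombination.1 hw)))
  have h1 : A (fun a => (LinearMap.proj a).comp g) = 1 := by
    change (Matrix.of fun a c => g (w c) a).det = 1
    have h2 : (Matrix.of fun a c => g (w c) a) = 1 := by
      ext a c
      have h3 := LinearMap.congr_fun hg (Pi.single c 1)
      rw [LinearMap.comp_apply, Fintype.linearCombination_apply_single, one_smul,
        LinearMap.id_apply] at h3
      rw [Matrix.of_apply, h3, Matrix.one_apply, Pi.single_apply]
    rw [h2, Matrix.det_one]
  rw [hA, AlternatingMap.zero_apply] at h1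
  exact zero_ne_one h1

/-- Cramer's rule: a minor times a coordinate of `w c` is expanded through the minors with one index
replaced. -/
theorem coord_mul_minor [Finite ι] (b : Module.Basis ι ℝ V) (w : Fin r → V) (I : Fin r → ι) (a : ι)
    (c : Fin r) : minor b I w * b.coord a (w c) =
      ∑ k, b.coord (I k) (w c) * minor b (Function.update I k a) w := by
  classical
  have h1 := congrFun (Matrix.mulVec_cramer (Matrix.transpose (Matrix.of fun a c =>
    b.coord (I a) (w c))) fun c => b.coord a (w c)) c
  rw [Matrix.det_transpose, Pi.smul_apply, smul_eq_mul] at h1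
  rw [minor, ← h1, Matrix.mulVec, dotProduct]
  refine Finset.sum_congr rfl fun k _ => ?_
  rw [Matrix.cramer_transpose_apply, Matrix.transpose_apply, Matrix.of_apply, minor]
  congr 2
  ext k' c'
  by_cases hk : k' = k
  · subst hk; simp
  · simp [hk]

/-- Rows of the adjugate combine the `w c` into vectors whose coordinates are exactly the minors
with one index replaced. Thus the minors determine the span. -/
theorem exists_vec_minor [Finite ι] (b : Module.Basis ι ℝ V) (w : Fin r → V) (I : Fin r → ι)
    (k : Fin r) : ∃ X ∈ Submodule.span ℝ (Set.range w), ∀ a,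
      b.coord a X = minor b (Function.update I k a) w := by
  classical
  set W : Matrix (Fin r) (Fin r) ℝ := Matrix.of fun a c => b.coord (I a) (w c) with hW
  refine ⟨∑ c, W.transpose.adjugate k c • w c, Submodule.sum_mem _ fun c _ =>
    Submodule.smul_mem _ _ (Submodule.subset_span ⟨c, rfl⟩), fun a => ?_⟩
  have h1 := congrFun (Matrix.cramer_eq_adjugate_mulVec W.transpose fun c => b.coord a (w c)) k
  rw [Matrix.cramer_transpose_apply, Matrix.mulVec, dotProduct] at h1
  rw [map_sum]
  simp only [map_smul, smul_eq_mul]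
  rw [← h1, minor]
  congr 1
  ext k' c'
  by_cases hk : k' = k
  · subst hk; simp
  · simp [hk, hW]

/-- Two families with proportional minors span the same space. -/
theorem span_le_of_minors [Finite ι] (b : Module.Basis ι ℝ V) {w w' : Fin r → V}
    (hw : LinearIndependent ℝ w) (hw' : LinearIndependent ℝ w')
    (hm : ∀ I J, minor b I w * minor b J w' = minor b J w * minor b I w') :
    Submodule.span ℝ (Set.range w') ≤ Submodule.span ℝ (Set.range w) := by
  obtain ⟨I, hI⟩ := exists_minor_ne_zero b hw
  obtain ⟨J, hJ⟩ := exists_minor_ne_zero b hw'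
  have hI' : minor b I w' ≠ 0 := fun h0 => by
    have := hm I J
    rw [h0, mul_zero] at this
    exact mul_ne_zero hI hJ this
  rw [Submodule.span_le]
  rintro _ ⟨c, rfl⟩
  choose X hX hXc using exists_vec_minor b w I
  -- Cramer's rule expands `w' c` with minors of `w'`; proportionality trades these for minors of
  -- `w`, which are the coordinates of the vectors `X k` in the span of `w`.
  have h1 : w' c = (minor b I w)⁻¹ • ∑ k, b.coord (I k) (w' c) • X k := by
    refine b.ext_elem fun a => ?_
    rw [← Module.Basis.coord_apply, ← Module.Basis.coord_apply, map_smul, map_sum, smul_eq_mul,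
      eq_inv_mul_iff_mul_eq₀ hI]
    simp only [map_smul, smul_eq_mul, hXc]
    refine mul_left_cancel₀ hI' ?_
    rw [mul_left_comm, coord_mul_minor, Finset.mul_sum, Finset.mul_sum]
    refine Finset.sum_congr rfl fun k _ => ?_
    rw [mul_left_comm, hm I (Function.update I k a)]
    ring
  rw [h1]
  exact Submodule.smul_mem _ _ (Submodule.sum_mem _ fun k _ => Submodule.smul_mem _ _ (hX k))

end Minor

/-! ## Separation of periodic tori -/

theorem matNorm_le_of_entries {N : ℕ} {A : Matrix (Fin N) (Fin N) ℝ} {ε : ℝ} (hε : 0 ≤ ε)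
    (hA : ∀ i j, |A i j| ≤ ε) : matNorm A ≤ N * ε := by
  have h : matNorm A = ((Finset.univ.sup fun i : Fin N => ∑ j, ‖A i j‖₊ : NNReal) : ℝ) :=
    Matrix.linfty_opNorm_def A
  lift ε to NNReal using hε
  rw [h, ← NNReal.coe_natCast, ← NNReal.coe_mul, NNReal.coe_le_coe]
  refine Finset.sup_le fun i _ => (Finset.sum_le_card_nsmul _ _ ε fun j _ => ?_).trans_eq ?_
  · exact_mod_cast hA i j
  · simp

/-- Two real numbers with almost the same square are almost equal up to sign. -/
theorem exists_sign {s δ : ℝ} (h : |s ^ 2 - 1| ≤ δ) : ∃ σ : ℝ, (σ = 1 ∨ σ = -1) ∧ |s - σ| ≤ δ := by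
  have h1 : |s ^ 2 - 1| = |s - 1| * |s + 1| := by rw [← abs_mul]; ring_nf
  rcases le_total 0 s with hs | hs
  · refine ⟨1, Or.inl rfl, le_trans ?_ h⟩
    rw [h1]
    exact le_mul_of_one_le_right (abs_nonneg _) (by rw [abs_of_nonneg] <;> linarith)
  · refine ⟨-1, Or.inr rfl, le_trans ?_ h⟩
    rw [h1, sub_neg_eq_add]
    exact le_mul_of_one_le_left (abs_nonneg _) (by rw [abs_of_nonpos] <;> linarith)

/-! ### Norm bounds and approximate normalization of the Cartan subalgebra. -/

namespace LinAlgGroup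

variable {N : ℕ} {G : LinAlgGroup N} {Γ : Subgroup G.RealPoints} {gZ : Submodule ℤ G.lieAlg}
  {B : LinearMap.BilinForm ℝ G.lieAlg} {h : LieSubalgebra ℝ G.lieAlg}

theorem exists_functional_bound (l : G.lieAlg →ₗ[ℝ] ℝ) :
    ∃ C, 0 ≤ C ∧ ∀ X : G.lieAlg, |l X| ≤ C * matNorm X.1 := by
  obtain ⟨l', hl'⟩ := LinearMap.exists_extend (p := G.lieAlg.toSubmodule) l
  refine ⟨∑ i, ∑ j, |l' (Matrix.single i j 1)|, Finset.sum_nonneg fun i _ =>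
    Finset.sum_nonneg fun j _ => abs_nonneg _, fun X => ?_⟩
  have h1 : l X = l' X.1 := (LinearMap.congr_fun hl' X).symm
  rw [h1]
  nth_rewrite 1 [Matrix.matrix_eq_sum_single X.1]
  rw [map_sum, Finset.sum_mul]
  refine (Finset.abs_sum_le_sum_abs _ _).trans (Finset.sum_le_sum fun i _ => ?_)
  rw [map_sum, Finset.sum_mul]
  refine (Finset.abs_sum_le_sum_abs _ _).trans (Finset.sum_le_sum fun j _ => ?_)
  rw [show Matrix.single i j (X.1 i j) = X.1 i j • Matrix.single i j (1 : ℝ) by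
    rw [Matrix.smul_single, smul_eq_mul, mul_one], map_smul, smul_eq_mul, abs_mul, mul_comm]
  exact mul_le_mul_of_nonneg_left (abs_apply_le_matNorm _ _ _) (abs_nonneg _)

theorem exists_functional_bound' {ι : Type*} [Finite ι] (l : ι → G.lieAlg →ₗ[ℝ] ℝ) :
    ∃ C, 0 ≤ C ∧ ∀ i, ∀ X : G.lieAlg, |l i X| ≤ C * matNorm X.1 := by
  have := Fintype.ofFinite ι
  choose C hC0 hC using fun i => exists_functional_bound (l i)
  refine ⟨∑ i, C i, Finset.sum_nonneg fun i _ => hC0 i, fun i X => (hC i X).trans ?_⟩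
  exact mul_le_mul_of_nonneg_right (Finset.single_le_sum (fun i _ => hC0 i) (Finset.mem_univ i))
    (matNorm_nonneg _)

theorem exists_form_bound (B : LinearMap.BilinForm ℝ G.lieAlg) :
    ∃ C, 0 ≤ C ∧ ∀ X Y : G.lieAlg, |B X Y| ≤ C * (matNorm X.1 * matNorm Y.1) := by
  let b := Module.finBasis ℝ G.lieAlg
  obtain ⟨C₁, hC₁, h₁⟩ := exists_functional_bound' fun i => b.coord i
  obtain ⟨C₂, hC₂, h₂⟩ := exists_functional_bound' fun i => B (b i)
  refine ⟨∑ _i : Fin (Module.finrank ℝ G.lieAlg), C₁ * C₂, by positivity, fun X Y => ?_⟩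
  have h3 : B X Y = ∑ i, b.coord i X * B (b i) Y := by
    nth_rewrite 1 [← b.sum_repr X]
    rw [map_sum, LinearMap.sum_apply]
    exact Finset.sum_congr rfl fun i _ => by
      rw [map_smul, LinearMap.smul_apply, smul_eq_mul, Module.Basis.coord_apply]
  rw [h3, Finset.sum_mul]
  refine (Finset.abs_sum_le_sum_abs _ _).trans (Finset.sum_le_sum fun i _ => ?_)
  rw [abs_mul]
  refine (mul_le_mul (h₁ i X) (h₂ i Y) (abs_nonneg _)
    (mul_nonneg hC₁ (matNorm_nonneg _))).trans_eq ?_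
  ring

theorem matNorm_Ad_le (g : G.RealPoints) (X : G.lieAlg) :
    matNorm (G.Ad g X).1 ≤ matNorm (G.toMat g) * matNorm (G.toMat g⁻¹) * matNorm X.1 := by
  rw [coe_Ad]
  refine (matNorm_mul_le _ _).trans ((mul_le_mul_of_nonneg_right (matNorm_mul_le _ _)
    (matNorm_nonneg _)).trans_eq ?_)
  ring

theorem matNorm_toMat_le (g : G.RealPoints) :
    matNorm (G.toMat g) ≤ matNorm (1 : Matrix (Fin N) (Fin N) ℝ) + G.dev g := by
  have := matNorm_add_le (1 : Matrix (Fin N) (Fin N) ℝ) (G.toMat g - 1)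
  rwa [add_sub_cancel] at this

theorem matNorm_Ad_le_of_dev_le {g : G.RealPoints} (hg : G.dev g ≤ 1 / 2) (X : G.lieAlg) :
    matNorm (G.Ad g X).1 ≤ (matNorm (1 : Matrix (Fin N) (Fin N) ℝ) + 1) ^ 2 * matNorm X.1 := by
  refine (matNorm_Ad_le g X).trans (mul_le_mul_of_nonneg_right ?_ (matNorm_nonneg _))
  have h0 := matNorm_nonneg (1 : Matrix (Fin N) (Fin N) ℝ)
  rw [sq]
  refine mul_le_mul ((matNorm_toMat_le g).trans (by linarith)) ?_ (matNorm_nonneg _) (by linarith)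
  have := G.dev_inv_le hg
  exact (matNorm_toMat_le g⁻¹).trans (by linarith)

theorem exists_conjBy_bound (P : GL (Fin N) ℝ) : ∃ C, 0 ≤ C ∧
    ∀ A : Matrix (Fin N) (Fin N) ℝ, ∀ i j, |conjBy P A i j| ≤ C * matNorm A := by
  refine ⟨matNorm P.1 * matNorm P⁻¹.1, mul_nonneg (matNorm_nonneg _) (matNorm_nonneg _),
    fun A i j => (abs_apply_le_matNorm _ i j).trans ?_⟩
  rw [conjBy_apply]
  refine (matNorm_mul_le _ _).trans ((mul_le_mul_of_nonneg_right (matNorm_mul_le _ _)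
    (matNorm_nonneg _)).trans_eq ?_)
  ring

theorem exists_bound_of_conjBy (P : GL (Fin N) ℝ) : ∃ C, 0 ≤ C ∧
    ∀ (A : Matrix (Fin N) (Fin N) ℝ) (ε : ℝ), 0 ≤ ε → (∀ i j, |conjBy P A i j| ≤ ε) →
      matNorm A ≤ C * ε := by
  refine ⟨matNorm P⁻¹.1 * matNorm P.1 * N, by
    have := matNorm_nonneg P.1
    have := matNorm_nonneg P⁻¹.1
    positivity, fun A ε hε hA => ?_⟩
  have h1 : A = P⁻¹.1 * conjBy P A * P.1 := by
    rw [conjBy_apply, show P⁻¹.1 * (P.1 * A * P⁻¹.1) * P.1 = (P⁻¹.1 * P.1) * A * (P⁻¹.1 * P.1) by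
      noncomm_ring, Units.inv_mul, one_mul, mul_one]
  nth_rewrite 1 [h1]
  refine (matNorm_mul_le _ _).trans ((mul_le_mul_of_nonneg_right (matNorm_mul_le _ _)
    (matNorm_nonneg _)).trans ?_)
  have := mul_le_mul_of_nonneg_left (matNorm_le_of_entries hε hA)
    (mul_nonneg (matNorm_nonneg P⁻¹.1) (matNorm_nonneg P.1))
  linarith

/-- Since `g = exp(s x)` fixes `X`, one has `Ad(g u g⁻¹) X = Ad(g) Ad(u) X`. The left side is
bounded because `g u g⁻¹` is near the identity, while `Ad(g)` multiplies the entry by an explicit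
exponential. -/
theorem Diagonalizes.exp_mul_conjBy_le {P : GL (Fin N) ℝ} (hP : Diagonalizes P h) {C : ℝ} (hC : 0 ≤ C)
    (hCP : ∀ A : Matrix (Fin N) (Fin N) ℝ, ∀ i j, |conjBy P A i j| ≤ C * matNorm A) (x : h) (s : ℝ)
    {u : G.RealPoints}
    (hs : G.dev (G.exp (s • (x : G.lieAlg)) * u * (G.exp (s • (x : G.lieAlg)))⁻¹) ≤ 1 / 2)
    {X : G.lieAlg} (hX : X ∈ h) (i j : Fin N) :
    Real.exp (s * entryWeight P h i j x) * |conjBy P (G.Ad u X) i j| ≤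
      C * ((matNorm (1 : Matrix (Fin N) (Fin N) ℝ) + 1) ^ 2 * matNorm X.1) := by
  have hc : ((s • x : h) : G.lieAlg) = s • (x : G.lieAlg) := rfl
  have h3 := hP.exp_mem (s • x)
  have h5 := hP.Ad_exp_apply (s • x) (G.Ad u X) i j
  have hw : entryWeight P h i j (s • x) = s * entryWeight P h i j x := by
    rw [map_smul, smul_eq_mul]
  rw [hc] at h3 h5
  rw [hw] at h5
  generalize G.exp (s • (x : G.lieAlg)) = g at *
  have h4 : G.Ad (g * u * g⁻¹) X = G.Ad g (G.Ad u X) := by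
    rw [Ad_mul, Ad_mul, (G.cartanSubgroup h).inv_mem h3 X hX]
  rw [← h4] at h5
  rw [← abs_of_pos (Real.exp_pos (s * entryWeight P h i j x)), ← abs_mul, ← h5]
  exact (hCP _ i j).trans (mul_le_mul_of_nonneg_left (matNorm_Ad_le_of_dev_le hs X) hC)

/-- An element `u` such that `aᵗ u a⁻ᵗ` and `a⁻ᵗ u aᵗ` are bounded almost normalizes `h`. -/
theorem Diagonalizes.exists_approx {P : GL (Fin N) ℝ} (hP : Diagonalizes P h)
    (hh : h.IsCartanSubalgebra) {x : h} (hx : 0 < G.minAbsRoot h x) :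
    ∃ C, 0 ≤ C ∧ ∀ (u : G.RealPoints) (t : ℕ),
      G.dev (G.exp (x : G.lieAlg) ^ t * u * (G.exp (x : G.lieAlg) ^ t)⁻¹) ≤ 1 / 2 →
      G.dev ((G.exp (x : G.lieAlg) ^ t)⁻¹ * u * G.exp (x : G.lieAlg) ^ t) ≤ 1 / 2 →
      ∀ X ∈ h, ∃ Z ∈ h, matNorm (G.Ad u X - Z).1 ≤
        C * matNorm X.1 * Real.exp (-(t * G.minAbsRoot h x)) := by
  obtain ⟨C₁, hC₁, h₁⟩ := exists_conjBy_bound P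
  obtain ⟨C₂, hC₂, h₂⟩ := exists_bound_of_conjBy P
  set K := (matNorm (1 : Matrix (Fin N) (Fin N) ℝ) + 1) ^ 2 with hK
  have hK0 : 0 ≤ K := sq_nonneg _
  refine ⟨C₂ * (C₁ * K), by positivity, fun u t hu1 hu2 X hX => ?_⟩
  set m := G.minAbsRoot h x
  obtain ⟨Z, hZ, hZe⟩ := hP.exists_proj hh hx (G.Ad u X)
  refine ⟨Z, hZ, ?_⟩
  have hu1' := hP.exp_mul_conjBy_le hC₁ h₁ x t (by rw [exp_natCast_smul]; exact hu1) hX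
  have hu2' := hP.exp_mul_conjBy_le hC₁ h₁ x (-t) (by rw [neg_smul, exp_neg, exp_natCast_smul, inv_inv]; exact hu2) hX
  have h6 := h₂ (G.Ad u X - Z).1 (C₁ * (K * matNorm X.1) * Real.exp (-(t * m)))
    (mul_nonneg (mul_nonneg hC₁ (mul_nonneg hK0 (matNorm_nonneg _))) (Real.exp_pos _).le)
    fun i j => ?_
  · exact h6.trans_eq (by ring)
  rw [coe_sub, map_sub, Matrix.sub_apply, hZe]
  have hRHS : 0 ≤ C₁ * (K * matNorm X.1) * Real.exp (-(t * m)) :=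
    mul_nonneg (mul_nonneg hC₁ (mul_nonneg hK0 (matNorm_nonneg _))) (Real.exp_pos _).le
  by_cases hw : entryWeight P h i j x = 0
  · simpa [hw] using hRHS
  rw [if_neg hw, zero_mul, sub_zero]
  by_cases h0 : conjBy P (G.Ad u X) i j = 0
  · rw [h0, abs_zero]; exact hRHS
  have hgap : m ≤ |entryWeight P h i j x| :=
    (hP.gap x h0).resolve_left fun h0 => hw (by rw [h0, LinearMap.zero_apply])
  have ht0 : (0 : ℝ) ≤ t := Nat.cast_nonneg t
  have h7 : Real.exp (t * m) * |conjBy P (G.Ad u X) i j| ≤ C₁ * (K * matNorm X.1) := by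
    -- Entries of positive weight are controlled by the conjugate by `aᵗ`, those of negative weight
    -- by the conjugate by `a⁻ᵗ`.
    rcases le_abs.1 hgap with hg | hg
    · refine (mul_le_mul_of_nonneg_right (Real.exp_le_exp.2 ?_) (abs_nonneg _)).trans (hu1' i j)
      exact mul_le_mul_of_nonneg_left hg ht0
    · refine (mul_le_mul_of_nonneg_right (Real.exp_le_exp.2 ?_) (abs_nonneg _)).trans (hu2' i j)
      rw [neg_mul, ← mul_neg]
      exact mul_le_mul_of_nonneg_left hg ht0
  rw [Real.exp_neg, ← div_eq_mul_inv, le_div_iff₀ (Real.exp_pos _), mul_comm]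
  exact h7

end LinAlgGroup

/-- Minors that are integral multiples of large numbers and almost equal are proportional. -/
theorem minors_proportional {ι : Type*} {q q' : ι → ℝ} {c c' β C ε σ Δ : ℝ} {n n' κ : ℕ}
    (hC : 0 ≤ C) (hβ : 0 < β) (hn : 0 < n) (hn' : 0 < n') (hc : c ^ 2 * n = β)
    (hc' : c' ^ 2 * n' = β) (hq : ∀ I, ∃ k : ℤ, q I = c * k) (hq' : ∀ I, ∃ k : ℤ, q' I = c' * k)
    (hqC : ∀ I, |q I| ≤ C) (hσ : σ = 1 ∨ σ = -1) (hqq : ∀ I, |q' I - σ * q I| ≤ C * ε)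
    (hκ : (κ = 1 ∧ (n : ℝ) ≤ Δ ∧ (n' : ℝ) ≤ Δ) ∨ (κ = 2 ∧ (n : ℝ) = Δ ∧ (n' : ℝ) = Δ))
    (hsmall : 2 * C ^ 2 / β * ε ^ κ * Δ < 1) (I J : ι) : q I * q' J = q J * q' I := by
  have hnR : (0 : ℝ) < n := by exact_mod_cast hn
  have hnR' : (0 : ℝ) < n' := by exact_mod_cast hn'
  have habs : ∀ z : ℤ, z ≠ 0 → (1 : ℝ) ≤ |(z : ℝ)| := fun z hz => by
    rw [← Int.cast_abs]; exact_mod_cast Int.one_le_abs hz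
  rcases hκ with ⟨rfl, h1, h2⟩ | ⟨rfl, h1, h2⟩
  -- With only an upper bound on the discriminants the scales may differ. The 2×2 determinant is an
  -- integral multiple of `c c'`, where `|c c'| ≥ β / Δ`, and is also `O(ε)`.
  · have hΔ : 0 < Δ := hnR.trans_le h1
    by_contra hne
    obtain ⟨k, hk⟩ := hq I
    obtain ⟨l, hl⟩ := hq J
    obtain ⟨k', hk'⟩ := hq' I
    obtain ⟨l', hl'⟩ := hq' J
    have hD : q I * q' J - q J * q' I = c * c' * ((k * l' - l * k' : ℤ) : ℝ) := by
      rw [hk, hl, hk', hl']; push_cast; ring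
    have hz : k * l' - l * k' ≠ 0 := fun h0 => hne (by
      rw [h0, Int.cast_zero, mul_zero] at hD; linarith)
    have hup : |q I * q' J - q J * q' I| ≤ 2 * C ^ 2 * ε := by
      rw [show q I * q' J - q J * q' I = q I * (q' J - σ * q J) - q J * (q' I - σ * q I) by ring]
      refine (abs_sub _ _).trans ?_
      rw [abs_mul, abs_mul]
      have e1 := mul_le_mul (hqC I) (hqq J) (abs_nonneg _) hC
      have e2 := mul_le_mul (hqC J) (hqq I) (abs_nonneg _) hC
      linarith
    have hlow : |c * c'| ≤ |q I * q' J - q J * q' I| := by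
      rw [hD, abs_mul (c * c')]
      exact le_mul_of_one_le_right (abs_nonneg _) (habs _ hz)
    have hcc : β ≤ |c * c'| * Δ := by
      refine (sq_le_sq₀ hβ.le (by positivity)).1 ?_
      have e1 : (c * c') ^ 2 * (n * n') = β ^ 2 := by
        rw [sq β]; nth_rewrite 1 [← hc]; rw [← hc']; ring
      rw [mul_pow, sq_abs, ← e1]
      refine mul_le_mul_of_nonneg_left ?_ (sq_nonneg _)
      rw [sq]
      exact mul_le_mul h1 h2 hnR'.le hΔ.le
    rw [pow_one, div_mul_eq_mul_div, div_mul_eq_mul_div, div_lt_one hβ] at hsmall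
    have := mul_le_mul_of_nonneg_right (hlow.trans hup) hΔ.le
    linarith
  -- Equal discriminants give `c' = ±c`, so `q' - σ q` is itself an integral multiple of `c`, with
  -- `c² = β / Δ`. Smallness of `ε² Δ` instead of `ε Δ` is enough to make it vanish.
  · have hΔ : 0 < Δ := h1 ▸ hnR
    have hcc : c' = c ∨ c' = -c := by
      refine sq_eq_sq_iff_eq_or_eq_neg.1 (mul_right_cancel₀ hΔ.ne' ?_)
      rw [← h1, hc, h1, ← h2, hc']
    have hint : ∀ I, ∃ k : ℤ, q' I - σ * q I = c * k := by
      intro I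
      obtain ⟨k, hk⟩ := hq I
      obtain ⟨k', hk'⟩ := hq' I
      rcases hcc with rfl | rfl <;> rcases hσ with rfl | rfl
      · exact ⟨k' - k, by rw [hk, hk']; push_cast; ring⟩
      · exact ⟨k' + k, by rw [hk, hk']; push_cast; ring⟩
      · exact ⟨-k' - k, by rw [hk, hk']; push_cast; ring⟩
      · exact ⟨-k' + k, by rw [hk, hk']; push_cast; ring⟩
    have heq : ∀ I, q' I = σ * q I := by
      intro I
      by_contra hne
      obtain ⟨k, hk⟩ := hint I
      have hz : k ≠ 0 := fun h0 => hne (by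
        rw [h0, Int.cast_zero, mul_zero] at hk; linarith)
      have h3 : |c| ≤ C * ε := by
        refine le_trans ?_ (hqq I)
        rw [hk, abs_mul]
        exact le_mul_of_one_le_right (abs_nonneg _) (habs _ hz)
      have h4 : c ^ 2 ≤ (C * ε) ^ 2 := by
        rw [← sq_abs c]; exact pow_le_pow_left₀ (abs_nonneg _) h3 2
      rw [div_mul_eq_mul_div, div_mul_eq_mul_div, div_lt_one hβ] at hsmall
      have h5 := mul_le_mul_of_nonneg_right h4 hΔ.le
      rw [← h1, hc, h1] at h5
      have : 0 ≤ (C * ε) ^ 2 * Δ := by positivity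
      nlinarith
    rw [heq, heq]
    ring

/-! ### Plücker coordinates of nearby periodic tori. -/

namespace LinAlgGroup

variable {N : ℕ} {G : LinAlgGroup N} {Γ : Subgroup G.RealPoints} {gZ : Submodule ℤ G.lieAlg}
  {B : LinearMap.BilinForm ℝ G.lieAlg} {h : LieSubalgebra ℝ G.lieAlg}

/-- An almost isometric family of vectors of `h` has determinant almost `±1`. -/
theorem exists_sign_det {r : ℕ} (e : Module.Basis (Fin r) ℝ h) (B : LinearMap.BilinForm ℝ G.lieAlg)
    (hb0 : (Matrix.of fun i j => B (e i) (e j)).det ≠ 0) (S : ℝ) : ∃ C, 0 ≤ C ∧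
    ∀ (Y : Fin r → G.lieAlg) (Z : Fin r → h) (ε : ℝ), 0 ≤ ε →
      (∀ i j, B (Y i) (Y j) = B (e i) (e j)) → (∀ i, matNorm (Y i).1 ≤ S) →
      (∀ i, matNorm (Z i : G.lieAlg).1 ≤ S) → (∀ i, matNorm (Y i - Z i).1 ≤ ε) →
      ∃ σ : ℝ, (σ = 1 ∨ σ = -1) ∧ |e.det Z - σ| ≤ C * ε := by
  obtain ⟨CB, hCB, hB⟩ := exists_form_bound B
  obtain ⟨L, hL, hdet⟩ := exists_det_lipschitz r (CB * (S * S))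
  set b0 := (Matrix.of fun i j => B (e i) (e j)).det with hb0d
  refine ⟨L * (2 * CB * |S|) / |b0|, by positivity, fun Y Z ε hε hYe hY hZ hYZ => ?_⟩
  -- The Gram determinant of `Z` is `(det Z)² b0`, while that of the nearby family `Y` is exactly
  -- `b0`. So `(det Z)²` is close to one.
  have hgram := det_gram_eq e (B.compl₁₂ h.toSubmodule.subtype h.toSubmodule.subtype) Z
  have hgram' : (Matrix.of fun i j => B (Z i) (Z j)).det = e.det Z ^ 2 * b0 := hgram
  have hbd : ∀ X W : G.lieAlg, matNorm X.1 ≤ S → matNorm W.1 ≤ S → |B X W| ≤ CB * (S * S) :=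
    fun X W hX hW => (hB X W).trans (mul_le_mul_of_nonneg_left (mul_le_mul hX hW
      (matNorm_nonneg _) ((matNorm_nonneg _).trans hX)) hCB)
  have h1 := hdet (Matrix.of fun i j => B (Z i) (Z j)) (Matrix.of fun i j => B (e i) (e j))
    (2 * CB * |S| * ε) (by positivity) (fun i j => hbd _ _ (hZ i) (hZ j))
    (fun i j => by
      rw [Matrix.of_apply, ← hYe]
      exact hbd _ _ (hY i) (hY j)) (fun i j => ?_)
  · refine exists_sign ?_
    rw [hgram'] at h1
    rw [show e.det Z ^ 2 * b0 - b0 = (e.det Z ^ 2 - 1) * b0 by ring, abs_mul,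
      ← le_div_iff₀ (abs_pos.2 hb0)] at h1
    exact h1.trans_eq (by ring)
  · rw [Matrix.of_apply, Matrix.of_apply, ← hYe]
    have h2 : B (Z i) (Z j) - B (Y i) (Y j) = -(B (Y i - Z i) (Z j) + B (Y i) (Y j - Z j)) := by
      simp only [map_sub, LinearMap.sub_apply]
      ring
    rw [h2, abs_neg]
    refine (abs_add_le _ _).trans ?_
    have hS : ∀ {a : ℝ}, a ≤ S → a ≤ |S| := fun ha => ha.trans (le_abs_self S)
    have e1 := (hB (Y i - Z i) (Z j)).trans (mul_le_mul_of_nonneg_left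
      (mul_le_mul (hYZ i) (hS (hZ j)) (matNorm_nonneg _) hε) hCB)
    have e2 := (hB (Y i) (Y j - Z j)).trans (mul_le_mul_of_nonneg_left
      (mul_le_mul (hS (hY i)) (hYZ j) (matNorm_nonneg _) (abs_nonneg _)) hCB)
    linarith

/-- The minors of `Ad(g u) h` and of `Ad(g) h` almost agree if `u` almost normalizes `h`. -/
theorem Diagonalizes.exists_minor_estimate {P : GL (Fin N) ℝ} (hP : Diagonalizes P h)
    (hh : h.IsCartanSubalgebra) {x : h} (hx : 0 < G.minAbsRoot h x) (hB : B.Nondegenerate)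
    (hinv : ∀ (g : G.RealPoints) (X Y : G.lieAlg), B (G.Ad g X) (G.Ad g Y) = B X Y) {r d : ℕ}
    (e : Module.Basis (Fin r) ℝ h) (b : Module.Basis (Fin d) ℝ G.lieAlg) (R : ℝ) :
    ∃ C, 0 ≤ C ∧ ∀ (g u : G.RealPoints) (t : ℕ), matNorm (G.toMat g) ≤ R →
      matNorm (G.toMat g⁻¹) ≤ R → G.dev u ≤ 1 / 2 →
      G.dev (G.exp (x : G.lieAlg) ^ t * u * (G.exp (x : G.lieAlg) ^ t)⁻¹) ≤ 1 / 2 →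
      G.dev ((G.exp (x : G.lieAlg) ^ t)⁻¹ * u * G.exp (x : G.lieAlg) ^ t) ≤ 1 / 2 →
      (∀ I, |minor b I fun c => G.Ad g (e c)| ≤ C) ∧ ∃ σ : ℝ, (σ = 1 ∨ σ = -1) ∧
        ∀ I, |(minor b I fun c => G.Ad (g * u) (e c)) - σ * minor b I fun c => G.Ad g (e c)| ≤
          C * Real.exp (-(t * G.minAbsRoot h x)) := by
  obtain ⟨C₀, hC₀, happ⟩ := hP.exists_approx hh hx
  obtain ⟨Cf, hCf, hf⟩ := exists_functional_bound' fun i => b.coord i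
  set E := ∑ c, matNorm (e c : G.lieAlg).1 with hE
  have hE0 : 0 ≤ E := Finset.sum_nonneg fun c _ => matNorm_nonneg _
  have heE : ∀ c, matNorm (e c : G.lieAlg).1 ≤ E := fun c =>
    Finset.single_le_sum (f := fun c => matNorm (e c : G.lieAlg).1)
      (fun c _ => matNorm_nonneg _) (Finset.mem_univ c)
  set K := (matNorm (1 : Matrix (Fin N) (Fin N) ℝ) + 1) ^ 2 with hK
  have hK0 : 0 ≤ K := sq_nonneg _
  set C₁ := C₀ * E with hC₁
  have hC₁0 : 0 ≤ C₁ := mul_nonneg hC₀ hE0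
  set S := E + K * E + C₁ with hS
  have hS0 : 0 ≤ S := by positivity
  obtain ⟨C₂, hC₂, hsign⟩ := exists_sign_det e B (hP.det_form_ne_zero hh hx hB hinv e) S
  obtain ⟨L, hL, hdet⟩ := exists_det_lipschitz r (Cf * (R * R * S))
  set M := (r.factorial : ℝ) * (Cf * (|R| * |R| * S)) ^ r with hM
  have hM0 : 0 ≤ M := by positivity
  refine ⟨M + L * (Cf * (|R| * |R| * C₁)) + C₂ * C₁ * M, by positivity,
    fun g u t hg hg' hu hu1 hu2 => ?_⟩
  have hR : 0 ≤ R := (matNorm_nonneg _).trans hg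
  rw [abs_of_nonneg hR] at *
  set ε := Real.exp (-(t * G.minAbsRoot h x)) with hε
  have hε0 : 0 ≤ ε := (Real.exp_pos _).le
  have hε1 : ε ≤ 1 := Real.exp_le_one_iff.2 (neg_nonpos.2 (by positivity))
  have hcoord : ∀ (i : Fin d) (X : G.lieAlg) (s : ℝ), matNorm X.1 ≤ s →
      |b.coord i (G.Ad g X)| ≤ Cf * (R * R * s) := fun i X s hX =>
    (hf i _).trans (mul_le_mul_of_nonneg_left ((matNorm_Ad_le g X).trans (mul_le_mul
      (mul_le_mul hg hg' (matNorm_nonneg _) hR) hX (matNorm_nonneg _) (by positivity))) hCf)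
  have hminor : ∀ I, |minor b I fun c => G.Ad g (e c)| ≤ M := by
    intro I
    have h1 := Matrix.det_le (A := Matrix.of fun a c => b.coord (I a) (G.Ad g (e c)))
      (abv := AbsoluteValue.abs) (x := Cf * (R * R * S)) fun i j => hcoord _ _ _ ((heE j).trans
        (by rw [hS, add_assoc]; exact le_add_of_nonneg_right (by positivity)))
    rw [Fintype.card_fin, nsmul_eq_mul] at h1
    rw [hM]
    exact h1
  have hL' : 0 ≤ L * (Cf * (R * R * C₁)) := by positivity
  refine ⟨fun I => (hminor I).trans ?_, ?_⟩
  · have : 0 ≤ C₂ * C₁ * M := by positivity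
    linarith
  -- Replacing `Ad(u) e_c` by a nearby `Z_c ∈ 𝔥` reduces the comparison to `𝔥` itself, where passing
  -- from `e` to `Z` multiplies all minors by the same number `det Z ≈ ±1`.
  choose Z hZ hYZ using fun c => happ u t hu1 hu2 (e c) (e c).2
  have hYZ' : ∀ c, matNorm (G.Ad u (e c) - Z c).1 ≤ C₁ * ε := fun c =>
    (hYZ c).trans (mul_le_mul_of_nonneg_right (mul_le_mul_of_nonneg_left (heE c) hC₀) hε0)
  have hY : ∀ c, matNorm (G.Ad u (e c)).1 ≤ K * E := fun c =>
    (matNorm_Ad_le_of_dev_le hu _).trans (mul_le_mul_of_nonneg_left (heE c) hK0)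
  have hY' : ∀ c, matNorm (G.Ad u (e c)).1 ≤ S := fun c => (hY c).trans (by rw [hS]; linarith)
  have hZS : ∀ c, matNorm (Z c).1 ≤ S := by
    intro c
    have h1 := matNorm_sub_le (G.Ad u (e c)).1 (G.Ad u (e c) - Z c).1
    rw [show (G.Ad u (e c)).1 - (G.Ad u (e c) - Z c).1 = (Z c).1 by
      rw [coe_sub, sub_sub_cancel]] at h1
    have h2 : C₁ * ε ≤ C₁ := mul_le_of_le_one_right hC₁0 hε1
    have h3 := hYZ' c
    have h4 := hY c
    rw [hS]
    linarith
  set Z' : Fin r → h := fun c => ⟨Z c, hZ c⟩ with hZ'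
  obtain ⟨σ, hσ, hσd⟩ := hsign (fun c => G.Ad u (e c)) Z' (C₁ * ε) (by positivity)
    (fun i j => hinv u _ _) hY' hZS hYZ'
  refine ⟨σ, hσ, fun I => ?_⟩
  have h1 : (minor b I fun c => G.Ad g (Z c)) = e.det Z' * minor b I fun c => G.Ad g (e c) :=
    det_apply_eq e (fun a => (b.coord (I a)).comp ((G.Ad g).comp h.toSubmodule.subtype)) Z'
  have h2 : |(minor b I fun c => G.Ad (g * u) (e c)) - minor b I fun c => G.Ad g (Z c)| ≤
      L * (Cf * (R * R * (C₁ * ε))) := by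
    refine hdet _ _ _ (by positivity) (fun i j => ?_) (fun i j => ?_) (fun i j => ?_)
    · change |b.coord (I i) (G.Ad (g * u) (e j))| ≤ _
      rw [Ad_mul]; exact hcoord _ _ _ (hY' j)
    · rw [Matrix.of_apply]; exact hcoord _ _ _ (hZS j)
    · change |b.coord (I i) (G.Ad (g * u) (e j)) - b.coord (I i) (G.Ad g (Z j))| ≤ _
      rw [Ad_mul, ← map_sub, ← map_sub]
      exact hcoord _ _ _ (hYZ' j)
  have h3 : |(minor b I fun c => G.Ad g (Z c)) - σ * minor b I fun c => G.Ad g (e c)| ≤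
      C₂ * (C₁ * ε) * M := by
    rw [h1, ← sub_mul, abs_mul]
    exact mul_le_mul hσd (hminor I) (abs_nonneg _) (by positivity)
  have h4 := abs_sub_le (minor b I fun c => G.Ad (g * u) (e c)) (minor b I fun c => G.Ad g (Z c))
    (σ * minor b I fun c => G.Ad g (e c))
  have h5 : 0 ≤ M * ε := by positivity
  linarith

/-- The minors of the Cartan subalgebra of a periodic orbit. -/
theorem IsIntegralStructure.exists_minor_scale {P : GL (Fin N) ℝ} (hP : Diagonalizes P h)
    (hh : h.IsCartanSubalgebra) (hΓ : Γ.Commensurable G.integerPoints)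
    (hB : G.IsIntegralStructure Γ gZ B) {r d : ℕ} (e : Module.Basis (Fin r) ℝ h)
    (hb0 : (Matrix.of fun i j => B (e i) (e j)).det ≠ 0)
    {b : Module.Basis (Fin d) ℤ gZ} {b' : Module.Basis (Fin d) ℝ G.lieAlg}
    (hb : ∀ i, b' i = b i) {y : G.RealPoints}
    (hper : HomSpace.IsPeriodic Γ (G.cartanSubgroup h) y) :
    0 < G.disc gZ B h y ∧ ∃ c : ℝ,
      c ^ 2 * G.disc gZ B h y = |(Matrix.of fun i j => B (e i) (e j)).det| ∧
      ∀ γ ∈ Γ, ∀ a ∈ G.cartanSubgroup h, ∀ I : Fin r → Fin d,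
        ∃ k : ℤ, (minor b' I fun c => G.Ad (γ * y * a) (e c)) = c * k := by
  have ht := hP.span_eq_of_isPeriodic hh hΓ hB hper
  have hinj : Function.Injective (G.Ad y) := fun X Y hXY => by
    rw [← G.Ad_one X, ← G.Ad_one Y, ← inv_mul_cancel y, Ad_mul, Ad_mul, hXY]
  let f : Module.Basis (Fin r) ℝ (h.toSubmodule.map (G.Ad y)) :=
    Module.Basis.map (M := h.toSubmodule) e (Submodule.equivMapOfInjective (G.Ad y) hinj h.toSubmodule)
  have hf : ∀ c, (f c : G.lieAlg) = G.Ad y (e c) := fun c => rfl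
  have hgram : (Matrix.of fun i j => B (f i) (f j)) = Matrix.of fun i j => B (e i) (e j) := by
    ext i j
    rw [Matrix.of_apply, Matrix.of_apply, hf, hf, hB.invariant]
  obtain ⟨hpos, c, hc, hcψ⟩ := hB.exists_discSub_scale ht f (by rwa [hgram])
  refine ⟨hpos, c, by rw [← hgram]; exact hc, fun γ hγ a ha I => ?_⟩
  -- `Ad(γ)` preserves the lattice and `H` acts trivially on `𝔥`, so one scale `c` serves all
  -- representatives `γ y a` of the points of the orbit.
  obtain ⟨k, hk⟩ := hcψ (fun i => (b'.coord (I i)).comp (G.Ad γ)) fun i X hX =>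
    ⟨_, repr_eq_intCast hb (hB.ad_mem γ hγ X hX) (I i)⟩
  refine ⟨k, hk ▸ ?_⟩
  rw [minor]
  congr 1
  ext i j
  rw [Matrix.of_apply, Matrix.of_apply, Ad_mul, ha _ (e j).2, Ad_mul, hf]
  rfl

/-- Two nearby points of periodic orbits of bounded discriminant whose trajectories stay close for
a long time lie on the same local orbit. -/
theorem IsIntegralStructure.exists_separation {P : GL (Fin N) ℝ} (hP : Diagonalizes P h)
    (hh : h.IsCartanSubalgebra) (hΓ : Γ.Commensurable G.integerPoints)
    (hB : G.IsIntegralStructure Γ gZ B) {x : h} (hx : 0 < G.minAbsRoot h x) (R : ℝ) :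
    ∃ C, 0 ≤ C ∧ ∀ (y y' g u : G.RealPoints) (t κ : ℕ) (Δ : ℝ),
      HomSpace.IsPeriodic Γ (G.cartanSubgroup h) y →
      HomSpace.IsPeriodic Γ (G.cartanSubgroup h) y' →
      ((κ = 1 ∧ (G.disc gZ B h y : ℝ) ≤ Δ ∧ (G.disc gZ B h y' : ℝ) ≤ Δ) ∨
        (κ = 2 ∧ (G.disc gZ B h y : ℝ) = Δ ∧ (G.disc gZ B h y' : ℝ) = Δ)) →
      C * Real.exp (-(t * G.minAbsRoot h x)) ^ κ * Δ < 1 →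
      HomSpace.mk Γ g ∈ HomSpace.orbit Γ (G.cartanSubgroup h) y →
      HomSpace.mk Γ (g * u) ∈ HomSpace.orbit Γ (G.cartanSubgroup h) y' →
      matNorm (G.toMat g) ≤ R → matNorm (G.toMat g⁻¹) ≤ R → G.dev u ≤ 1 / 2 →
      G.dev (G.exp (x : G.lieAlg) ^ t * u * (G.exp (x : G.lieAlg) ^ t)⁻¹) ≤ 1 / 2 →
      G.dev ((G.exp (x : G.lieAlg) ^ t)⁻¹ * u * G.exp (x : G.lieAlg) ^ t) ≤ 1 / 2 →
      ∀ X ∈ h, G.Ad u X ∈ h := by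
  obtain ⟨d, b, b', hb⟩ := hB.exists_basis
  let e : Module.Basis (Fin (Module.finrank ℝ h)) ℝ h := Module.finBasis ℝ h
  have hb0 := hP.det_form_ne_zero hh hx hB.nondegenerate hB.invariant e
  obtain ⟨C, hC, hest⟩ := hP.exists_minor_estimate hh hx hB.nondegenerate hB.invariant e b' R
  refine ⟨2 * C ^ 2 / |(Matrix.of fun i j => B (e i) (e j)).det|, by positivity,
    fun y y' g u t κ Δ hy hy' hκ hsmall hg hgu hgR hgR' hu hu1 hu2 => ?_⟩
  obtain ⟨hn, c, hc, hck⟩ := hB.exists_minor_scale hP hh hΓ e hb0 hb hy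
  obtain ⟨hn', c', hc', hck'⟩ := hB.exists_minor_scale hP hh hΓ e hb0 hb hy'
  obtain ⟨γ, hγ, a, ha, hga⟩ := (HomSpace.mem_orbit_iff Γ _).1 hg
  obtain ⟨γ', hγ', a', ha', hga'⟩ := (HomSpace.mem_orbit_iff Γ _).1 hgu
  obtain ⟨hqC, σ, hσ, hqq⟩ := hest g u t hgR hgR' hu hu1 hu2
  have hprop := minors_proportional hC (abs_pos.2 hb0) hn hn' hc hc'
    (fun I => hga ▸ hck γ hγ a ha I) (fun I => hga' ▸ hck' γ' hγ' a' ha' I) hqC hσ hqq hκ hsmall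
  have hinj : ∀ g : G.RealPoints, Function.Injective (G.Ad g) := fun g X Y hXY => by
    rw [← G.Ad_one X, ← G.Ad_one Y, ← inv_mul_cancel g, Ad_mul, Ad_mul, hXY]
  have hli : ∀ g, LinearIndependent ℝ fun c => G.Ad g (e c : G.lieAlg) := fun g =>
    (e.linearIndependent.map' h.toSubmodule.subtype (Submodule.ker_subtype _)).map' (G.Ad g)
      (LinearMap.ker_eq_bot.2 (hinj g))
  have hspan : ∀ g, Submodule.span ℝ (Set.range fun c => G.Ad g (e c : G.lieAlg)) =
      h.toSubmodule.map (G.Ad g) := by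
    intro g
    have h1 : (Set.range fun c => G.Ad g (e c : G.lieAlg)) =
        (G.Ad g) '' (h.toSubmodule.subtype '' Set.range e) := by
      rw [← Set.range_comp, ← Set.range_comp]; rfl
    rw [h1, ← Submodule.map_span, ← Submodule.map_span]
    congr 1
    rw [show Submodule.span ℝ (Set.range e) = (⊤ : Submodule ℝ h.toSubmodule) from e.span_eq,
      Submodule.map_top, Submodule.range_subtype]
  intro X hX
  have h1 : G.Ad (g * u) X ∈ h.toSubmodule.map (G.Ad g) := by
    rw [← hspan]
    refine span_le_of_minors b' (hli g) (hli (g * u)) hprop ?_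
    rw [hspan]
    exact ⟨X, hX, rfl⟩
  obtain ⟨X', hX', hXX'⟩ := h1
  rw [Ad_mul] at hXX'
  rw [← hinj g hXX']
  exact hX'

end LinAlgGroup

/-! ## The measure of Bowen balls -/

namespace LinAlgGroup

variable {N : ℕ} {G : LinAlgGroup N} {Γ : Subgroup G.RealPoints} {gZ : Submodule ℤ G.lieAlg}
  {B : LinearMap.BilinForm ℝ G.lieAlg} {h : LieSubalgebra ℝ G.lieAlg}

/-- The part of a collection of periodic orbits of bounded discriminant in a long Bowen ball is
contained in a single local orbit. -/
theorem IsIntegralStructure.exists_bowen_bound {P : GL (Fin N) ℝ} (hP : Diagonalizes P h)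
    (hh : h.IsCartanSubalgebra) (hΓ : Γ.Commensurable G.integerPoints)
    (hB : G.IsIntegralStructure Γ gZ B) {x : h} (hx : 0 < G.minAbsRoot h x)
    (ν : Measure (G.cartanSubgroup h)) [ν.IsHaarMeasure] (R : ℝ) :
    ∃ C : ℝ, 0 ≤ C ∧ ∃ r₀ : ℝ, 0 < r₀ ∧ ∃ c : ℝ≥0∞, c ≠ ⊤ ∧
      ∀ (n : ℕ) (y : Fin n → G.RealPoints) (t κ : ℕ) (Δ r : ℝ) (A : Set (HomSpace Γ))
        (S : Set G.RealPoints),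
      (∀ j, HomSpace.IsPeriodic Γ (G.cartanSubgroup h) (y j)) →
      (Function.Injective fun j => HomSpace.orbit Γ (G.cartanSubgroup h) (y j)) →
      ((κ = 1 ∧ ∀ j, (G.disc gZ B h (y j) : ℝ) ≤ Δ) ∨
        (κ = 2 ∧ ∀ j, (G.disc gZ B h (y j) : ℝ) = Δ)) →
      C * Real.exp (-(t * G.minAbsRoot h x)) ^ κ * Δ < 1 → r ≤ r₀ →
      (∀ z ∈ A, ∃ q, matNorm (G.toMat q) ≤ R ∧ matNorm (G.toMat q⁻¹) ≤ R ∧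
        HomSpace.mk Γ q = HomSpace.rightMul Γ (G.exp (x : G.lieAlg) ^ t) z) →
      G.BowenSmall (G.exp (x : G.lieAlg)) r (2 * t) S →
      HomSpace.normalizedMeasure Γ (G.cartanSubgroup h) ν y (A ∩ HomSpace.mk Γ '' S) ≤
        (HomSpace.totalVolume Γ (G.cartanSubgroup h) ν y)⁻¹ * c := by
  have := discreteTopology_of_commensurable hΓ
  have := countable_of_commensurable hΓ
  have hHc : IsClosed (G.cartanSubgroup h : Set G.RealPoints) := isClosed_cartanSubgroup h
  obtain ⟨C, hC, hsep⟩ := hB.exists_separation hP hh hΓ hx R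
  obtain ⟨ρ₁, hρ₁, hnorm⟩ := hP.exists_normalizer_radius
  -- The compact neighbourhood `V` will contain every possible local piece; the Haar measure of `V ∩
  -- H` is the constant `c`.
  obtain ⟨V, hV, hV1⟩ := exists_compact_mem_nhds (1 : G.RealPoints)
  obtain ⟨ρ₂, hρ₂, hVr⟩ := G.exists_dev_lt_of_mem_nhds hV1
  set K : Set (G.cartanSubgroup h) := Subtype.val ⁻¹' V with hK
  have hKc : IsCompact K := hHc.isClosedEmbedding_subtypeVal.isCompact_preimage hV
  refine ⟨C, hC, min (1 / 2) (min ρ₁ ρ₂), by positivity, ν K, hKc.measure_ne_top,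
    fun n y t κ Δ r A S hper hdist hκ hsmall hr hA hS => ?_⟩
  set a := G.exp (x : G.lieAlg) with ha
  have hr1 : r ≤ 1 / 2 := hr.trans (min_le_left _ _)
  have hr2 : r ≤ ρ₁ := hr.trans ((min_le_right _ _).trans (min_le_left _ _))
  have hr3 : r ≤ ρ₂ := hr.trans ((min_le_right _ _).trans (min_le_right _ _))
  have haH : a ^ t ∈ G.cartanSubgroup h := (G.cartanSubgroup h).pow_mem (hP.exp_mem x) t
  rw [HomSpace.normalizedMeasure, Measure.smul_apply, smul_eq_mul, Measure.coe_finsetSum,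
    Finset.sum_apply]
  gcongr
  have hzero : ∀ j, (A ∩ HomSpace.mk Γ '' S ∩ HomSpace.orbit Γ (G.cartanSubgroup h) (y j) = ∅) →
      HomSpace.orbitMeasure Γ (G.cartanSubgroup h) ν (y j) (A ∩ HomSpace.mk Γ '' S) = 0 := fun j hj =>
    measure_mono_null (fun z hz hzj => (Set.eq_empty_iff_forall_notMem.1 hj) z ⟨hz, hzj⟩)
      (HomSpace.orbitMeasure_compl_orbit Γ (G.cartanSubgroup h) ν hHc (y j))
  by_cases hne : ∃ j₀, (A ∩ HomSpace.mk Γ '' S ∩ HomSpace.orbit Γ (G.cartanSubgroup h) (y j₀)).Nonempty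
  swap
  · push Not at hne
    rw [Finset.sum_eq_zero fun j _ => hzero j (hne j)]
    exact zero_le
  obtain ⟨j₀, z₀, ⟨hz₀A, g₀, hg₀, rfl⟩, hz₀⟩ := hne
  obtain ⟨q, hqR, hqR', hq⟩ := hA _ hz₀A
  rw [HomSpace.rightMul_mk] at hq
  obtain ⟨γ, hγ, hqγ⟩ := (HomSpace.mk_eq_mk_iff Γ).1 hq.symm
  have key : ∀ j, ∀ g ∈ S, HomSpace.mk Γ g ∈ HomSpace.orbit Γ (G.cartanSubgroup h) (y j) →
      ∃ u ∈ G.cartanSubgroup h, u ∈ V ∧ g = g₀ * u := by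
    intro j g hg hgj
    -- The base point is moved to the middle time `t`, where it has a bounded representative. The
    -- times `0` and `2t` become `-t` and `t`, so both expanding and contracting directions are
    -- controlled, and `t` need only be half the length.
    set u := (a ^ t)⁻¹ * (g₀⁻¹ * g) * a ^ t with hu
    have horb : ∀ {g' y' : G.RealPoints}, HomSpace.mk Γ g' ∈ HomSpace.orbit Γ (G.cartanSubgroup h) y' →
        HomSpace.mk Γ (g' * a ^ t) ∈ HomSpace.orbit Γ (G.cartanSubgroup h) y' := by
      rintro g' y' ⟨b, hb, hbe⟩
      refine ⟨b * a ^ t, (G.cartanSubgroup h).mul_mem hb haH, ?_⟩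
      rw [← HomSpace.rightMul_mk, hbe, HomSpace.rightMul_mk, mul_assoc]
    have hqu : HomSpace.mk Γ (q * u) = HomSpace.mk Γ (g * a ^ t) := by
      rw [← HomSpace.mk_mul_of_mem Γ hγ (g * a ^ t)]
      congr 1
      rw [hqγ, hu]
      group
    have hu0 : G.dev u < r := hS g₀ hg₀ g hg t (by omega)
    have hu1 : a ^ t * u * (a ^ t)⁻¹ = g₀⁻¹ * g := by rw [hu]; group
    have hu2 : (a ^ t)⁻¹ * u * a ^ t = (a ^ (2 * t))⁻¹ * (g₀⁻¹ * g) * a ^ (2 * t) := by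
      rw [hu, two_mul, pow_add]; group
    have hd1 := hS g₀ hg₀ g hg 0 (by omega)
    rw [pow_zero, inv_one, one_mul, mul_one] at hd1
    have hd2 := hS g₀ hg₀ g hg (2 * t) le_rfl
    have hκ' : (κ = 1 ∧ (G.disc gZ B h (y j₀) : ℝ) ≤ Δ ∧ (G.disc gZ B h (y j) : ℝ) ≤ Δ) ∨
        (κ = 2 ∧ (G.disc gZ B h (y j₀) : ℝ) = Δ ∧ (G.disc gZ B h (y j) : ℝ) = Δ) :=
      hκ.imp (fun hk => ⟨hk.1, hk.2 _, hk.2 _⟩) fun hk => ⟨hk.1, hk.2 _, hk.2 _⟩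
    have h1 := hsep (y j₀) (y j) q u t κ Δ (hper j₀) (hper j) hκ' hsmall
      (by rw [hq]; exact horb hz₀) (by rw [hqu]; exact horb hgj) hqR hqR' (hu0.le.trans hr1)
      (by rw [hu1]; exact hd1.le.trans hr1) (by rw [hu2]; exact hd2.le.trans hr1)
    have huH := hnorm u (hu0.trans_le hr2) h1
    refine ⟨g₀⁻¹ * g, ?_, hVr _ (hd1.trans_le hr3), by group⟩
    rw [← hu1]
    exact (G.cartanSubgroup h).mul_mem ((G.cartanSubgroup h).mul_mem haH huH) ((G.cartanSubgroup h).inv_mem haH)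
  obtain ⟨γ₀, hγ₀, b, hb, hg₀e⟩ := (HomSpace.mem_orbit_iff Γ (G.cartanSubgroup h)).1 hz₀
  -- Distinctness of the orbits is used here: a second orbit meeting the ball would coincide with
  -- that of `y j₀`.
  rw [Finset.sum_eq_single j₀ (fun j _ hj => hzero j ?_) fun hj => absurd (Finset.mem_univ _) hj]
  · have hsub : A ∩ HomSpace.mk Γ '' S ∩ HomSpace.orbit Γ (G.cartanSubgroup h) (y j₀) ⊆
        (fun u : G.cartanSubgroup h => HomSpace.mk Γ (γ₀ * y j₀ * (⟨b, hb⟩ : G.cartanSubgroup h) * u)) '' K := by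
      rintro _ ⟨⟨_, g, hg, rfl⟩, hgj⟩
      obtain ⟨u, hu, huV, rfl⟩ := key j₀ g hg hgj
      exact ⟨⟨u, hu⟩, huV, by rw [hg₀e]⟩
    refine le_trans ?_ (HomSpace.orbitMeasure_image_le Γ (G.cartanSubgroup h) ν (y j₀) hγ₀ ⟨b, hb⟩ hKc)
    -- The set `A ∩ mk Γ '' S` is not assumed measurable; it is split along the measurable orbit,
    -- whose complement is null.
    rw [← measure_inter_add_sdiff (A ∩ HomSpace.mk Γ '' S)
      (HomSpace.measurableSet_orbit Γ (G.cartanSubgroup h) hHc (y j₀))]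
    rw [measure_mono_null (Set.sdiff_subset_compl _ _)
      (HomSpace.orbitMeasure_compl_orbit Γ (G.cartanSubgroup h) ν hHc (y j₀)), add_zero]
    exact measure_mono hsub
  · refine Set.eq_empty_of_forall_notMem ?_
    rintro _ ⟨⟨_, g, hg, rfl⟩, hgj⟩
    obtain ⟨u, hu, huV, rfl⟩ := key j g hg hgj
    refine hj (hdist ?_)
    beta_reduce
    rw [← HomSpace.orbit_eq_of_mem Γ (G.cartanSubgroup h) hgj, ← HomSpace.orbit_eq_of_mem Γ (G.cartanSubgroup h) hz₀]
    exact HomSpace.orbit_eq_of_mem Γ (G.cartanSubgroup h) ⟨u, hu, rfl⟩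

end LinAlgGroup

/-! ## Partitions with null boundary -/

section Partition

/-- The label of a point depends only on which of the sets contain it, so it is locally constant
away from their frontiers. -/
theorem exists_partition_of_cover {X : Type*} [TopologicalSpace X] [MeasurableSpace X]
    [BorelSpace X] {μ : Measure X} {k : ℕ} {U : Fin k → Set X} (hU : ∀ j, IsOpen (U j))
    (hμ : ∀ j, μ (frontier (U j)) = 0) :
    ∃ P : X → Fin (k + 1), Measurable P ∧ (∀ w, μ (frontier (P ⁻¹' {w})) = 0) ∧
      (∀ z, P z = 0 → ∀ j, z ∉ U j) ∧ ∀ z j, P z = Fin.succ j → z ∈ U j := by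
  classical
  let φ : (Fin k → Prop) → Fin (k + 1) := fun s =>
    if h : ∃ j, s j then Fin.succ h.choose else 0
  have hφ0 : ∀ s, φ s = 0 → ∀ j, ¬ s j := by
    intro s hs j hj
    simp only [φ, dif_pos (⟨j, hj⟩ : ∃ j, s j)] at hs
    exact Fin.succ_ne_zero _ hs
  have hφs : ∀ s j, φ s = Fin.succ j → s j := by
    intro s j hs
    by_cases h : ∃ j, s j
    · simp only [φ, dif_pos h] at hs
      rw [← Fin.succ_injective _ hs]
      exact h.choose_spec
    · simp only [φ, dif_neg h] at hs
      exact absurd hs.symm (Fin.succ_ne_zero _)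
  let P : X → Fin (k + 1) := fun z => φ fun j => z ∈ U j
  have hm : Measurable fun z (j : Fin k) => z ∈ U j :=
    measurable_pi_lambda _ fun j => (hU j).measurableSet.mem
  refine ⟨P, (Measurable.of_discrete (f := φ)).comp hm, fun w => ?_, fun z hz j => hφ0 _ hz j,
    fun z j hz => hφs _ j hz⟩
  refine measure_mono_null (t := ⋃ j, frontier (U j)) (fun z hz => ?_) (measure_iUnion_null hμ)
  by_contra hcon
  simp only [Set.mem_iUnion, not_exists] at hcon
  have hloc : ∀ j, ∀ᶠ z' in 𝓝 z, (z' ∈ U j ↔ z ∈ U j) := by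
    intro j
    by_cases hz : z ∈ U j
    · filter_upwards [(hU j).mem_nhds hz] with z' hz'
      simp [hz, hz']
    · have h1 : z ∉ closure (U j) := fun h => hcon j ⟨h, by rwa [(hU j).interior_eq]⟩
      filter_upwards [isClosed_closure.isOpen_compl.mem_nhds h1] with z' hz'
      exact iff_of_false (fun h => hz' (subset_closure h)) hz
  have hP : ∀ᶠ z' in 𝓝 z, P z' = P z := by
    filter_upwards [eventually_all.2 hloc] with z' hz'
    change φ (fun j => z' ∈ U j) = φ fun j => z ∈ U j
    congr 1
    funext j
    exact propext (hz' j)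
  by_cases hw : P z = w
  · exact hz.2 (mem_interior_iff_mem_nhds.2 (hP.mono fun z' h => h.trans hw))
  · obtain ⟨z', hz', h2⟩ := (mem_closure_iff_frequently.1 hz.1).and_eventually hP |>.exists
    exact hw (h2.symm.trans hz')

/-- Frontiers of concentric balls with different radii are disjoint, so all but countably many radii
have null frontier. -/
theorem exists_null_frontier_nhd {X : Type*} [TopologicalSpace X] [T2Space X]
    [LocallyCompactSpace X] [SecondCountableTopology X] [MeasurableSpace X] [BorelSpace X]
    (μ : Measure X) [SFinite μ] {z : X} {W : Set X} (hW : W ∈ 𝓝 z) :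
    ∃ U, IsOpen U ∧ z ∈ U ∧ U ⊆ W ∧ μ (frontier U) = 0 := by
  let _ : MetricSpace X := TopologicalSpace.metrizableSpaceMetric X
  obtain ⟨ε, hε, hεW⟩ := Metric.mem_nhds_iff.1 hW
  obtain ⟨r, hr, hr0⟩ := exists_null_frontier_thickening μ {z} hε
  rw [Metric.thickening_singleton] at hr0
  exact ⟨Metric.ball z r, Metric.isOpen_ball, Metric.mem_ball_self hr.1,
    (Metric.ball_subset_ball hr.2.le).trans hεW, hr0⟩

end Partition

namespace LinAlgGroup

variable {N : ℕ} {G : LinAlgGroup N} {Γ : Subgroup G.RealPoints}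

theorem exists_compact_image (μ : Measure (HomSpace Γ)) [IsFiniteMeasure μ]
    (hΓ : Γ.Commensurable G.integerPoints) {ε : ℝ≥0∞} (hε : 0 < ε) :
    ∃ K : Set G.RealPoints, IsCompact K ∧ μ (HomSpace.mk Γ '' K)ᶜ < ε := by
  have := discreteTopology_of_commensurable hΓ
  have := HomSpace.t2Space Γ
  have h1 := tendsto_measure_iInter_atTop (μ := μ)
    (s := fun n => (HomSpace.mk Γ '' compactCovering G.RealPoints n)ᶜ)
    (fun n => (((isCompact_compactCovering _ n).image
      (HomSpace.continuous_mk Γ)).measurableSet.compl).nullMeasurableSet)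
    (fun m n hmn => Set.compl_subset_compl.2 (Set.image_mono (compactCovering_subset _ hmn)))
    ⟨0, measure_ne_top _ _⟩
  have h2 : ⋂ n, (HomSpace.mk Γ '' compactCovering G.RealPoints n)ᶜ = ∅ := by
    rw [← Set.compl_iUnion, ← Set.image_iUnion, iUnion_compactCovering, Set.image_univ,
      (HomSpace.mk_surjective Γ).range_eq, Set.compl_univ]
  rw [h2, measure_empty] at h1
  obtain ⟨n, hn⟩ := (h1.eventually (gt_mem_nhds hε)).exists
  exact ⟨_, isCompact_compactCovering _ n, hn⟩

/-- A finite partition into small pieces of a compact set and a remaining class. -/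
theorem exists_small_partition (μ : Measure (HomSpace Γ)) [IsFiniteMeasure μ]
    (hΓ : Γ.Commensurable G.integerPoints) {K : Set G.RealPoints} (hK : IsCompact K) {s : ℝ}
    (hs : 0 < s) : ∃ (k : ℕ) (P : HomSpace Γ → Fin (k + 1)), Measurable P ∧
      (∀ w, μ (frontier (P ⁻¹' {w})) = 0) ∧ P ⁻¹' {0} ⊆ (HomSpace.mk Γ '' K)ᶜ ∧
      ∀ j, j ≠ 0 → ∃ q ∈ K, ∀ z, P z = j → ∃ v, G.dev v < s ∧ HomSpace.mk Γ (q * v) = z := by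
  have := discreteTopology_of_commensurable hΓ
  have := HomSpace.t2Space Γ
  have := HomSpace.locallyCompactSpace Γ
  have := HomSpace.secondCountableTopology Γ
  have hnhd : ∀ q : G.RealPoints, HomSpace.mk Γ '' ((fun v => q * v) '' {v | G.dev v < s}) ∈
      𝓝 (HomSpace.mk Γ q) := by
    intro q
    refine (HomSpace.isOpenQuotientMap_mk Γ).isOpenMap.image_mem_nhds ?_
    have := (Homeomorph.mulLeft q).isOpenMap.image_mem_nhds (G.dev_lt_mem_nhds hs)
    simpa using this
  choose U hU hqU hUs hU0 using fun q => exists_null_frontier_nhd μ (hnhd q)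
  obtain ⟨F, hFK, hF⟩ := hK.elim_nhds_subcover (fun q => HomSpace.mk Γ ⁻¹' U q)
    fun q _ => ((hU q).preimage (HomSpace.continuous_mk Γ)).mem_nhds (hqU q)
  obtain ⟨P, hPm, hP0, hPz, hPs⟩ := exists_partition_of_cover (μ := μ)
    (U := fun j => U (F.equivFin.symm j : G.RealPoints)) (fun j => hU _) fun j => hU0 _
  refine ⟨F.card, P, hPm, hP0, ?_, fun j hj => ?_⟩
  · rintro z hz ⟨q, hq, rfl⟩
    obtain ⟨q', hq', hqq'⟩ := Set.mem_iUnion₂.1 (hF hq)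
    refine hPz _ hz (F.equivFin ⟨q', hq'⟩) ?_
    rw [Equiv.symm_apply_apply]
    exact hqq'
  · obtain ⟨j', rfl⟩ := Fin.exists_succ_eq.2 hj
    refine ⟨_, hFK _ (F.equivFin.symm j').2, fun z hz => ?_⟩
    obtain ⟨_, ⟨v, hv, rfl⟩, hvz⟩ := hUs _ (hPs z j' hz)
    exact ⟨v, hv, hvz⟩

end LinAlgGroup

/-! ## The normalized measures -/

namespace HomSpace

variable {G : Type} [Group G] [TopologicalSpace G] [MeasurableSpace G] (Γ H : Subgroup G)
  (ν : Measure H)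

theorem isProbabilityMeasure_normalizedMeasure {n : ℕ} {y : Fin n → G}
    (h0 : totalVolume Γ H ν y ≠ 0) (ht : totalVolume Γ H ν y ≠ ⊤) :
    IsProbabilityMeasure (normalizedMeasure Γ H ν y) := by
  refine ⟨?_⟩
  rw [normalizedMeasure, Measure.smul_apply, smul_eq_mul, Measure.coe_finsetSum, Finset.sum_apply]
  exact ENNReal.inv_mul_cancel h0 ht

theorem map_rightMul_normalizedMeasure [IsTopologicalGroup G] [BorelSpace G] [ν.IsHaarMeasure]
    [Countable Γ] {n : ℕ} (y : Fin n → G)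
    {a : H} (ha : a ∈ Subgroup.center H) :
    (normalizedMeasure Γ H ν y).map (rightMul Γ a) = normalizedMeasure Γ H ν y := by
  rw [normalizedMeasure, Measure.map_smul]
  congr 1
  ext s hs
  rw [Measure.map_apply (continuous_rightMul Γ a).measurable hs, Measure.coe_finsetSum,
    Finset.sum_apply, Finset.sum_apply]
  refine Finset.sum_congr rfl fun j _ => ?_
  rw [← Measure.map_apply (continuous_rightMul Γ a).measurable hs, map_rightMul_orbitMeasure Γ H ν _ ha]

/-- The total volume is eventually finite if the normalized measures converge to a probability
measure. -/
theorem eventually_totalVolume_ne_top [T2Space (HomSpace Γ)] [LocallyCompactSpace (HomSpace Γ)]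
    [SecondCountableTopology (HomSpace Γ)] {n : ℕ → ℕ} {y : (i : ℕ) → Fin (n i) → G}
    {μ : Measure (HomSpace Γ)} [IsProbabilityMeasure μ]
    (hμ : ∀ f : CompactlySupportedContinuousMap (HomSpace Γ) ℝ,
      Tendsto (fun i => ∫ z, f z ∂(normalizedMeasure Γ H ν (y i))) atTop (𝓝 (∫ z, f z ∂μ))) :
    ∀ᶠ i in atTop, totalVolume Γ H ν (y i) ≠ ⊤ := by
  by_contra hcon
  rw [not_eventually] at hcon
  have h1 : μ = 0 := by
    refine Measure.ext_of_integral_eq_on_compactlySupported fun f => ?_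
    rw [integral_zero_measure]
    refine isClosed_singleton.mem_of_frequently_of_tendsto (hcon.mono fun i hi => ?_) (hμ f)
    push Not at hi
    -- An infinite total volume has inverse zero, so the normalized measure is the zero measure;
    -- infinitely many such indices would force `μ = 0`.
    rw [normalizedMeasure, hi, ENNReal.inv_top, zero_smul, integral_zero_measure]
    rfl
  exact IsProbabilityMeasure.ne_zero μ h1

end HomSpace

/-- A time at which an exponentially decaying quantity beats a given growing sequence. -/
theorem exists_times {Δ : ℕ → ℝ} (hΔ : Tendsto Δ atTop atTop) {m C : ℝ} (hm : 0 < m) (hC : 0 ≤ C)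
    {κ : ℕ} (hκ : 0 < κ) : ∃ (t : ℕ → ℕ) (D : ℝ), Tendsto t atTop atTop ∧
      ∀ᶠ i in atTop, C * Real.exp (-(t i * m)) ^ κ * Δ i < 1 ∧
        t i * (κ * m) ≤ Real.log (Δ i) + D := by
  have hs : 0 < κ * m := by positivity
  -- Up to rounding, this solves `e^{t κ m} = (C + 1) Δ`. Using `C + 1` covers `C = 0` and makes the
  -- final inequality strict; rounding costs at most `κ m`, absorbed in `D`.
  set t : ℕ → ℕ := fun i => ⌈(Real.log (Δ i) + Real.log (C + 1)) / (κ * m)⌉₊ with ht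
  have hlog : Tendsto (fun i => Real.log (Δ i)) atTop atTop := Real.tendsto_log_atTop.comp hΔ
  have hnum : Tendsto (fun i => (Real.log (Δ i) + Real.log (C + 1)) / (κ * m)) atTop atTop :=
    (tendsto_atTop_add_const_right _ _ hlog).atTop_div_const hs
  refine ⟨t, Real.log (C + 1) + κ * m, tendsto_nat_ceil_atTop.comp hnum, ?_⟩
  filter_upwards [hΔ.eventually_gt_atTop 0, hnum.eventually_ge_atTop 0] with i hi hi0
  constructor
  · have h1 : Real.log (Δ i) + Real.log (C + 1) ≤ t i * (κ * m) :=
      (div_le_iff₀ hs).1 (Nat.le_ceil _)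
    have h2 : Real.exp (-(t i * m)) ^ κ = Real.exp (-(t i * (κ * m))) := by
      rw [← Real.exp_nat_mul]; congr 1; ring
    have h3 : Real.exp (-(t i * (κ * m))) ≤ (Δ i * (C + 1))⁻¹ := by
      rw [Real.exp_neg]
      refine inv_anti₀ (by positivity) ?_
      rw [← Real.log_mul hi.ne' (by positivity)] at h1
      exact (Real.log_le_iff_le_exp (by positivity)).1 h1
    rw [h2]
    calc C * Real.exp (-(t i * (κ * m))) * Δ i ≤ C * (Δ i * (C + 1))⁻¹ * Δ i := by gcongr
      _ = C / (C + 1) := by field_simp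
      _ < 1 := (div_lt_one (by positivity)).2 (by linarith)
  · have h1 := (Nat.ceil_lt_add_one hi0).le
    have h2 := mul_le_mul_of_nonneg_right h1 hs.le
    rw [add_mul, div_mul_cancel₀ _ hs.ne', one_mul] at h2
    linarith

/-! ### From measures of Bowen balls to entropy of long itineraries. -/

namespace LinAlgGroup

variable {N : ℕ} {G : LinAlgGroup N} {Γ : Subgroup G.RealPoints} {gZ : Submodule ℤ G.lieAlg}
  {B : LinearMap.BilinForm ℝ G.lieAlg} {h : LieSubalgebra ℝ G.lieAlg}

/-- A lower bound for the entropy of long itineraries from bounds for Bowen balls. -/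
theorem le_partitionEntropy_of_bowen {a : G.RealPoints} {r C : ℝ}
    (hC1 : 1 ≤ C) (hC : ∀ u, G.dev (a⁻¹ * u * a) ≤ C * G.dev u) (hr : 0 < r)
    (hCr : C * r ≤ 1 / 2) {M : ℕ} {cell : Matrix (Fin N) (Fin N) ℝ → Fin M}
    (hcell : ∀ A B, matNorm A ≤ C * r → matNorm B ≤ C * r → cell A = cell B →
      matNorm (A - B) ≤ r / 4) {k : ℕ} {P : HomSpace Γ → Fin (k + 1)} (hPm : Measurable P)
    (hP : ∀ j, j ≠ 0 → ∃ q, (∀ γ ∈ Γ, G.dev (q⁻¹ * γ * q) < 4 * C * r → γ = 1) ∧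
      ∀ z, P z = j → ∃ v, G.dev v < r / 8 ∧ HomSpace.mk Γ (q * v) = z)
    {m : Measure (HomSpace Γ)} [IsProbabilityMeasure m]
    (hm : MeasurePreserving (HomSpace.rightMul Γ a) m m) (t : ℕ) {δ : ℝ} (hδ : 0 < δ)
    (hδ1 : 3 * δ ≤ 1) (h0 : m.real (P ⁻¹' {0}) ≤ δ ^ 2) {κ₀ ξ : ℝ}
    (hκ₀ : ∀ A S, (∀ z ∈ A, P (HomSpace.rightMul Γ (a ^ t) z) ≠ 0) → G.BowenSmall a r (2 * t) S →
      m (A ∩ HomSpace.mk Γ '' S) ≤ ENNReal.ofReal κ₀) (hκ₀' : 0 < κ₀) (hξ : 0 ≤ ξ)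
    (hξκ : ξ ≤ -Real.log κ₀ - δ * (2 * t + 1 : ℕ) * Real.log M) :
    (1 - 3 * δ) * ξ ≤ partitionEntropy m (itinerary (HomSpace.rightMul Γ a) P (2 * t + 1)) := by
  classical
  have hM : 0 < M := (cell 0).pos
  have hM1 : (1 : ℝ) ≤ M := by exact_mod_cast hM
  -- This is `M^{δ L} κ₀` with `L = 2 t + 1`: the Bowen ball bound times the cost of a proportion
  -- `δ` of visits to the cusp.
  set κ := Real.exp (δ * (2 * t + 1 : ℕ) * Real.log M) * κ₀ with hκ
  have hlogκ : -Real.log κ = -Real.log κ₀ - δ * (2 * t + 1 : ℕ) * Real.log M := by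
    rw [hκ, Real.log_mul (Real.exp_pos _).ne' hκ₀'.ne', Real.log_exp]; ring
  have hgood := measureReal_goodItineraries hm hPm t hδ (by linarith) h0
  refine le_trans ?_ (le_partitionEntropy_of_atoms m
    (fun w => measurableSet_itinerary hm.measurable hPm (2 * t + 1) {w})
    (goodItineraries k t δ) (κ := κ) fun w hw => ?_)
  · rw [hlogκ]
    exact mul_le_mul hgood hξκ hξ measureReal_nonneg
  obtain ⟨hw0, hwt, hwc⟩ := hw
  -- Only times up to `2 t` are used, so the default value beyond the length of `w` is irrelevant.
  set w' : ℕ → Fin (k + 1) := fun i => if hi : i < 2 * t + 1 then w ⟨i, hi⟩ else 0 with hw'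
  have hA : ∀ z ∈ itinerary (HomSpace.rightMul Γ a) P (2 * t + 1) ⁻¹' {w}, ∀ i ≤ 2 * t,
      P (HomSpace.rightMul Γ (a ^ i) z) = w' i := by
    intro z hz i hi
    have h1 := congrFun (Set.mem_singleton_iff.1 hz) ⟨i, by omega⟩
    rw [itinerary, HomSpace.iterate_rightMul] at h1
    rw [h1, hw']
    simp only
    rw [dif_pos (by omega)]
  have hcard : ((Finset.range (2 * t + 1)).filter fun i => w' i = 0).card =
      (Finset.univ.filter fun m => w m = 0).card := by
    rw [Finset.card_filter, Finset.card_filter, Finset.sum_range]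
    refine Finset.sum_congr rfl fun i _ => ?_
    rw [hw']
    simp only [i.2, dif_pos]
  have h1 := measure_itinerary_le hC1 hC hr hCr hcell hP m w' (by simpa [hw'] using hw0) (2 * t)
    hA (κ₀ := ENNReal.ofReal κ₀) fun S hS => hκ₀ _ S (fun z hz => by
      rw [hA z hz t (by omega), hw']
      simp only
      rw [dif_pos (by omega)]
      exact hwt) hS
  rw [hcard] at h1
  refine ENNReal.toReal_le_of_le_ofReal (by positivity) (h1.trans ?_)
  rw [hκ, ENNReal.ofReal_mul (Real.exp_pos _).le]
  gcongr
  rw [← ENNReal.ofReal_natCast, ← ENNReal.ofReal_pow (by positivity)]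
  refine ENNReal.ofReal_le_ofReal ?_
  rw [← Real.rpow_natCast, Real.rpow_def_of_pos (by positivity), mul_comm]
  exact Real.exp_le_exp.2 (mul_le_mul_of_nonneg_right hwc (Real.log_nonneg hM1))

end LinAlgGroup

/-! ## The entropy bound -/

namespace LinAlgGroup

variable {N : ℕ} {G : LinAlgGroup N} {Γ : Subgroup G.RealPoints} {gZ : Submodule ℤ G.lieAlg}
  {B : LinearMap.BilinForm ℝ G.lieAlg} {h : LieSubalgebra ℝ G.lieAlg}

/-- The points of the partition pieces outside class `0` have representatives `q v`; bounding these
and their inverses makes the Plücker estimates uniform. -/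
theorem exists_norm_bound {K : Set G.RealPoints} (hK : IsCompact K) : ∃ R : ℝ, ∀ q ∈ K,
    ∀ v, G.dev v ≤ 1 / 2 → matNorm (G.toMat (q * v)) ≤ R ∧ matNorm (G.toMat (q * v)⁻¹) ≤ R := by
  obtain ⟨R₁, hR₁⟩ := (hK.image (continuous_matNorm.comp G.continuous_toMat)).bddAbove
  obtain ⟨R₂, hR₂⟩ := (hK.image
    (continuous_matNorm.comp (G.continuous_toMat.comp continuous_inv))).bddAbove
  set n := matNorm (1 : Matrix (Fin N) (Fin N) ℝ)
  have hn : 0 ≤ n := matNorm_nonneg _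
  refine ⟨max R₁ R₂ * (n + 1), fun q hq v hv => ?_⟩
  have h1 : matNorm (G.toMat q) ≤ max R₁ R₂ := (hR₁ ⟨q, hq, rfl⟩).trans (le_max_left _ _)
  have h2 : matNorm (G.toMat q⁻¹) ≤ max R₁ R₂ := (hR₂ ⟨q, hq, rfl⟩).trans (le_max_right _ _)
  have h0 : 0 ≤ max R₁ R₂ := (matNorm_nonneg _).trans h1
  have h3 : matNorm (G.toMat v) ≤ n + 1 := (matNorm_toMat_le v).trans (by linarith)
  have h4 : matNorm (G.toMat v⁻¹) ≤ n + 1 := by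
    have := G.dev_inv_le hv
    exact (matNorm_toMat_le v⁻¹).trans (by linarith)
  constructor
  · rw [toMat_mul]
    exact (matNorm_mul_le _ _).trans (mul_le_mul h1 h3 (matNorm_nonneg _) h0)
  · rw [mul_inv_rev, toMat_mul, mul_comm (max R₁ R₂)]
    exact (matNorm_mul_le _ _).trans (mul_le_mul h4 h2 (matNorm_nonneg _) (by linarith))

/-- The entropy bound for a fixed proportion `δ` of time spent in the cusp. -/
theorem IsIntegralStructure.le_metricEntropy_of_cusp {P : GL (Fin N) ℝ} (hP : Diagonalizes P h)
    (hh : h.IsCartanSubalgebra) (hΓ : Γ.Commensurable G.integerPoints)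
    (hB : G.IsIntegralStructure Γ gZ B) {x : h} (hx : 0 < G.minAbsRoot h x)
    (ν : Measure (G.cartanSubgroup h)) [ν.IsHaarMeasure] {ρ : ℝ} (hρ : 0 < ρ)
    {n : ℕ → ℕ} {y : (i : ℕ) → Fin (n i) → G.RealPoints} {Δ : ℕ → ℝ}
    (hper : ∀ i j, HomSpace.IsPeriodic Γ (G.cartanSubgroup h) (y i j))
    (hdist : ∀ i, Function.Injective fun j => HomSpace.orbit Γ (G.cartanSubgroup h) (y i j))
    (hΔ : Tendsto Δ atTop atTop)
    (hvol : ∀ i, ENNReal.ofReal (Δ i ^ ρ) <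
      HomSpace.totalVolume Γ (G.cartanSubgroup h) ν (y i))
    (hfin : ∀ i, HomSpace.totalVolume Γ (G.cartanSubgroup h) ν (y i) ≠ ⊤)
    (μ : Measure (HomSpace Γ)) [IsProbabilityMeasure μ]
    (hμ : ∀ f : CompactlySupportedContinuousMap (HomSpace Γ) ℝ,
      Tendsto (fun i => ∫ z, f z ∂(HomSpace.normalizedMeasure Γ (G.cartanSubgroup h) ν (y i)))
        atTop (𝓝 (∫ z, f z ∂μ)))
    {κ : ℕ} (hκ : (κ = 1 ∧ ∀ i j, (G.disc gZ B h (y i j) : ℝ) ≤ Δ i) ∨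
      (κ = 2 ∧ ∀ i j, (G.disc gZ B h (y i j) : ℝ) = Δ i))
    {Ca : ℝ} (hCa1 : 1 ≤ Ca) (hCa : ∀ u, G.dev ((G.exp (x : G.lieAlg))⁻¹ * u * G.exp (x : G.lieAlg)) ≤
      Ca * G.dev u) {M : ℕ} (hM : ∀ r > 0, ∃ cell : Matrix (Fin N) (Fin N) ℝ → Fin M,
        ∀ A B, matNorm A ≤ Ca * r → matNorm B ≤ Ca * r → cell A = cell B → matNorm (A - B) ≤ r / 4)
    {δ : ℝ} (hδ : 0 < δ) (hδ1 : 3 * δ ≤ 1)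
    (hη : 0 ≤ ρ * (κ * G.minAbsRoot h x) / 2 - δ * Real.log M - δ) :
    ENNReal.ofReal ((1 - 3 * δ) * (ρ * (κ * G.minAbsRoot h x) / 2 - δ * Real.log M - δ)) ≤
      metricEntropy μ (HomSpace.rightMul Γ (G.exp (x : G.lieAlg))) := by
  have := discreteTopology_of_commensurable hΓ
  have := countable_of_commensurable hΓ
  have := HomSpace.t2Space Γ
  have := HomSpace.locallyCompactSpace Γ
  have := HomSpace.secondCountableTopology Γ
  set m := G.minAbsRoot h x with hm
  set a := G.exp (x : G.lieAlg) with ha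
  have hκ0 : 0 < κ := by rcases hκ with h | h <;> omega
  have hprob : ∀ i, IsProbabilityMeasure
      (HomSpace.normalizedMeasure Γ (G.cartanSubgroup h) ν (y i)) := fun i =>
    HomSpace.isProbabilityMeasure_normalizedMeasure Γ _ ν ((zero_le).trans_lt (hvol i)).ne' (hfin i)
  have hinv : ∀ i, (HomSpace.normalizedMeasure Γ (G.cartanSubgroup h) ν (y i)).map
      (HomSpace.rightMul Γ a) = HomSpace.normalizedMeasure Γ (G.cartanSubgroup h) ν (y i) :=
    fun i => HomSpace.map_rightMul_normalizedMeasure Γ _ ν (y i) (hP.exp_mem_center x)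
  have hmp : ∀ i, MeasurePreserving (HomSpace.rightMul Γ a)
      (HomSpace.normalizedMeasure Γ (G.cartanSubgroup h) ν (y i))
      (HomSpace.normalizedMeasure Γ (G.cartanSubgroup h) ν (y i)) := fun i =>
    ⟨(HomSpace.continuous_rightMul Γ a).measurable, hinv i⟩
  have hmpμ : MeasurePreserving (HomSpace.rightMul Γ a) μ μ :=
    measurePreserving_of_vague_limit hμ (HomSpace.rightMulHomeomorph Γ a) hinv
  obtain ⟨K, hK, hKμ⟩ := exists_compact_image μ hΓ (ε := ENNReal.ofReal (δ ^ 2))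
    (ENNReal.ofReal_pos.2 (by positivity))
  obtain ⟨R, hR⟩ := exists_norm_bound hK
  obtain ⟨C, hC, r₀, hr₀, c, hc, hbowen⟩ := hB.exists_bowen_bound hP hh hΓ hx ν R
  obtain ⟨ρ₁, hρ₁, hinj⟩ := exists_injectivity_radius hΓ hK
  -- The three constraints are the scale of the Bowen ball bound, `Ca r ≤ 1/2`, and `4 Ca r ≤ ρ₁`
  -- for the injectivity radius.
  set r := min r₀ (min (1 / (2 * Ca)) (ρ₁ / (4 * Ca))) with hr
  have hCa0 : 0 < Ca := by linarith
  have hr0 : 0 < r := by positivity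
  have hr2 : Ca * r ≤ 1 / 2 := by
    have : r ≤ 1 / (2 * Ca) := (min_le_right _ _).trans (min_le_left _ _)
    calc Ca * r ≤ Ca * (1 / (2 * Ca)) := by gcongr
      _ = 1 / 2 := by field_simp
  have hr3 : 4 * Ca * r ≤ ρ₁ := by
    have : r ≤ ρ₁ / (4 * Ca) := (min_le_right _ _).trans (min_le_right _ _)
    calc 4 * Ca * r ≤ 4 * Ca * (ρ₁ / (4 * Ca)) := by gcongr
      _ = ρ₁ := by field_simp
  have hr4 : r ≤ 1 / 2 := by nlinarith
  obtain ⟨k, Q, hQm, hQf, hQ0, hQ⟩ := exists_small_partition μ hΓ hK (s := r / 8) (by positivity)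
  obtain ⟨cell, hcell⟩ := hM r hr0
  obtain ⟨t, D, ht, htD⟩ := exists_times hΔ hx hC hκ0
  -- Adding one makes the constant positive, so that its logarithm can be used.
  set c' := c.toReal + 1 with hc'
  have hc'0 : 0 < c' := by positivity
  have hμ0 : μ.real (Q ⁻¹' {0}) < δ ^ 2 := by
    refine (ENNReal.toReal_lt_of_lt_ofReal ((measure_mono hQ0).trans_lt hKμ))
  have hQ0i := (tendsto_measureReal_of_vague_limit hμ (hQf 0)).eventually (gt_mem_nhds hμ0)
  -- These are the constants lost in passing from `ρ log Δ - log c'` to `(ρ κ m / 2)(2 t + 1)`: the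
  -- additional time step, the rounding of `t`, and the Bowen ball constant. They are eventually
  -- below `δ (2 t + 1)`, whence the extra `- δ` in the bound.
  set D' := ρ * (κ * m) / 2 + ρ * D + Real.log c' with hD'
  have hL : Tendsto (fun i => 2 * t i + 1) atTop atTop :=
    tendsto_atTop_mono (fun i => by omega) ht
  have hLδ : ∀ᶠ i in atTop, D' ≤ δ * (2 * t i + 1 : ℕ) := by
    have h1 : Tendsto (fun i => δ * ((2 * t i + 1 : ℕ) : ℝ)) atTop atTop :=
      (tendsto_natCast_atTop_atTop.comp hL).const_mul_atTop hδ
    exact h1.eventually_ge_atTop D'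
  refine le_metricEntropy hQm fun l hl => ?_
  refine le_entropy_of_vague_limit (T := HomSpace.rightMulHomeomorph Γ a) hμ hmpμ hmp hQm hQf hL ?_ hl
  filter_upwards [htD, hQ0i, hLδ, hΔ.eventually_gt_atTop 0] with i hti hQi hLi hΔi
  rw [mul_assoc]
  refine le_partitionEntropy_of_bowen hCa1 hCa hr0 hr2 hcell hQm (fun j hj => ?_) (hmp i) (t i) hδ
    hδ1 hQi.le (κ₀ := c' / Δ i ^ ρ) (fun A S hA hS => ?_) (by positivity) (by positivity) ?_
  · obtain ⟨q, hq, hqz⟩ := hQ j hj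
    exact ⟨q, fun γ hγ hd => hinj q hq γ hγ (hd.trans_le hr3), hqz⟩
  · have hκi : (κ = 1 ∧ ∀ j, (G.disc gZ B h (y i j) : ℝ) ≤ Δ i) ∨
        (κ = 2 ∧ ∀ j, (G.disc gZ B h (y i j) : ℝ) = Δ i) :=
      hκ.imp (fun hk => ⟨hk.1, hk.2 i⟩) fun hk => ⟨hk.1, hk.2 i⟩
    refine (hbowen (n i) (y i) (t i) κ (Δ i) r A S (hper i) (hdist i) hκi hti.1 (min_le_left _ _)
      (fun z hz => ?_) hS).trans ?_
    · obtain ⟨q, hq, hqz⟩ := hQ _ (hA z hz)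
      obtain ⟨v, hv, hvz⟩ := hqz _ rfl
      have h1 := hR q hq v (by linarith)
      exact ⟨q * v, h1.1, h1.2, hvz⟩
    · have hpos : 0 < Δ i ^ ρ := Real.rpow_pos_of_pos hΔi ρ
      rw [div_eq_inv_mul, ENNReal.ofReal_mul (by positivity), ENNReal.ofReal_inv_of_pos hpos]
      refine mul_le_mul' (ENNReal.inv_le_inv.2 (hvol i).le) ?_
      rw [ENNReal.le_ofReal_iff_toReal_le hc hc'0.le]
      linarith
  · rw [Real.log_div hc'0.ne' (Real.rpow_pos_of_pos hΔi ρ).ne', Real.log_rpow hΔi]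
    have h1 := mul_le_mul_of_nonneg_left hti.2 hρ.le
    push_cast at hLi ⊢
    rw [hD'] at hLi
    nlinarith

/-- The entropy bound under either assumption on the discriminants. -/
theorem IsIntegralStructure.le_metricEntropy {P : GL (Fin N) ℝ} (hP : Diagonalizes P h)
    (hh : h.IsCartanSubalgebra) (hΓ : Γ.Commensurable G.integerPoints)
    (hB : G.IsIntegralStructure Γ gZ B) (x : h)
    (ν : Measure (G.cartanSubgroup h)) [ν.IsHaarMeasure] {ρ : ℝ} (hρ : 0 < ρ)
    {n : ℕ → ℕ} {y : (i : ℕ) → Fin (n i) → G.RealPoints} {Δ : ℕ → ℝ}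
    (hper : ∀ i j, HomSpace.IsPeriodic Γ (G.cartanSubgroup h) (y i j))
    (hdist : ∀ i, Function.Injective fun j => HomSpace.orbit Γ (G.cartanSubgroup h) (y i j))
    (hΔ : Tendsto Δ atTop atTop)
    (hvol : ∀ i, ENNReal.ofReal (Δ i ^ ρ) <
      HomSpace.totalVolume Γ (G.cartanSubgroup h) ν (y i))
    (μ : Measure (HomSpace Γ)) [IsProbabilityMeasure μ]
    (hμ : ∀ f : CompactlySupportedContinuousMap (HomSpace Γ) ℝ,
      Tendsto (fun i => ∫ z, f z ∂(HomSpace.normalizedMeasure Γ (G.cartanSubgroup h) ν (y i)))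
        atTop (𝓝 (∫ z, f z ∂μ)))
    {κ : ℕ} (hκ : (κ = 1 ∧ ∀ i j, (G.disc gZ B h (y i j) : ℝ) ≤ Δ i) ∨
      (κ = 2 ∧ ∀ i j, (G.disc gZ B h (y i j) : ℝ) = Δ i)) :
    ENNReal.ofReal (ρ * (κ * G.minAbsRoot h x) / 2) ≤
      metricEntropy μ (HomSpace.rightMul Γ (G.exp (x : G.lieAlg))) := by
  -- The bound is trivial if some root vanishes at `x`; this also covers an empty set of roots, for
  -- which the infimum is `0`.
  rcases le_or_gt (G.minAbsRoot h x) 0 with hx | hx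
  · rw [ENNReal.ofReal_of_nonpos]
    · exact zero_le
    · have := mul_nonpos_of_nonneg_of_nonpos (mul_nonneg hρ.le (Nat.cast_nonneg κ)) hx
      linarith
  have := discreteTopology_of_commensurable hΓ
  have := HomSpace.t2Space Γ
  have := HomSpace.locallyCompactSpace Γ
  have := HomSpace.secondCountableTopology Γ
  have hκ0 : 0 < κ := by rcases hκ with h | h <;> omega
  obtain ⟨i₀, hi₀⟩ := eventually_atTop.1 (HomSpace.eventually_totalVolume_ne_top Γ _ ν hμ)
  set a := G.exp (x : G.lieAlg) with ha
  set Ca := max 1 (matNorm (G.toMat a⁻¹) * matNorm (G.toMat a)) with hCad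
  have hCa : ∀ u, G.dev (a⁻¹ * u * a) ≤ Ca * G.dev u := fun u =>
    (G.dev_conj_le a u).trans (mul_le_mul_of_nonneg_right (le_max_right _ _) (G.dev_nonneg u))
  -- `M` depends only on the expansion of `a`, not on `δ` or on the partition, so `δ log M` tends to
  -- zero with `δ`.
  obtain ⟨M, hM⟩ := exists_cells (N := N) Ca
  have hpos : 0 < ρ * (κ * G.minAbsRoot h x) / 2 := by positivity
  have hlim : Tendsto (fun δ : ℝ => ρ * (κ * G.minAbsRoot h x) / 2 - δ * Real.log M - δ) (𝓝[>] 0)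
      (𝓝 (ρ * (κ * G.minAbsRoot h x) / 2)) := by
    refine Tendsto.mono_left ?_ nhdsWithin_le_nhds
    have : Continuous fun δ : ℝ => ρ * (κ * G.minAbsRoot h x) / 2 - δ * Real.log M - δ := by fun_prop
    simpa using this.tendsto 0
  have hlim' : Tendsto (fun δ : ℝ => (1 - 3 * δ) *
      (ρ * (κ * G.minAbsRoot h x) / 2 - δ * Real.log M - δ)) (𝓝[>] 0)
      (𝓝 (ρ * (κ * G.minAbsRoot h x) / 2)) := by
    have h1 : Tendsto (fun δ : ℝ => 1 - 3 * δ) (𝓝[>] 0) (𝓝 1) := by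
      refine Tendsto.mono_left ?_ nhdsWithin_le_nhds
      have : Continuous fun δ : ℝ => 1 - 3 * δ := by fun_prop
      simpa using this.tendsto 0
    simpa using h1.mul hlim
  refine le_of_tendsto (ENNReal.tendsto_ofReal hlim') ?_
  have h3 : ∀ᶠ δ : ℝ in 𝓝[>] 0, δ < 1 / 3 :=
    nhdsWithin_le_nhds (Iio_mem_nhds (by norm_num))
  filter_upwards [self_mem_nhdsWithin, h3, hlim.eventually (lt_mem_nhds hpos)] with δ hδ hδ1 hη
  -- The sequence is shifted by `i₀` to discard the finitely many indices whose total volume may be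
  -- infinite.
  refine hB.le_metricEntropy_of_cusp hP hh hΓ hx ν hρ (fun i => hper (i + i₀))
    (fun i => hdist (i + i₀)) (hΔ.comp (tendsto_add_atTop_nat i₀)) (fun i => hvol (i + i₀))
    (fun i => hi₀ (i + i₀) (Nat.le_add_left _ _)) μ
    (fun f => (hμ f).comp (tendsto_add_atTop_nat i₀)) ?_ (le_max_left _ _) hCa hM hδ
    (by linarith) hη.le
  exact hκ.imp (fun hk => ⟨hk.1, fun i => hk.2 _⟩) fun hk => ⟨hk.1, fun i => hk.2 _⟩

end LinAlgGroup

theorem theorem3p1 {N : ℕ} (G : LinAlgGroup N) (hG : G.IsSemisimple)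
    (Γ : Subgroup G.RealPoints) (hΓ : Γ.Commensurable G.integerPoints)
    (gZ : Submodule ℤ G.lieAlg) (B : LinearMap.BilinForm ℝ G.lieAlg)
    (hB : G.IsIntegralStructure Γ gZ B)
    (h : LieSubalgebra ℝ G.lieAlg) (hh : G.IsSplitCartan h)
    (ν : Measure (G.cartanSubgroup h)) [ν.IsHaarMeasure]
    (x : h) (ρ : ℝ) (hρ : 0 < ρ)
    (n : ℕ → ℕ) (y : (i : ℕ) → Fin (n i) → G.RealPoints) (Δ : ℕ → ℝ)
    (hper : ∀ i j, HomSpace.IsPeriodic Γ (G.cartanSubgroup h) (y i j))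
    (hdist : ∀ i, Function.Injective fun j => HomSpace.orbit Γ (G.cartanSubgroup h) (y i j))
    (hΔ : Tendsto Δ atTop atTop)
    (hvol : ∀ i, ENNReal.ofReal (Δ i ^ ρ) <
      HomSpace.totalVolume Γ (G.cartanSubgroup h) ν (y i))
    (μ : Measure (HomSpace Γ)) [IsProbabilityMeasure μ]
    (hμ : ∀ f : CompactlySupportedContinuousMap (HomSpace Γ) ℝ,
      Tendsto (fun i => ∫ z, f z ∂(HomSpace.normalizedMeasure Γ (G.cartanSubgroup h) ν (y i)))
        atTop (𝓝 (∫ z, f z ∂μ))) :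
    (∀ t : ℝ, MeasurePreserving
      (HomSpace.rightMul Γ (G.exp (t • (x : G.lieAlg)))) μ μ) ∧
    ((∀ i j, (G.disc gZ B h (y i j) : ℝ) ≤ Δ i) →
      ENNReal.ofReal (ρ * G.minAbsRoot h x / 2) ≤
        flowEntropy μ fun t => HomSpace.rightMul Γ (G.exp (t • (x : G.lieAlg)))) ∧
    ((∀ i j, (G.disc gZ B h (y i j) : ℝ) = Δ i) →
      ENNReal.ofReal (ρ * G.minAbsRoot h x) ≤
        flowEntropy μ fun t => HomSpace.rightMul Γ (G.exp (t • (x : G.lieAlg)))) := by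
  obtain ⟨P, hP⟩ := hh.split
  have hPd : LinAlgGroup.Diagonalizes P h := hP
  have := LinAlgGroup.discreteTopology_of_commensurable hΓ
  have := LinAlgGroup.countable_of_commensurable hΓ
  have := HomSpace.t2Space Γ
  have := HomSpace.locallyCompactSpace Γ
  have := HomSpace.secondCountableTopology Γ
  -- `exp(t x)` is central in `H`, so all the orbit measures, and hence their limit, are invariant
  -- under it.
  refine ⟨fun t => measurePreserving_of_vague_limit hμ
    (HomSpace.rightMulHomeomorph Γ (G.exp (t • (x : G.lieAlg)))) fun i =>
      HomSpace.map_rightMul_normalizedMeasure Γ _ ν (y i) (hPd.exp_mem_center (t • x)), ?_, ?_⟩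
  · intro hdisc
    have h1 := hB.le_metricEntropy hPd hh.cartan hΓ x ν hρ hper hdist hΔ hvol μ hμ
      (κ := 1) (Or.inl ⟨rfl, hdisc⟩)
    rw [Nat.cast_one, one_mul] at h1
    rw [flowEntropy, one_smul]
    exact h1
  · intro hdisc
    have h1 := hB.le_metricEntropy hPd hh.cartan hΓ x ν hρ hper hdist hΔ hvol μ hμ
      (κ := 2) (Or.inr ⟨rfl, hdisc⟩)
    rw [show ρ * (((2 : ℕ) : ℝ) * G.minAbsRoot h x) / 2 = ρ * G.minAbsRoot h x by push_cast; ring]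
      at h1
    rw [flowEntropy, one_smul]
    exact h1
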